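/- Let $\nu$ be a probability law on $(-\infty,+\infty]$ with $\nu(\{+\infty\})<1$ such that, for $\omega\sim\nu$ and every $t\in(0,\infty)$, $\mathbb E\,e^{-t\omega}<\infty$ (where $e^{-\infty}=0$), and put $\psi(t):=\log\mathbb E\,e^{-t\omega}$ for $t>0$. For each $n$ let $\boldsymbol\omega=(\omega_e)_{e\in E}$ be i.i.d. with law $\nu$, indexed by the edge set $E$ of the complete bipartite graph $K_{n,n}$. For a perfect matching $\pi$ of $K_{n,n}$ let $W(\pi)=\sum_{e\in\pi}\omega_e$, and for $\beta\in(0,\infty)$ let $$\mathbb P_{\beta,\boldsymbol\omega}(\pi)=\frac1{Z(\beta,\boldsymbol\omega)}\cdot\frac1{n!}\,e^{-\beta W(\pi)},\qquad Z(\beta,\boldsymbol\omega)=\frac1{n!}\sum_{\pi}e^{-\beta W(\pi)},$$ be the Gibbs measure on perfect matchings, defined when $Z(\beta,\boldsymbol\omega)>0$, and let $\langle\cdot\rangle_\beta$ denote the expectation under $\mathbb P_{\beta,\boldsymbol\omega}$ given $\boldsymbol\omega$. (On the event $Z(\beta,\boldsymbol\omega)=0$ any values may be used for the Gibbs sample,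 and Gibbs averages are set to $0$.) Then $\psi$ is twice continuously differentiable on $(0,\infty)$, and for every fixed $\beta\in(0,\infty)$ we have $\psi''(\beta)\ge0$ and, as $n\to\infty$: 1. If $\pi$ is sampled from $\mathbb P_{\beta,\boldsymbol\omega}$, then $$\frac1{\sqrt n}\bigl(W(\pi)+n\psi'(\beta)\bigr)\Rightarrow N\bigl(0,\psi''(\beta)\bigr),$$ both under the joint law of $(\boldsymbol\omega,\pi)$ and in the quenched sense: for every bounded continuous $f:\mathbb R\to\mathbb R$, the Gibbs average $\bigl\langle f\bigl(n^{-1/2}(W(\pi)+n\psi'(\beta))\bigr)\bigr\rangle_\beta$ converges in probability to $\mathbb E f(X)$, where $X\sim N(0,\psi''(\beta))$. 2. $\langle W(\pi)\rangle_\beta+n\psi'(\beta)\Rightarrow N(\mu,\sigma^2)$, where $$\mu=\bigl(\psi'(2\beta)-\psi'(\beta)\bigr)e^{\psi(2\beta)-2\psi(\beta)},\qquad \sigma^2=\bigl((\psi'(\beta)-\psi'(2\beta))^2+\psi''(2\beta)\bigr)e^{\psi(2\beta)-2\psi(\beta)}\ge 0.$$ Here a normal law with variance $0$ is the point mass at its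 mean. -/

import Mathlib

open MeasureTheory ProbabilityTheory Filter Topology
open scoped ENNReal BoundedContinuousFunction

namespace GibbsMatching

noncomputable section

/-- The Laplace transform `t ↦ E exp (-t ω)` of a weight `ω` with law `ν`. Weights live in
`(-∞, +∞]`, with `exp (-t * ∞) = 0` for `t > 0`; they are modelled in `EReal`, where an atom at
`-∞` makes this quantity infinite. -/
def laplace (ν : Measure EReal) (t : ℝ) : ℝ≥0∞ :=
  ∫⁻ x, EReal.exp (-((t : EReal) * x)) ∂ν

/-- `ψ(t) = log E exp (-t ω)`. -/
def psi (ν : Measure EReal) (t : ℝ) : ℝ :=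
  Real.log (laplace ν t).toReal

/-- Edges of `K_{n,n}` are pairs `(i, j)`; a perfect matching of `K_{n,n}` is the edge set
`{(i, π i)}` of a permutation `π`. This is its total weight. -/
def weight {n : ℕ} (w : Fin n × Fin n → EReal) (π : Equiv.Perm (Fin n)) : EReal :=
  ∑ i, w (i, π i)

/-- `exp (-β W(π))`, which is `0` for a matching of infinite weight. -/
def boltzmann {n : ℕ} (β : ℝ) (w : Fin n × Fin n → EReal) (π : Equiv.Perm (Fin n)) : ℝ :=
  (EReal.exp (-((β : EReal) * weight w π))).toReal

/-- The partition function `Z(β, w)`. -/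
def partitionFn {n : ℕ} (β : ℝ) (w : Fin n × Fin n → EReal) : ℝ :=
  (1 / (n.factorial : ℝ)) * ∑ π : Equiv.Perm (Fin n), boltzmann β w π

/-- The Gibbs probability of the matching `π`. It is meaningful when `Z(β, w) ≠ 0`, that is, when
some perfect matching has finite weight; otherwise all these numbers are `0`. -/
def gibbs {n : ℕ} (β : ℝ) (w : Fin n × Fin n → EReal) (π : Equiv.Perm (Fin n)) : ℝ :=
  (1 / partitionFn β w) * (1 / (n.factorial : ℝ)) * boltzmann β w π

/-- The Gibbs average `⟨f(π)⟩_β` given the weights. -/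
def gibbsAvg {n : ℕ} (β : ℝ) (w : Fin n × Fin n → EReal) (f : Equiv.Perm (Fin n) → ℝ) : ℝ :=
  ∑ π : Equiv.Perm (Fin n), gibbs β w π * f π

/-- `π` is a sample from the Gibbs measure with weights `w`: the conditional law of `π` given the
weights is `gibbs β w`, wherever the latter is defined (`Z ≠ 0`). -/
def IsGibbsSample {n : ℕ} {Ω : Type*} [MeasurableSpace Ω] (P : Measure Ω) (β : ℝ)
    (w : Ω → Fin n × Fin n → EReal) (π : Ω → Equiv.Perm (Fin n)) : Prop :=
  (∀ τ : Equiv.Perm (Fin n), MeasurableSet {a | π a = τ}) ∧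
  ∀ (τ : Equiv.Perm (Fin n)) (A : Set (Fin n × Fin n → EReal)), MeasurableSet A →
    (∀ v ∈ A, partitionFn β v ≠ 0) →
    P {a | w a ∈ A ∧ π a = τ} = ∫⁻ a in {a | w a ∈ A}, ENNReal.ofReal (gibbs β (w a) τ) ∂P

/-- `(W(π) + n ψ'(β)) / √n`. A matching of infinite weight has Gibbs probability `0`, so the value
given to it by `EReal.toReal` is immaterial. -/
def normalizedWeight {n : ℕ} (ν : Measure EReal) (β : ℝ) (w : Fin n × Fin n → EReal)
    (π : Equiv.Perm (Fin n)) : ℝ :=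
  ((weight w π).toReal + n * deriv (psi ν) β) / √(n : ℝ)

/-- The limiting mean of the centred Gibbs average. -/
def limitMean (ν : Measure EReal) (β : ℝ) : ℝ :=
  (deriv (psi ν) (2 * β) - deriv (psi ν) β) * Real.exp (psi ν (2 * β) - 2 * psi ν β)

/-- The limiting variance of the centred Gibbs average. -/
def limitVar (ν : Measure EReal) (β : ℝ) : ℝ :=
  ((deriv (psi ν) β - deriv (psi ν) (2 * β)) ^ 2 + deriv (deriv (psi ν)) (2 * β)) *
    Real.exp (psi ν (2 * β) - 2 * psi ν β)

end

end GibbsMatching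

set_option linter.unusedSectionVars false

/-! Put Y = exp(-βω - ψ(β)) and x = ω + ψ'(β) on each edge (`tiltWeight`, `tiltObs`). Then E Y = 1
and E Yx = 0, the normalized partition function is `permMean Y` = (1/n!) per(Y), and the Gibbs
measure weights π by the product of Y along π. Every second moment needed here is a sum over pairs
of matchings. By independence each pair contributes a function of the overlap K alone, and K has the
law of the number of fixed points of a uniform permutation. The generating function of K is a
truncated exponential series (`overlapMean_pow`), so K is asymptotically Poisson(1); under the tilt
r^K with r = E Y² it becomes Poisson(r) with total mass e^(r-1).

Three second-moment computations carry the proof, with v = r - 1.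

The denominator: `permMean Y` is not concentrated, but its randomness is that of exp((1/n) Σ_e (Y_e
- 1)) to leading order. Multiplying by ∏_e (1 - (Y_e - 1)/n) makes it converge in L² to e^(-v)
(`IsTilt.tendsto_integral_damped_sq`). The product is bounded in L², so `permMean Y` is bounded away
from 0 in probability (`IsTilt.exists_permMean_lower_bound`). Hence a numerator that vanishes in L²
gives a Gibbs average that vanishes in probability (`IsTilt.tendsto_measure_of_div`).

The quenched limit: two replicas drawn with density proportional to Y(π)Y(τ) share only O(1) edges,
so their rescaled observables become independent Gaussians of variance E Yx² = ψ''(β)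
(`IsTilt.tendsto_charFun_replicaLaw`). For a test function f with Gaussian mean 0 the mean square of
the numerator therefore tends to (∫ f)² = 0. The joint limit follows because the quenched averages
are bounded and converge in probability to a constant.

The Gibbs average: it is approximated by the linear statistic S = (1/n) Σ_e Y_e x_e plus the
constant m = -E Y²x. An exact computation shows that the numerator centred at S + m vanishes in L²
(`IsTilt.tendsto_integral_centredNumerator_sq`). The classical central limit theorem for n²
independent summands gives S ⇒ N(0, E Y²x²). As Y² is the tilt at 2β up to the factor exp(ψ(2β) -
2ψ(β)), these two constants are the stated μ and σ². -/

namespace GibbsMatching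

/-! ### Overlap of two uniform matchings and edge counting. -/

section Permutations

open Finset

variable {𝕜 : Type*} [Field 𝕜] {n : ℕ}

/-- The number of points where two permutations agree. -/
def agree (π τ : Equiv.Perm (Fin n)) : ℕ := #{i | π i = τ i}

lemma agree_comp (π σ : Equiv.Perm (Fin n)) : agree π (π * σ) = agree 1 σ := by
  refine congrArg card (filter_congr fun i _ => ?_)
  simp [π.injective.eq_iff]

/-- The mean of a function of the overlap of two independent uniform matchings. -/
noncomputable def overlapMean (𝕜 : Type*) [Field 𝕜] (n : ℕ) (f : ℕ → 𝕜) : 𝕜 :=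
  (n.factorial : 𝕜)⁻¹ * ∑ σ : Equiv.Perm (Fin n), f (agree 1 σ)

/-- Left translation in the symmetric group fixes one of the two matchings to be the identity, so
that overlaps become fixed points. -/
lemma sum_sum_agree [CharZero 𝕜] (f : ℕ → 𝕜) :
    (n.factorial : 𝕜)⁻¹ * ((n.factorial : 𝕜)⁻¹ *
      ∑ π : Equiv.Perm (Fin n), ∑ τ : Equiv.Perm (Fin n), f (agree π τ)) = overlapMean 𝕜 n f := by
  have h : ∀ π : Equiv.Perm (Fin n),
      ∑ τ : Equiv.Perm (Fin n), f (agree π τ) = ∑ σ : Equiv.Perm (Fin n), f (agree 1 σ) := by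
    intro π
    rw [← Equiv.sum_comp (Equiv.mulLeft π)]
    simp [agree_comp]
  have h0 : (n.factorial : 𝕜) ≠ 0 := by exact_mod_cast n.factorial_ne_zero
  simp only [h, sum_const, card_univ, Fintype.card_perm, Fintype.card_fin, nsmul_eq_mul,
    overlapMean]
  field_simp

lemma card_perm_fixing (S : Finset (Fin n)) :
    #{σ : Equiv.Perm (Fin n) | ∀ i ∈ S, σ i = i} = (n - #S).factorial := by
  have e := Equiv.Perm.subtypeEquivSubtypePerm (fun i : Fin n => i ∉ S)
  have h := Fintype.card_congr e
  rw [Fintype.card_perm] at h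
  simp only [not_not] at h
  rw [Fintype.card_subtype, Fintype.card_subtype] at h
  rw [show n - #S = #{i | i ∉ S} by rw [filter_not, card_sdiff]; simp, h]

/-- Expanding r^K = (1 + (r - 1))^K over subsets S of the fixed points leaves (n - j)! permutations
for each of the C(n, j) sets of size j, and the factorials cancel to 1/j!. The identity is exact for
each n, so r may vary with n and may be differentiated. -/
lemma overlapMean_pow [CharZero 𝕜] (r : 𝕜) :
    overlapMean 𝕜 n (fun k => r ^ k) = ∑ j ∈ range (n + 1), (r - 1) ^ j / (j.factorial : 𝕜) := by
  have h1 : ∀ σ : Equiv.Perm (Fin n), r ^ agree 1 σ =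
      ∑ S : Finset (Fin n), if ∀ i ∈ S, σ i = i then (r - 1) ^ #S else 0 := by
    intro σ
    have h2 : r ^ agree 1 σ = ∏ i, (1 + if σ i = i then r - 1 else 0) := by
      have : ∀ i, (1 + if σ i = i then r - 1 else 0) = if i = σ i then r else 1 := by
        intro i; simp only [eq_comm (a := i)]; split_ifs <;> simp
      simp only [this, agree, prod_ite, prod_const, one_pow, mul_one]
      congr!
    rw [h2, prod_one_add, powerset_univ]
    refine sum_congr rfl fun S _ => ?_
    rw [prod_ite_zero, prod_const]
    congr!
  have h3 : ∑ σ : Equiv.Perm (Fin n), r ^ agree 1 σ =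
      ∑ S : Finset (Fin n), ((n - #S).factorial : 𝕜) * (r - 1) ^ #S := by
    simp only [h1]
    rw [sum_comm]
    refine sum_congr rfl fun S _ => ?_
    rw [← sum_filter, sum_const, card_perm_fixing, nsmul_eq_mul]
  rw [overlapMean, h3, ← powerset_univ,
    sum_powerset_apply_card (fun k => ((n - k).factorial : 𝕜) * (r - 1) ^ k), mul_sum]
  simp only [card_univ, Fintype.card_fin]
  refine sum_congr rfl fun j hj => ?_
  have hj' : j ≤ n := by simpa [Nat.lt_succ_iff] using hj
  rw [nsmul_eq_mul, Nat.cast_choose 𝕜 hj']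
  have a1 : (n.factorial : 𝕜) ≠ 0 := by exact_mod_cast n.factorial_ne_zero
  have a2 : (j.factorial : 𝕜) ≠ 0 := by exact_mod_cast j.factorial_ne_zero
  have a3 : ((n - j).factorial : 𝕜) ≠ 0 := by exact_mod_cast (n - j).factorial_ne_zero
  field_simp

/-- A quantity attached to an edge, depending on which of the two matchings contain it. -/
def edgeCase {α : Type*} (π τ : Equiv.Perm (Fin n)) (a b b' c : α) (e : Fin n × Fin n) : α :=
  if π e.1 = e.2 then (if τ e.1 = e.2 then a else b) else (if τ e.1 = e.2 then b' else c)

/-- With K common edges the product is a^K b^(n-K) b'^(n-K) c^(n²-2n+K). Writing it through ratios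
isolates the dependence on K and avoids truncated subtraction in the exponents; this is why b, b', c
must not vanish, while a may. -/
lemma prod_edgeCase (π τ : Equiv.Perm (Fin n)) (a : 𝕜) {b b' c : 𝕜}
    (hb : b ≠ 0) (hb' : b' ≠ 0) (hc : c ≠ 0) :
    ∏ e, edgeCase π τ a b b' c e =
      c ^ (n ^ 2) * (b / c) ^ n * (b' / c) ^ n * (a * c / (b * b')) ^ agree π τ := by
  have h1 : ∀ i j, edgeCase π τ a b b' c (i, j) =
      c * (if π i = j then b / c else 1) * (if τ i = j then b' / c else 1) *
        (if π i = j then (if π i = τ i then a * c / (b * b') else 1) else 1) := by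
    intro i j
    unfold edgeCase
    by_cases h : π i = j
    · subst h
      by_cases h' : τ i = π i
      · simp only [h', if_true]; field_simp
      · simp only [h', Ne.symm h', if_true, if_false]; field_simp
    · by_cases h' : τ i = j <;> simp only [h, h', if_true, if_false] <;> field_simp
  rw [Fintype.prod_prod_type]
  simp only [h1, prod_mul_distrib, prod_ite_eq, mem_univ, if_true, prod_const, card_univ,
    Fintype.card_fin, prod_ite, one_pow, mul_one, agree]
  ring

lemma sum_edgeCase (π τ : Equiv.Perm (Fin n)) (a b b' c : 𝕜) :
    ∑ e, edgeCase π τ a b b' c e =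
      n ^ 2 * c + n * (b - c) + n * (b' - c) + agree π τ * (a - b - b' + c) := by
  have h1 : ∀ i j, edgeCase π τ a b b' c (i, j) =
      c + (if π i = j then b - c else 0) + (if τ i = j then b' - c else 0) +
        (if π i = j then (if π i = τ i then a - b - b' + c else 0) else 0) := by
    intro i j
    unfold edgeCase
    by_cases h : π i = j
    · subst h
      by_cases h' : τ i = π i
      · simp only [h', if_true]; ring
      · simp only [h', Ne.symm h', if_true, if_false]; ring
    · by_cases h' : τ i = j <;> simp only [h, h', if_true, if_false] <;> ring
  rw [Fintype.sum_prod_type]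
  simp only [h1, sum_add_distrib, sum_ite_eq, mem_univ, if_true, sum_const, card_univ,
    Fintype.card_fin, sum_ite, agree, nsmul_eq_mul, mul_zero, add_zero]
  ring

end Permutations

/-! ### Poisson limits for the overlap. -/

section OverlapLimits

/-- Dominated convergence for series, the convergent sequence being bounded. The shift d accounts
for the terms of the truncated exponential lost by differentiating in r. -/
lemma tendsto_sum_pow_div_factorial {x : ℕ → ℂ} {y : ℂ} (hx : Tendsto x atTop (𝓝 y)) (d : ℕ) :
    Tendsto (fun n => ∑ j ∈ Finset.range (n + 1 - d), x n ^ j / (j.factorial : ℂ)) atTop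
      (𝓝 (Complex.exp y)) := by
  obtain ⟨B, hB⟩ : ∃ B : ℝ, ∀ n, ‖x n‖ ≤ B := by
    obtain ⟨B, hB⟩ := hx.norm.bddAbove_range
    exact ⟨B, fun n => hB ⟨n, rfl⟩⟩
  have h : Tendsto (fun n => ∑' j : ℕ, if j < n + 1 - d then x n ^ j / (j.factorial : ℂ) else 0)
      atTop (𝓝 (∑' j : ℕ, y ^ j / (j.factorial : ℂ))) := by
    refine tendsto_tsum_of_dominated_convergence (bound := fun j => B ^ j / (j.factorial : ℝ))
      (Real.summable_pow_div_factorial B) (fun j => ?_) (Eventually.of_forall fun n j => ?_)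
    · refine ((hx.pow j).div_const _).congr' ?_
      filter_upwards [eventually_ge_atTop (j + d)] with n hn
      rw [if_pos (by omega)]
    · split_ifs
      · rw [norm_div, norm_pow, Complex.norm_natCast]
        gcongr
        exact hB n
      · have : 0 ≤ B := (norm_nonneg _).trans (hB 0)
        simpa using by positivity
  rw [Complex.exp_eq_exp_ℂ, NormedSpace.exp_eq_tsum_div]
  refine h.congr fun n => ?_
  rw [tsum_eq_sum (s := Finset.range (n + 1 - d))]
  · exact Finset.sum_congr rfl fun j hj => if_pos (by simpa using hj)
  · intro j hj
    exact if_neg (by simpa using hj)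

lemma tendsto_overlapMean_pow {r : ℕ → ℂ} {ρ : ℂ} (hr : Tendsto r atTop (𝓝 ρ)) :
    Tendsto (fun n => overlapMean ℂ n (fun k => r n ^ k)) atTop (𝓝 (Complex.exp (ρ - 1))) := by
  simp only [overlapMean_pow]
  exact tendsto_sum_pow_div_factorial (hr.sub_const 1) 0

lemma tendsto_real_sum_pow_div_factorial {x : ℕ → ℝ} {y : ℝ} (hx : Tendsto x atTop (𝓝 y)) (d : ℕ) :
    Tendsto (fun n => ∑ j ∈ Finset.range (n + 1 - d), x n ^ j / (j.factorial : ℝ)) atTop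
      (𝓝 (Real.exp y)) := by
  have h := tendsto_sum_pow_div_factorial
    ((Complex.continuous_ofReal.tendsto y).comp hx) d
  have h' := (Complex.continuous_re.tendsto _).comp h
  rw [← Complex.ofReal_exp, Complex.ofReal_re] at h'
  refine h'.congr fun n => ?_
  simp only [Function.comp]
  rw [← Complex.ofReal_re (∑ j ∈ Finset.range (n + 1 - d), x n ^ j / (j.factorial : ℝ))]
  push_cast
  rfl

lemma tendsto_overlapMean_pow_real {r : ℕ → ℝ} {ρ : ℝ} (hr : Tendsto r atTop (𝓝 ρ)) :
    Tendsto (fun n => overlapMean ℝ n (fun k => r n ^ k)) atTop (𝓝 (Real.exp (ρ - 1))) := by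
  simp only [overlapMean_pow]
  exact tendsto_real_sum_pow_div_factorial (hr.sub_const 1) 0

lemma hasDerivAt_sum_pow_div_factorial (m : ℕ) (r : ℝ) :
    HasDerivAt (fun r : ℝ => ∑ j ∈ Finset.range m, (r - 1) ^ j / (j.factorial : ℝ))
      (∑ j ∈ Finset.range (m - 1), (r - 1) ^ j / (j.factorial : ℝ)) r := by
  have h : HasDerivAt (fun r : ℝ => ∑ j ∈ Finset.range m, (r - 1) ^ j / (j.factorial : ℝ))
      (∑ j ∈ Finset.range m, (j * (r - 1) ^ (j - 1)) / (j.factorial : ℝ)) r := by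
    refine HasDerivAt.fun_sum fun j _ => ?_
    simpa using (((hasDerivAt_id r).sub_const 1).pow j).div_const (j.factorial : ℝ)
  convert h using 1
  cases m with
  | zero => simp
  | succ m =>
    rw [Finset.sum_range_succ']
    simp only [Nat.add_sub_cancel, Nat.cast_zero, zero_mul, zero_div, add_zero]
    refine Finset.sum_congr rfl fun j _ => ?_
    rw [Nat.factorial_succ]
    have : (j.factorial : ℝ) ≠ 0 := by exact_mod_cast j.factorial_ne_zero
    push_cast
    field_simp

/-- Both sides are the derivative in r of the generating function of the overlap. -/
lemma overlapMean_mul_pow (n : ℕ) (r : ℝ) :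
    overlapMean ℝ n (fun k => k * r ^ (k - 1)) =
      ∑ j ∈ Finset.range (n + 1 - 1), (r - 1) ^ j / (j.factorial : ℝ) := by
  refine HasDerivAt.unique (f := fun r => overlapMean ℝ n (fun k => r ^ k)) (x := r) ?_ ?_
  · unfold overlapMean
    refine HasDerivAt.const_mul _ (HasDerivAt.fun_sum fun σ _ => ?_)
    exact hasDerivAt_pow (agree 1 σ) r
  · simp only [overlapMean_pow]
    exact hasDerivAt_sum_pow_div_factorial (n + 1) r

/-- A second derivative of the generating function. The truncated subtractions are harmless, since
the factor k(k - 1) vanishes at k = 0 and k = 1. -/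
lemma overlapMean_mul_mul_pow (n : ℕ) (r : ℝ) :
    overlapMean ℝ n (fun k => k * ((k - 1 : ℕ) * r ^ (k - 1 - 1))) =
      ∑ j ∈ Finset.range (n + 1 - 2), (r - 1) ^ j / (j.factorial : ℝ) := by
  refine HasDerivAt.unique (f := fun r => overlapMean ℝ n (fun k => k * r ^ (k - 1))) (x := r) ?_ ?_
  · unfold overlapMean
    refine HasDerivAt.const_mul _ (HasDerivAt.fun_sum fun σ _ => HasDerivAt.const_mul _ ?_)
    exact hasDerivAt_pow (agree 1 σ - 1) r
  · simp only [overlapMean_mul_pow]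
    exact hasDerivAt_sum_pow_div_factorial (n + 1 - 1) r

/-- First and second moments of the overlap under the exponential tilt `r ^ k`. -/
lemma tendsto_overlapMean_quadratic {A B C : ℕ → ℝ} {A' B' C' : ℝ} (r : ℝ)
    (hA : Tendsto A atTop (𝓝 A')) (hB : Tendsto B atTop (𝓝 B')) (hC : Tendsto C atTop (𝓝 C')) :
    Tendsto (fun n => overlapMean ℝ n (fun k => r ^ k * (A n + B n * k + C n * k ^ 2))) atTop
      (𝓝 (Real.exp (r - 1) * (A' + B' * r + C' * (r ^ 2 + r)))) := by
  -- The substitution k² = k(k - 1) + k passes to factorial moments, which are the derivatives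
  -- computed above.
  have key : ∀ n, overlapMean ℝ n (fun k => r ^ k * (A n + B n * k + C n * k ^ 2)) =
      A n * overlapMean ℝ n (fun k => r ^ k) +
      (B n + C n) * (r * overlapMean ℝ n (fun k => k * r ^ (k - 1))) +
      C n * (r ^ 2 * overlapMean ℝ n (fun k => k * ((k - 1 : ℕ) * r ^ (k - 1 - 1)))) := by
    intro n
    simp only [overlapMean, Finset.mul_sum, ← Finset.sum_add_distrib]
    refine Finset.sum_congr rfl fun σ _ => ?_
    rcases agree 1 σ with _ | _ | k
    · simp; ring
    · simp; ring
    · simp; ring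
  simp only [key, overlapMean_pow, overlapMean_mul_pow, overlapMean_mul_mul_pow]
  have l := fun d => tendsto_real_sum_pow_div_factorial (x := fun _ => r - 1) tendsto_const_nhds d
  have := ((hA.mul (l 0)).add ((hB.add hC).mul ((l 1).const_mul r))).add
    (hC.mul ((l 2).const_mul (r ^ 2)))
  convert! this using 2
  ring

end OverlapLimits

/-! ### Exact second moments of random permanents. -/

section PermanentMoments

variable {E : Type*} {n : ℕ}

/-- The normalized permanent `(1 / n!) ∑_π ∏_i F (w (i, π i))`. -/
noncomputable def permMean {𝕜 : Type*} [Field 𝕜] (F : E → 𝕜) (w : Fin n × Fin n → E) : 𝕜 :=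
  (n.factorial : 𝕜)⁻¹ * ∑ π : Equiv.Perm (Fin n), ∏ i, F (w (i, π i))

lemma prod_matching {𝕜 : Type*} [CommMonoid 𝕜] (F : E → 𝕜) (w : Fin n × Fin n → E)
    (π : Equiv.Perm (Fin n)) :
    ∏ i, F (w (i, π i)) = ∏ e : Fin n × Fin n, if π e.1 = e.2 then F (w e) else 1 := by
  rw [Fintype.prod_prod_type]
  simp

/-- Regrouping by edges exhibits a product of functions of independent coordinates. The factor H
sits on all n² edges and will hold the damping correction. -/
lemma prod_matching_mul {𝕜 : Type*} [CommMonoid 𝕜] (F G H : E → 𝕜) (w : Fin n × Fin n → E)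
    (π τ : Equiv.Perm (Fin n)) :
    (∏ i, F (w (i, π i))) * (∏ i, G (w (i, τ i))) * ∏ e, H (w e) =
      ∏ e, edgeCase π τ (fun x => F x * G x * H x) (fun x => F x * H x) (fun x => G x * H x) H e
        (w e) := by
  rw [prod_matching, prod_matching, ← Finset.prod_mul_distrib, ← Finset.prod_mul_distrib]
  refine Finset.prod_congr rfl fun e _ => ?_
  unfold edgeCase
  split_ifs <;> simp

variable {𝕜 : Type*} [RCLike 𝕜]

lemma permMean_mul (F G H : E → 𝕜) (w : Fin n × Fin n → E) :
    permMean F w * permMean G w * ∏ e, H (w e) =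
      (n.factorial : 𝕜)⁻¹ * ((n.factorial : 𝕜)⁻¹ * ∑ π : Equiv.Perm (Fin n),
        ∑ τ : Equiv.Perm (Fin n),
          (∏ i, F (w (i, π i))) * (∏ i, G (w (i, τ i))) * ∏ e, H (w e)) := by
  simp only [permMean, ← Finset.mul_sum, ← Finset.sum_mul]
  ring

lemma permMean_one (w : Fin n × Fin n → E) : permMean (fun _ => (1 : 𝕜)) w = 1 := by
  have h0 : (n.factorial : 𝕜) ≠ 0 := by exact_mod_cast n.factorial_ne_zero
  simp [permMean, Fintype.card_perm, h0]

lemma overlapMean_one : overlapMean 𝕜 n (fun _ => 1) = 1 := by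
  have h0 : (n.factorial : 𝕜) ≠ 0 := by exact_mod_cast n.factorial_ne_zero
  simp [overlapMean, Fintype.card_perm, h0]

/-- The law of an independent family of edge weights. -/
noncomputable abbrev edgeLaw [MeasurableSpace E] (ν : Measure E) (n : ℕ) :
    Measure (Fin n × Fin n → E) :=
  Measure.pi fun _ => ν

variable [MeasurableSpace E] {ν : Measure E} [IsProbabilityMeasure ν]

lemma integrable_prod_matching_mul {F G H : E → 𝕜} (π τ : Equiv.Perm (Fin n))
    (hFGH : Integrable (fun x => F x * G x * H x) ν) (hFH : Integrable (fun x => F x * H x) ν)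
    (hGH : Integrable (fun x => G x * H x) ν) (hH : Integrable H ν) :
    Integrable (fun w : Fin n × Fin n → E =>
      (∏ i, F (w (i, π i))) * (∏ i, G (w (i, τ i))) * ∏ e, H (w e)) (edgeLaw ν n) := by
  simp only [prod_matching_mul]
  refine Integrable.fintype_prod fun e => ?_
  unfold edgeCase
  split_ifs <;> assumption

lemma integral_prod_matching_mul (F G H : E → 𝕜) (π τ : Equiv.Perm (Fin n)) :
    ∫ w, (∏ i, F (w (i, π i))) * (∏ i, G (w (i, τ i))) * ∏ e, H (w e) ∂(edgeLaw ν n) =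
      ∏ e, edgeCase π τ (∫ x, F x * G x * H x ∂ν) (∫ x, F x * H x ∂ν) (∫ x, G x * H x ∂ν)
        (∫ x, H x ∂ν) e := by
  simp only [prod_matching_mul]
  rw [integral_fintype_prod_eq_prod]
  refine Finset.prod_congr rfl fun e _ => ?_
  unfold edgeCase
  split_ifs <;> rfl

lemma integrable_permMean_mul {F G H : E → 𝕜}
    (hFGH : Integrable (fun x => F x * G x * H x) ν) (hFH : Integrable (fun x => F x * H x) ν)
    (hGH : Integrable (fun x => G x * H x) ν) (hH : Integrable H ν) :
    Integrable (fun w : Fin n × Fin n → E => permMean F w * permMean G w * ∏ e, H (w e))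
      (edgeLaw ν n) := by
  simp only [permMean_mul]
  exact ((integrable_finsetSum _ fun π _ => integrable_finsetSum _ fun τ _ =>
    integrable_prod_matching_mul π τ hFGH hFH hGH hH).const_mul _).const_mul _

/-- Each pair of matchings integrates to a product over edges, which depends only on the overlap by
`prod_edgeCase`. The same formula serves the damped permanent (real, H a power of `damp`) and the
replica characteristic function (complex phases, H = 1). -/
lemma integral_permMean_mul {F G H : E → 𝕜}
    (hFGH : Integrable (fun x => F x * G x * H x) ν) (hFH : Integrable (fun x => F x * H x) ν)
    (hGH : Integrable (fun x => G x * H x) ν) (hH : Integrable H ν)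
    (hF0 : ∫ x, F x * H x ∂ν ≠ 0) (hG0 : ∫ x, G x * H x ∂ν ≠ 0) (hH0 : ∫ x, H x ∂ν ≠ 0) :
    ∫ w : Fin n × Fin n → E, permMean F w * permMean G w * ∏ e, H (w e) ∂(edgeLaw ν n) =
      (∫ x, H x ∂ν) ^ (n ^ 2) * ((∫ x, F x * H x ∂ν) / ∫ x, H x ∂ν) ^ n *
        ((∫ x, G x * H x ∂ν) / ∫ x, H x ∂ν) ^ n *
        overlapMean 𝕜 n (fun k => ((∫ x, F x * G x * H x ∂ν) * (∫ x, H x ∂ν) /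
          ((∫ x, F x * H x ∂ν) * ∫ x, G x * H x ∂ν)) ^ k) := by
  simp only [permMean_mul]
  rw [integral_const_mul, integral_const_mul, integral_finsetSum]
  swap
  · exact fun π _ => integrable_finsetSum _ fun τ _ =>
      integrable_prod_matching_mul π τ hFGH hFH hGH hH
  have h1 : ∀ π : Equiv.Perm (Fin n), ∫ w, ∑ τ : Equiv.Perm (Fin n),
      (∏ i, F (w (i, π i))) * (∏ i, G (w (i, τ i))) * ∏ e, H (w e) ∂(edgeLaw ν n) =
      ∑ τ : Equiv.Perm (Fin n), (∫ x, H x ∂ν) ^ (n ^ 2) *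
        ((∫ x, F x * H x ∂ν) / ∫ x, H x ∂ν) ^ n *
        ((∫ x, G x * H x ∂ν) / ∫ x, H x ∂ν) ^ n * ((∫ x, F x * G x * H x ∂ν) * (∫ x, H x ∂ν) /
          ((∫ x, F x * H x ∂ν) * ∫ x, G x * H x ∂ν)) ^ agree π τ := by
    intro π
    rw [integral_finsetSum _ fun τ _ => integrable_prod_matching_mul π τ hFGH hFH hGH hH]
    refine Finset.sum_congr rfl fun τ _ => ?_
    rw [integral_prod_matching_mul, prod_edgeCase _ _ _ hF0 hG0 hH0]
  simp only [h1]
  rw [← sum_sum_agree]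
  simp only [← Finset.mul_sum]
  ring

lemma integral_permMean_mul_prod {F H : E → 𝕜} (hFH : Integrable (fun x => F x * H x) ν)
    (hH : Integrable H ν) (hF0 : ∫ x, F x * H x ∂ν ≠ 0) (hH0 : ∫ x, H x ∂ν ≠ 0) :
    ∫ w : Fin n × Fin n → E, permMean F w * ∏ e, H (w e) ∂(edgeLaw ν n) =
      (∫ x, H x ∂ν) ^ (n ^ 2) * ((∫ x, F x * H x ∂ν) / ∫ x, H x ∂ν) ^ n := by
  have h := integral_permMean_mul (n := n) (ν := ν) (F := F) (G := fun _ => 1) (H := H)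
    (by simpa using hFH) hFH (by simpa using hH) hH hF0 (by simpa using hH0) hH0
  simp only [permMean_one, mul_one, one_mul, div_self hH0, one_pow] at h
  rw [h, div_self (mul_ne_zero hF0 hH0)]
  simp [overlapMean_one]

lemma integrable_permMean_mul_prod {F H : E → 𝕜} (hFH : Integrable (fun x => F x * H x) ν)
    (hH : Integrable H ν) :
    Integrable (fun w : Fin n × Fin n → E => permMean F w * ∏ e, H (w e)) (edgeLaw ν n) := by
  have h := integrable_permMean_mul (n := n) (ν := ν) (F := F) (G := fun _ => 1) (H := H)
    (by simpa using hFH) hFH (by simpa using hH) hH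
  simpa only [permMean_one, mul_one] using h

end PermanentMoments

/-! ### The permanent is bounded away from zero in probability. -/

section LowerBound

variable {E : Type*} [MeasurableSpace E]

/-- A nonnegative weight `Y` of mean one and an observable `x` whose `Y`-weighted mean vanishes,
with finite mixed moments. -/
structure IsTilt (ν : Measure E) (Y x : E → ℝ) : Prop where
  measurable_weight : Measurable Y
  measurable_obs : Measurable x
  nonneg : ∀ ω, 0 ≤ Y ω
  integrable : ∀ a b : ℕ, Integrable (fun ω => Y ω ^ (a + 1) * x ω ^ b) ν
  mean_one : ∫ ω, Y ω ∂ν = 1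
  centered : ∫ ω, Y ω * x ω ∂ν = 0

variable {ν : Measure E} [IsProbabilityMeasure ν] {Y x : E → ℝ}

lemma IsTilt.integrable_pow (h : IsTilt ν Y x) (k : ℕ) : Integrable (fun ω => Y ω ^ k) ν := by
  cases k with
  | zero => simp
  | succ k => simpa using h.integrable k 0

lemma IsTilt.integrable_quartic (h : IsTilt ν Y x) (c₀ c₁ c₂ c₃ c₄ : ℝ) :
    Integrable (fun ω => c₀ + c₁ * Y ω + c₂ * Y ω ^ 2 + c₃ * Y ω ^ 3 + c₄ * Y ω ^ 4) ν := by
  have := h.integrable_pow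
  exact (((((integrable_const c₀).add (by simpa using (this 1).const_mul c₁)).add
    ((this 2).const_mul c₂))).add ((this 3).const_mul c₃)).add ((this 4).const_mul c₄)

/-- All the edge moments of the damped permanent, up to Y² times the squared correction, are
polynomials of degree at most four in Y; they are read off from this one formula. -/
lemma IsTilt.integral_quartic (h : IsTilt ν Y x) (c₀ c₁ c₂ c₃ c₄ : ℝ) :
    ∫ ω, (c₀ + c₁ * Y ω + c₂ * Y ω ^ 2 + c₃ * Y ω ^ 3 + c₄ * Y ω ^ 4) ∂ν =
      c₀ + c₁ + c₂ * ∫ ω, Y ω ^ 2 ∂ν + c₃ * ∫ ω, Y ω ^ 3 ∂ν + c₄ * ∫ ω, Y ω ^ 4 ∂ν := by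
  have hp := h.integrable_pow
  have h1 : Integrable (fun ω => c₁ * Y ω) ν := by simpa using (hp 1).const_mul c₁
  have h2 := (hp 2).const_mul c₂
  have h3 := (hp 3).const_mul c₃
  have h4 := (hp 4).const_mul c₄
  have h0 : Integrable (fun _ : E => c₀) ν := integrable_const c₀
  have h01 : Integrable (fun ω => c₀ + c₁ * Y ω) ν := h0.add h1
  have h012 : Integrable (fun ω => c₀ + c₁ * Y ω + c₂ * Y ω ^ 2) ν := h01.add h2
  have h0123 : Integrable (fun ω => c₀ + c₁ * Y ω + c₂ * Y ω ^ 2 + c₃ * Y ω ^ 3) ν := h012.add h3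
  rw [integral_add h0123 h4, integral_add h012 h3, integral_add h01 h2, integral_add h0 h1]
  simp [integral_const_mul, h.mean_one]

/-- Convergence to zero in mean square implies convergence to zero in probability. -/
lemma tendsto_measure_of_tendsto_integral_sq {Ω : ℕ → Type*} [∀ n, MeasurableSpace (Ω n)]
    (P : ∀ n, Measure (Ω n)) [∀ n, IsProbabilityMeasure (P n)] (X : ∀ n, Ω n → ℝ)
    (hX : ∀ᶠ n in atTop, Integrable (fun a => X n a ^ 2) (P n))
    (hlim : Tendsto (fun n => ∫ a, X n a ^ 2 ∂(P n)) atTop (𝓝 0)) {ε : ℝ} (hε : 0 < ε) :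
    Tendsto (fun n => (P n).real {a | ε ≤ |X n a|}) atTop (𝓝 0) := by
  have h2 : 0 < ε ^ 2 := by positivity
  have hl : Tendsto (fun n => (∫ a, X n a ^ 2 ∂(P n)) / ε ^ 2) atTop (𝓝 0) := by
    simpa using hlim.div_const (ε ^ 2)
  refine tendsto_of_tendsto_of_tendsto_of_le_of_le' tendsto_const_nhds hl
    (Eventually.of_forall fun n => measureReal_nonneg) ?_
  filter_upwards [hX] with n hn
  rw [le_div_iff₀ h2, mul_comm]
  have := mul_meas_ge_le_integral_of_nonneg (μ := P n) (f := fun a => X n a ^ 2)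
    (Eventually.of_forall fun a => sq_nonneg _) hn (ε ^ 2)
  have hset : {a | ε ≤ |X n a|} = {a | ε ^ 2 ≤ X n a ^ 2} := by
    ext a
    simp only [Set.mem_ofPred_eq]
    rw [sq_le_sq, abs_of_pos hε]
  rw [hset]
  exact this

/-- The correction `1 - (Y - 1) / n` cancelling the fluctuations of the permanent. -/
noncomputable def damp (Y : E → ℝ) (t : ℝ) (ω : E) : ℝ := 1 - t * (Y ω - 1)

lemma tendsto_inv_nat : Tendsto (fun n : ℕ => (n : ℝ)⁻¹) atTop (𝓝 0) :=
  tendsto_inv_atTop_nhds_zero_nat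

lemma tendsto_one_add_pow_of_eventuallyEq {b g : ℕ → ℝ} {s : ℝ} (hg : Tendsto g atTop (𝓝 s))
    (hb : ∀ᶠ n : ℕ in atTop, n * (b n - 1) = g n) :
    Tendsto (fun n => b n ^ n) atTop (𝓝 (Real.exp s)) := by
  have := Real.tendsto_one_add_pow_exp_of_tendsto (g := fun n => b n - 1) (t := s)
    (hg.congr' (by filter_upwards [hb] with n hn; exact hn.symm))
  simpa using this

lemma tendsto_one_add_inv_sq_pow (v : ℝ) :
    Tendsto (fun n : ℕ => (1 + ((n : ℝ)⁻¹) ^ 2 * v) ^ (n ^ 2)) atTop (𝓝 (Real.exp v)) := by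
  have h1 : Tendsto (fun n : ℕ => n ^ 2) atTop atTop := tendsto_pow_atTop two_ne_zero
  refine ((Real.tendsto_one_add_div_pow_exp v).comp h1).congr fun n => ?_
  simp only [Function.comp]
  push_cast
  rw [inv_pow, div_eq_inv_mul]

lemma IsTilt.integral_damp (h : IsTilt ν Y x) (t : ℝ) : ∫ ω, damp Y t ω ∂ν = 1 := by
  have := h.integral_quartic (1 + t) (-t) 0 0 0
  convert! this using 1
  · refine integral_congr_ae (Eventually.of_forall fun ω => ?_); simp only [damp]; ring
  · ring

lemma IsTilt.integral_mul_damp (h : IsTilt ν Y x) (t : ℝ) :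
    ∫ ω, Y ω * damp Y t ω ∂ν = 1 - t * (∫ ω, Y ω ^ 2 ∂ν - 1) := by
  have := h.integral_quartic 0 (1 + t) (-t) 0 0
  convert! this using 1
  · refine integral_congr_ae (Eventually.of_forall fun ω => ?_); simp only [damp]; ring
  · ring

lemma IsTilt.integral_damp_sq (h : IsTilt ν Y x) (t : ℝ) :
    ∫ ω, damp Y t ω ^ 2 ∂ν = 1 + t ^ 2 * (∫ ω, Y ω ^ 2 ∂ν - 1) := by
  have := h.integral_quartic ((1 + t) ^ 2) (-2 * t * (1 + t)) (t ^ 2) 0 0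
  convert! this using 1
  · refine integral_congr_ae (Eventually.of_forall fun ω => ?_); simp only [damp]; ring
  · ring

lemma IsTilt.integral_mul_damp_sq (h : IsTilt ν Y x) (t : ℝ) :
    ∫ ω, Y ω * damp Y t ω ^ 2 ∂ν = 1 - 2 * t * (∫ ω, Y ω ^ 2 ∂ν - 1) +
      t ^ 2 * (1 - 2 * ∫ ω, Y ω ^ 2 ∂ν + ∫ ω, Y ω ^ 3 ∂ν) := by
  have := h.integral_quartic 0 ((1 + t) ^ 2) (-2 * t * (1 + t)) (t ^ 2) 0
  convert! this using 1
  · refine integral_congr_ae (Eventually.of_forall fun ω => ?_); simp only [damp]; ring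
  · ring

lemma IsTilt.integral_mul_mul_damp_sq (h : IsTilt ν Y x) (t : ℝ) :
    ∫ ω, Y ω * Y ω * damp Y t ω ^ 2 ∂ν = (1 + t) ^ 2 * ∫ ω, Y ω ^ 2 ∂ν -
      2 * t * (1 + t) * ∫ ω, Y ω ^ 3 ∂ν + t ^ 2 * ∫ ω, Y ω ^ 4 ∂ν := by
  have := h.integral_quartic 0 0 ((1 + t) ^ 2) (-2 * t * (1 + t)) (t ^ 2)
  convert! this using 1
  · refine integral_congr_ae (Eventually.of_forall fun ω => ?_); simp only [damp]; ring
  · ring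

lemma IsTilt.integrable_damp (h : IsTilt ν Y x) (t : ℝ) : Integrable (damp Y t) ν := by
  refine (h.integrable_quartic (1 + t) (-t) 0 0 0).congr (Eventually.of_forall fun ω => ?_)
  simp only [damp]; ring

lemma IsTilt.integrable_mul_damp (h : IsTilt ν Y x) (t : ℝ) :
    Integrable (fun ω => Y ω * damp Y t ω) ν := by
  refine (h.integrable_quartic 0 (1 + t) (-t) 0 0).congr (Eventually.of_forall fun ω => ?_)
  simp only [damp]; ring

lemma IsTilt.integrable_damp_sq (h : IsTilt ν Y x) (t : ℝ) :
    Integrable (fun ω => damp Y t ω ^ 2) ν := by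
  refine (h.integrable_quartic ((1 + t) ^ 2) (-2 * t * (1 + t)) (t ^ 2) 0 0).congr
    (Eventually.of_forall fun ω => ?_)
  simp only [damp]; ring

lemma IsTilt.integrable_mul_damp_sq (h : IsTilt ν Y x) (t : ℝ) :
    Integrable (fun ω => Y ω * damp Y t ω ^ 2) ν := by
  refine (h.integrable_quartic 0 ((1 + t) ^ 2) (-2 * t * (1 + t)) (t ^ 2) 0).congr
    (Eventually.of_forall fun ω => ?_)
  simp only [damp]; ring

lemma IsTilt.integrable_mul_mul_damp_sq (h : IsTilt ν Y x) (t : ℝ) :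
    Integrable (fun ω => Y ω * Y ω * damp Y t ω ^ 2) ν := by
  refine (h.integrable_quartic 0 0 ((1 + t) ^ 2) (-2 * t * (1 + t)) (t ^ 2)).congr
    (Eventually.of_forall fun ω => ?_)
  simp only [damp]; ring

lemma IsTilt.one_le_second_moment (h : IsTilt ν Y x) : 1 ≤ ∫ ω, Y ω ^ 2 ∂ν := by
  have h1 := h.integral_quartic 1 (-2) 1 0 0
  have h2 : 0 ≤ ∫ ω, (1 + -2 * Y ω + 1 * Y ω ^ 2 + 0 * Y ω ^ 3 + 0 * Y ω ^ 4) ∂ν :=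
    integral_nonneg fun ω => by
      simp only [Pi.zero_apply]
      nlinarith [sq_nonneg (Y ω - 1)]
  linarith

/-- The damped permanent is concentrated. -/
lemma IsTilt.tendsto_integral_damped_sq (h : IsTilt ν Y x) :
    let v := ∫ ω, Y ω ^ 2 ∂ν - 1
    Tendsto (fun n : ℕ => ∫ w : Fin n × Fin n → E,
      (permMean Y w * ∏ e, damp Y (n : ℝ)⁻¹ (w e) - Real.exp (-v)) ^ 2 ∂(edgeLaw ν n))
      atTop (𝓝 0) ∧
    ∀ᶠ n : ℕ in atTop, Integrable (fun w : Fin n × Fin n → E =>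
      (permMean Y w * ∏ e, damp Y (n : ℝ)⁻¹ (w e) - Real.exp (-v)) ^ 2) (edgeLaw ν n) := by
  intro v
  have hv : 0 ≤ v := sub_nonneg.2 h.one_le_second_moment
  set m2 := ∫ ω, Y ω ^ 2 ∂ν with hm2
  set m3 := ∫ ω, Y ω ^ 3 ∂ν
  set m4 := ∫ ω, Y ω ^ 4 ∂ν
  let t : ℕ → ℝ := fun n => (n : ℝ)⁻¹
  have ht : Tendsto t atTop (𝓝 0) := tendsto_inv_nat
  -- With D the correction at t = 1/n, the sequences b, c, d, a are the means of YD, D², YD², Y²D².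
  -- Only b, c, d are raised to powers growing with n, so their terms of order 1/n (and 1/n² for c)
  -- matter, whereas a enters the limit through a → r.
  let b : ℕ → ℝ := fun n => 1 - t n * v
  let c : ℕ → ℝ := fun n => 1 + t n ^ 2 * v
  let d : ℕ → ℝ := fun n => 1 - 2 * t n * v + t n ^ 2 * (1 - 2 * m2 + m3)
  let a : ℕ → ℝ := fun n => (1 + t n) ^ 2 * m2 - 2 * t n * (1 + t n) * m3 + t n ^ 2 * m4
  have lb : Tendsto b atTop (𝓝 1) := by
    have : Tendsto b atTop (𝓝 (1 - 0 * v)) := (ht.mul_const v).const_sub 1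
    simpa using this
  have lc : Tendsto c atTop (𝓝 1) := by
    have : Tendsto c atTop (𝓝 (1 + 0 ^ 2 * v)) := ((ht.pow 2).mul_const v).const_add 1
    simpa using this
  have ld : Tendsto d atTop (𝓝 1) := by
    have : Tendsto d atTop (𝓝 (1 - 2 * 0 * v + 0 ^ 2 * (1 - 2 * m2 + m3))) :=
      (((ht.const_mul 2).mul_const v).const_sub 1).add ((ht.pow 2).mul_const _)
    simpa using this
  have la : Tendsto a atTop (𝓝 m2) := by
    have : Tendsto a atTop (𝓝 ((1 + 0) ^ 2 * m2 - 2 * 0 * (1 + 0) * m3 + 0 ^ 2 * m4)) :=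
      ((((ht.const_add 1).pow 2).mul_const m2).sub
        (((ht.const_mul 2).mul (ht.const_add 1)).mul_const m3)).add ((ht.pow 2).mul_const m4)
    simpa using this
  have hpos : ∀ᶠ n : ℕ in atTop, (n : ℝ) ≠ 0 := by
    filter_upwards [eventually_ne_atTop 0] with n hn
    exact_mod_cast hn
  have pb : Tendsto (fun n => b n ^ n) atTop (𝓝 (Real.exp (-v))) := by
    refine tendsto_one_add_pow_of_eventuallyEq (g := fun _ => -v) tendsto_const_nhds ?_
    filter_upwards [hpos] with n hn
    simp only [b, t]; field_simp; ring
  have pc : Tendsto (fun n => c n ^ n) atTop (𝓝 1) := by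
    rw [← Real.exp_zero]
    refine tendsto_one_add_pow_of_eventuallyEq (g := fun n => t n * v)
      (by simpa using ht.mul_const v) ?_
    filter_upwards [hpos] with n hn
    simp only [c, t]; field_simp; ring
  have pd : Tendsto (fun n => d n ^ n) atTop (𝓝 (Real.exp (-2 * v))) := by
    refine tendsto_one_add_pow_of_eventuallyEq (g := fun n => -2 * v + t n * (1 - 2 * m2 + m3))
      (by simpa using (ht.mul_const (1 - 2 * m2 + m3)).const_add (-2 * v)) ?_
    filter_upwards [hpos] with n hn
    simp only [d, t]; field_simp; ring
  have pcc : Tendsto (fun n => c n ^ (n ^ 2)) atTop (𝓝 (Real.exp v)) :=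
    tendsto_one_add_inv_sq_pow v
  have lr : Tendsto (fun n => a n * c n / (d n * d n)) atTop (𝓝 m2) := by
    have : Tendsto (fun n => a n * c n / (d n * d n)) atTop (𝓝 (m2 * 1 / (1 * 1))) :=
      (la.mul lc).div (ld.mul ld) (by norm_num)
    simpa using this
  have lo := tendsto_overlapMean_pow_real lr
  have eb := lb.eventually_ne one_ne_zero
  have ec := lc.eventually_ne one_ne_zero
  have ed := ld.eventually_ne one_ne_zero
  have main : ∀ᶠ n : ℕ in atTop, ∫ w : Fin n × Fin n → E,
      (permMean Y w * ∏ e, damp Y (n : ℝ)⁻¹ (w e) - Real.exp (-v)) ^ 2 ∂(edgeLaw ν n) =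
      c n ^ (n ^ 2) * (d n ^ n / c n ^ n) * (d n ^ n / c n ^ n) *
        overlapMean ℝ n (fun k => (a n * c n / (d n * d n)) ^ k) -
      2 * Real.exp (-v) * b n ^ n + Real.exp (-v) ^ 2 ∧
      Integrable (fun w : Fin n × Fin n → E =>
        (permMean Y w * ∏ e, damp Y (n : ℝ)⁻¹ (w e) - Real.exp (-v)) ^ 2) (edgeLaw ν n) := by
    filter_upwards [eb, ec, ed] with n eb ec ed
    have i1 := integrable_permMean_mul (n := n) (h.integrable_mul_mul_damp_sq (t n))
      (h.integrable_mul_damp_sq (t n)) (h.integrable_mul_damp_sq (t n)) (h.integrable_damp_sq (t n))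
    have i2 := integrable_permMean_mul_prod (n := n) (h.integrable_mul_damp (t n))
      (h.integrable_damp (t n))
    have hc' := h.integral_damp_sq (t n)
    have hd' := h.integral_mul_damp_sq (t n)
    have ha' := h.integral_mul_mul_damp_sq (t n)
    have hb' := h.integral_mul_damp (t n)
    have e1 := integral_permMean_mul (n := n) (h.integrable_mul_mul_damp_sq (t n))
      (h.integrable_mul_damp_sq (t n)) (h.integrable_mul_damp_sq (t n)) (h.integrable_damp_sq (t n))
      (by rw [hd']; exact ed) (by rw [hd']; exact ed) (by rw [hc']; exact ec)
    have e2 := integral_permMean_mul_prod (n := n) (h.integrable_mul_damp (t n))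
      (h.integrable_damp (t n)) (by rw [hb']; exact eb) (by rw [h.integral_damp]; norm_num)
    have expand : ∀ w : Fin n × Fin n → E,
        (permMean Y w * ∏ e, damp Y (n : ℝ)⁻¹ (w e) - Real.exp (-v)) ^ 2 =
        permMean Y w * permMean Y w * ∏ e, damp Y (t n) (w e) ^ 2 -
        2 * Real.exp (-v) * (permMean Y w * ∏ e, damp Y (t n) (w e)) + Real.exp (-v) ^ 2 := by
      intro w
      rw [Finset.prod_pow]
      simp only [t]
      ring
    simp only [expand]
    have i3 : Integrable (fun w : Fin n × Fin n → E =>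
        permMean Y w * permMean Y w * ∏ e, damp Y (t n) (w e) ^ 2 -
        2 * Real.exp (-v) * (permMean Y w * ∏ e, damp Y (t n) (w e))) (edgeLaw ν n) :=
      i1.sub (i2.const_mul (2 * Real.exp (-v)))
    refine ⟨?_, i3.add (integrable_const _)⟩
    rw [integral_add i3 (integrable_const _), integral_sub i1 (i2.const_mul _),
      integral_const_mul, e1, e2, hc', hd', ha', hb', h.integral_damp]
    simp only [integral_const, probReal_univ, one_smul, one_pow, one_mul, div_one, ← div_pow]
    rfl
  refine ⟨?_, main.mono fun n hn => hn.2⟩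
  have lim : Tendsto (fun n => c n ^ (n ^ 2) * (d n ^ n / c n ^ n) * (d n ^ n / c n ^ n) *
        overlapMean ℝ n (fun k => (a n * c n / (d n * d n)) ^ k) -
      2 * Real.exp (-v) * b n ^ n + Real.exp (-v) ^ 2) atTop
      (𝓝 (Real.exp v * (Real.exp (-2 * v) / 1) * (Real.exp (-2 * v) / 1) * Real.exp (m2 - 1) -
        2 * Real.exp (-v) * Real.exp (-v) + Real.exp (-v) ^ 2)) := by
    have q := pd.div pc one_ne_zero
    exact (((((pcc.mul q).mul q).mul lo)).sub (pb.const_mul _)).add_const _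
  -- The second moment tends to exp(v - 2v - 2v + v) = e^(-2v), the square of the limiting mean
  -- e^(-v). The last v comes from the overlap, the first from the n² factors D².
  have hz : Real.exp v * (Real.exp (-2 * v) / 1) * (Real.exp (-2 * v) / 1) * Real.exp (m2 - 1) -
        2 * Real.exp (-v) * Real.exp (-v) + Real.exp (-v) ^ 2 = 0 := by
    rw [div_one, ← Real.exp_add, ← Real.exp_add, ← Real.exp_add, mul_assoc, ← Real.exp_add,
      ← Real.exp_nat_mul]
    have : v + -2 * v + -2 * v + (m2 - 1) = -v + -v := by simp only [v]; ring
    rw [this]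
    push_cast
    ring_nf
  rw [hz] at lim
  exact lim.congr' (main.mono fun n hn => hn.1.symm)

lemma IsTilt.integral_prod_damp_sq (h : IsTilt ν Y x) (n : ℕ) (t : ℝ) :
    ∫ w : Fin n × Fin n → E, (∏ e, damp Y t (w e)) ^ 2 ∂(edgeLaw ν n) =
      (1 + t ^ 2 * (∫ ω, Y ω ^ 2 ∂ν - 1)) ^ (n ^ 2) := by
  simp only [← Finset.prod_pow]
  rw [integral_fintype_prod_eq_prod (f := fun _ ω => damp Y t ω ^ 2), Finset.prod_const,
    h.integral_damp_sq]
  simp [sq]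

lemma IsTilt.integrable_prod_damp_sq (h : IsTilt ν Y x) (n : ℕ) (t : ℝ) :
    Integrable (fun w : Fin n × Fin n → E => (∏ e, damp Y t (w e)) ^ 2) (edgeLaw ν n) := by
  simp only [← Finset.prod_pow]
  exact Integrable.fintype_prod (f := fun _ ω => damp Y t ω ^ 2) fun _ => h.integrable_damp_sq t

/-- The normalized permanent is bounded away from zero in probability. -/
lemma IsTilt.exists_permMean_lower_bound (h : IsTilt ν Y x) {ε : ℝ} (hε : 0 < ε) :
    ∃ δ > 0, ∀ᶠ n : ℕ in atTop,
      (edgeLaw ν n).real {w : Fin n × Fin n → E | permMean Y w < δ} ≤ ε := by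
  set v := ∫ ω, Y ω ^ 2 ∂ν - 1 with hv
  obtain ⟨h1, h2⟩ := h.tendsto_integral_damped_sq
  rw [← hv] at h1 h2
  have hη : 0 < Real.exp (-v) / 2 := by positivity
  have h3 := tendsto_measure_of_tendsto_integral_sq (fun n => edgeLaw ν n)
    (fun n w => permMean Y w * ∏ e, damp Y (n : ℝ)⁻¹ (w e) - Real.exp (-v)) h2 h1 hη
  -- The second moment of the damping product tends to e^v, hence is eventually at most e^v + 1;
  -- Chebyshev then bounds the probability that the product exceeds K in absolute value.
  obtain ⟨K, hK0, hK⟩ : ∃ K : ℝ, 0 < K ∧ (Real.exp v + 1) / K ^ 2 ≤ ε / 2 := by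
    have : Tendsto (fun K : ℝ => (Real.exp v + 1) / K ^ 2) atTop (𝓝 0) :=
      tendsto_const_nhds.div_atTop (tendsto_pow_atTop two_ne_zero)
    obtain ⟨K, hK⟩ := ((this.eventually_lt_const (half_pos hε)).and (eventually_gt_atTop 0)).exists
    exact ⟨K, hK.2, hK.1.le⟩
  have h4 : ∀ᶠ n : ℕ in atTop,
      (edgeLaw ν n).real {w : Fin n × Fin n → E | K ≤ |∏ e, damp Y (n : ℝ)⁻¹ (w e)|} ≤ ε / 2 := by
    have hlim := tendsto_one_add_inv_sq_pow v
    filter_upwards [hlim.eventually_le_const (lt_add_one (Real.exp v))] with n hn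
    refine le_trans ?_ hK
    rw [le_div_iff₀ (by positivity), mul_comm]
    have := mul_meas_ge_le_integral_of_nonneg (μ := edgeLaw ν n)
      (f := fun w : Fin n × Fin n → E => (∏ e, damp Y (n : ℝ)⁻¹ (w e)) ^ 2)
      (Eventually.of_forall fun a => sq_nonneg _) (h.integrable_prod_damp_sq n _) (K ^ 2)
    rw [h.integral_prod_damp_sq] at this
    have hset : {w : Fin n × Fin n → E | K ≤ |∏ e, damp Y (n : ℝ)⁻¹ (w e)|} =
        {w | K ^ 2 ≤ (∏ e, damp Y (n : ℝ)⁻¹ (w e)) ^ 2} := by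
      ext a
      simp only [Set.mem_ofPred_eq]
      rw [sq_le_sq, abs_of_pos hK0]
    rw [hset]
    exact this.trans hn
  -- If the damping product is below K in absolute value and the damped permanent is within e^(-v)/2
  -- of e^(-v), then K times the permanent exceeds e^(-v)/2.
  refine ⟨Real.exp (-v) / 2 / K, by positivity, ?_⟩
  filter_upwards [h4, h3.eventually_le_const (half_pos hε)] with n h4 h3
  refine le_trans ?_ ((add_le_add h3 h4).trans_eq (add_halves ε))
  refine le_trans (measureReal_mono ?_) (measureReal_union_le _ _)
  intro w hw
  simp only [Set.mem_ofPred_eq, Set.mem_union] at hw ⊢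
  by_contra! hcon
  obtain ⟨c1, c2⟩ := hcon
  have hZ : 0 ≤ permMean Y w := mul_nonneg (by positivity)
    (Finset.sum_nonneg fun π _ => Finset.prod_nonneg fun i _ => h.nonneg _)
  have c3 : permMean Y w * ∏ e, damp Y (n : ℝ)⁻¹ (w e) ≤ Real.exp (-v) / 2 :=
    calc permMean Y w * ∏ e, damp Y (n : ℝ)⁻¹ (w e)
        ≤ permMean Y w * K := mul_le_mul_of_nonneg_left ((le_abs_self _).trans c2.le) hZ
      _ ≤ Real.exp (-v) / 2 / K * K := mul_le_mul_of_nonneg_right hw.le hK0.le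
      _ = Real.exp (-v) / 2 := by field_simp
  have := neg_abs_le (permMean Y w * ∏ e, damp Y (n : ℝ)⁻¹ (w e) - Real.exp (-v))
  linarith

end LowerBound

/-! ### The classical central limit theorem through characteristic functions. -/

section CharFun

open Complex in
/-- The characteristic function limit in the central limit theorem. -/
lemma tendsto_charFun_pow {μ : Measure ℝ} [IsProbabilityMeasure μ] (hμ : MemLp id 2 μ)
    (h0 : ∫ y, y ∂μ = 0) (t : ℝ) :
    Tendsto (fun n : ℕ => charFun μ ((√(n : ℝ))⁻¹ * t) ^ n) atTop
      (𝓝 (exp (-((∫ y, y ^ 2 ∂μ : ℝ) * t ^ 2 / 2)))) := by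
  set s : ℝ := ∫ y, y ^ 2 ∂μ with hs
  -- A finite second moment makes the characteristic function C², so the second order Taylor
  -- expansion at 0 holds with Peano remainder.
  have taylor : (fun t : ℝ => charFun μ t - (1 - s * t ^ 2 / 2)) =o[𝓝 0] fun t => t ^ 2 := by
    have hT : ∀ t : ℝ, taylorWithinEval (charFun μ) 2 Set.univ 0 t = 1 - (s : ℂ) * t ^ 2 / 2 := by
      intro t
      have := taylorWithinEval_charFun_two_zero (P := μ) (X := id) aemeasurable_id
        (by simpa using hμ) t
      rw [Measure.map_id] at this
      rw [this]
      simp [h0, hs]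
    simp_rw [← hT]
    convert! taylor_isLittleO_univ (n := 2) (f := charFun μ) (x₀ := 0) ?_ using 2
    · simp
    · exact contDiff_charFun (n := 2) hμ
  apply tendsto_pow_exp_of_isLittleO_sub_add_div
  suffices (fun (n : ℕ) ↦ charFun μ ((√n)⁻¹ * t) -
      (1 + (-(s * ((√n)⁻¹ * t) ^ 2 / 2) : ℂ))) =o[atTop] fun n ↦ ((√n)⁻¹ * t) ^ 2 by
    have aux : (fun (n : ℕ) ↦ ‖(1 / n : ℂ)‖) = fun (n : ℕ) ↦ ‖(1 / n : ℝ)‖ := by simp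
    rw [← Asymptotics.isLittleO_norm_right, aux, Asymptotics.isLittleO_norm_right]
    refine .of_const_mul_right (c := t ^ 2) ?_
    convert! this using 4 with n <;> norm_cast <;> simp [field]
  have : Tendsto (fun (n : ℕ) ↦ (√n)⁻¹ * t) atTop (𝓝 0) := by
    rw [← zero_mul t]
    exact .mul_const t (tendsto_inv_atTop_zero.comp <| Real.tendsto_sqrt_atTop.comp <|
      tendsto_natCast_atTop_atTop)
  convert! taylor.comp_tendsto this using 2
  simp
  ring

end CharFun

/-! ### Two replicas and the quenched Gaussian limit. -/

section Replicas

variable {E : Type*} [MeasurableSpace E] {ν : Measure E} [IsProbabilityMeasure ν] {Y x : E → ℝ}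

/-- The law of the observable under the tilted measure. -/
noncomputable def tiltLaw (ν : Measure E) (Y x : E → ℝ) : Measure ℝ :=
  (ν.withDensity fun ω => ENNReal.ofReal (Y ω)).map x

lemma IsTilt.integral_tiltLaw (h : IsTilt ν Y x) {G : Type*} [NormedAddCommGroup G]
    [NormedSpace ℝ G] {g : ℝ → G} (hg : StronglyMeasurable g) :
    ∫ y, g y ∂(tiltLaw ν Y x) = ∫ ω, Y ω • g (x ω) ∂ν := by
  rw [tiltLaw, integral_map h.measurable_obs.aemeasurable hg.aestronglyMeasurable,
    integral_withDensity_eq_integral_toReal_smul h.measurable_weight.ennreal_ofReal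
      (Eventually.of_forall fun _ => ENNReal.ofReal_lt_top)]
  simp only [ENNReal.toReal_ofReal (h.nonneg _)]

lemma IsTilt.integrable_weight (h : IsTilt ν Y x) : Integrable Y ν := by
  simpa using h.integrable 0 0

lemma IsTilt.isProbabilityMeasure_tiltLaw (h : IsTilt ν Y x) :
    IsProbabilityMeasure (tiltLaw ν Y x) := by
  constructor
  rw [tiltLaw, Measure.map_apply h.measurable_obs MeasurableSet.univ, Set.preimage_univ,
    withDensity_apply _ MeasurableSet.univ, setLIntegral_univ,
    ← ofReal_integral_eq_lintegral_ofReal h.integrable_weight (Eventually.of_forall h.nonneg),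
    h.mean_one, ENNReal.ofReal_one]

lemma IsTilt.memLp_tiltLaw (h : IsTilt ν Y x) : MemLp id 2 (tiltLaw ν Y x) := by
  rw [memLp_two_iff_integrable_sq aestronglyMeasurable_id, tiltLaw,
    integrable_map_measure (by fun_prop) h.measurable_obs.aemeasurable,
    integrable_withDensity_iff_integrable_smul' h.measurable_weight.ennreal_ofReal
      (Eventually.of_forall fun _ => ENNReal.ofReal_lt_top)]
  simp only [ENNReal.toReal_ofReal (h.nonneg _)]
  simpa using h.integrable 0 2

lemma IsTilt.tendsto_charFun_tiltLaw (h : IsTilt ν Y x) (t : ℝ) :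
    Tendsto (fun n : ℕ => charFun (tiltLaw ν Y x) ((√(n : ℝ))⁻¹ * t) ^ n) atTop
      (𝓝 (Complex.exp (-((∫ ω, Y ω * x ω ^ 2 ∂ν : ℝ) * t ^ 2 / 2)))) := by
  have := h.isProbabilityMeasure_tiltLaw
  have h0 : ∫ y, y ∂(tiltLaw ν Y x) = 0 := by
    rw [h.integral_tiltLaw (g := fun y => y) stronglyMeasurable_id]
    simpa using h.centered
  have h2 : ∫ y, y ^ 2 ∂(tiltLaw ν Y x) = ∫ ω, Y ω * x ω ^ 2 ∂ν := by
    rw [h.integral_tiltLaw (g := fun y => y ^ 2) (by fun_prop)]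
    simp
  rw [← h2]
  exact tendsto_charFun_pow h.memLp_tiltLaw h0 t

/-- The tilted weight with a phase. -/
noncomputable def phase (Y x : E → ℝ) (t : ℝ) (ω : E) : ℂ := Y ω * Complex.exp (t * x ω * Complex.I)

lemma norm_exp_phase (t y : ℝ) : ‖Complex.exp (t * y * Complex.I)‖ = 1 := by
  rw [← Complex.ofReal_mul, Complex.norm_exp_ofReal_mul_I]

/-- Averaged over the weights, the observable of a single tilted matching is a sum of n independent
variables with law `tiltLaw`; this identity brings the classical limit theorem into play. -/
lemma IsTilt.integral_phase (h : IsTilt ν Y x) (t : ℝ) :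
    ∫ ω, phase Y x t ω ∂ν = charFun (tiltLaw ν Y x) t := by
  rw [charFun_apply_real, h.integral_tiltLaw (by fun_prop)]
  simp [phase]

lemma IsTilt.measurable_phase (h : IsTilt ν Y x) (t : ℝ) : Measurable (phase Y x t) := by
  have := h.measurable_weight
  have := h.measurable_obs
  unfold phase
  fun_prop

lemma IsTilt.integrable_phase (h : IsTilt ν Y x) (t : ℝ) : Integrable (phase Y x t) ν := by
  refine h.integrable_weight.mono' (h.measurable_phase t).aestronglyMeasurable
    (Eventually.of_forall fun ω => ?_)
  rw [phase, norm_mul, norm_exp_phase, Complex.norm_real, Real.norm_of_nonneg (h.nonneg ω), mul_one]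

lemma norm_phase_mul (hY : ∀ ω, 0 ≤ Y ω) (s t : ℝ) (ω : E) :
    ‖phase Y x s ω * phase Y x t ω‖ = Y ω ^ 2 := by
  simp only [phase, norm_mul, norm_exp_phase, Complex.norm_real, Real.norm_of_nonneg (hY ω)]
  ring

lemma IsTilt.integrable_phase_mul (h : IsTilt ν Y x) (s t : ℝ) :
    Integrable (fun ω => phase Y x s ω * phase Y x t ω) ν :=
  (h.integrable_pow 2).mono' ((h.measurable_phase s).mul (h.measurable_phase t)).aestronglyMeasurable
    (Eventually.of_forall fun ω => (norm_phase_mul h.nonneg s t ω).le)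

lemma tendsto_inv_sqrt_nat_mul (t : ℝ) :
    Tendsto (fun n : ℕ => (√(n : ℝ))⁻¹ * t) atTop (𝓝 0) := by
  rw [← zero_mul t]
  exact .mul_const t (tendsto_inv_atTop_zero.comp <| Real.tendsto_sqrt_atTop.comp <|
    tendsto_natCast_atTop_atTop)

/-- The phases tend to 1 pointwise and the integrand is dominated by Y². A shared edge thus keeps
its weight E Y² in the limit but carries no phase, which is why the replicas decouple. -/
lemma IsTilt.tendsto_integral_phase_mul (h : IsTilt ν Y x) (s t : ℝ) :
    Tendsto (fun n : ℕ => ∫ ω, phase Y x ((√(n : ℝ))⁻¹ * s) ω * phase Y x ((√(n : ℝ))⁻¹ * t) ω ∂ν)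
      atTop (𝓝 ((∫ ω, Y ω ^ 2 ∂ν : ℝ) : ℂ)) := by
  rw [← integral_complex_ofReal]
  refine tendsto_integral_of_dominated_convergence (fun ω => Y ω ^ 2)
    (fun n => ((h.measurable_phase _).mul (h.measurable_phase _)).aestronglyMeasurable)
    (h.integrable_pow 2)
    (fun n => Eventually.of_forall fun ω => (norm_phase_mul h.nonneg _ _ ω).le)
    (Eventually.of_forall fun ω => ?_)
  have key : ∀ t : ℝ, Tendsto (fun n : ℕ => phase Y x ((√(n : ℝ))⁻¹ * t) ω) atTop (𝓝 (Y ω)) := by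
    intro t
    have hc : Continuous fun u : ℝ => phase Y x u ω := by unfold phase; fun_prop
    have := (hc.tendsto 0).comp (tendsto_inv_sqrt_nat_mul t)
    simpa [phase, Function.comp_def] using this
  have := (key s).mul (key t)
  convert! this using 2
  push_cast
  ring

/-- The total observable of a matching. -/
def obsSum {n : ℕ} (x : E → ℝ) (w : Fin n × Fin n → E) (π : Equiv.Perm (Fin n)) : ℝ :=
  ∑ i, x (w (i, π i))

/-- The weight of a matching. -/
def matchWeight {n : ℕ} (Y : E → ℝ) (w : Fin n × Fin n → E) (π : Equiv.Perm (Fin n)) : ℝ :=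
  ∏ i, Y (w (i, π i))

lemma prod_phase {n : ℕ} (t : ℝ) (w : Fin n × Fin n → E) (π : Equiv.Perm (Fin n)) :
    ∏ i, phase Y x t (w (i, π i)) =
      matchWeight Y w π * Complex.exp (t * obsSum x w π * Complex.I) := by
  simp only [phase, Finset.prod_mul_distrib, matchWeight, obsSum]
  rw [← Complex.exp_sum]
  push_cast
  rw [Finset.mul_sum, Finset.sum_mul]

lemma IsTilt.matchWeight_nonneg (h : IsTilt ν Y x) {n : ℕ} (w : Fin n × Fin n → E)
    (π : Equiv.Perm (Fin n)) : 0 ≤ matchWeight Y w π :=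
  Finset.prod_nonneg fun _ _ => h.nonneg _

lemma IsTilt.measurable_matchWeight (h : IsTilt ν Y x) {n : ℕ} (π : Equiv.Perm (Fin n)) :
    Measurable fun w : Fin n × Fin n → E => matchWeight Y w π := by
  have := h.measurable_weight
  unfold matchWeight
  fun_prop

lemma IsTilt.measurable_obsSum (h : IsTilt ν Y x) {n : ℕ} (π : Equiv.Perm (Fin n)) :
    Measurable fun w : Fin n × Fin n → E => obsSum x w π := by
  have := h.measurable_obs
  unfold obsSum
  fun_prop

lemma IsTilt.integrable_matchWeight_mul (h : IsTilt ν Y x) {n : ℕ} (π τ : Equiv.Perm (Fin n)) :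
    Integrable (fun w : Fin n × Fin n → E => matchWeight Y w π * matchWeight Y w τ)
      (edgeLaw ν n) := by
  have h2 := h.integrable_pow 2
  simp only [sq] at h2
  have := integrable_prod_matching_mul (n := n) (ν := ν) (F := Y) (G := Y) (H := fun _ => 1) π τ
    (by simpa using h2) (by simpa using h.integrable_weight) (by simpa using h.integrable_weight)
    (integrable_const _)
  simpa [matchWeight] using this

/-- The second moment of the normalized permanent. -/
noncomputable def secondMoment (ν : Measure E) (Y : E → ℝ) (n : ℕ) : ℝ :=
  overlapMean ℝ n fun k => (∫ ω, Y ω ^ 2 ∂ν) ^ k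

lemma IsTilt.secondMoment_pos (h : IsTilt ν Y x) (n : ℕ) : 0 < secondMoment ν Y n := by
  have h1 := h.one_le_second_moment
  unfold secondMoment overlapMean
  have : 0 < ∑ σ : Equiv.Perm (Fin n), (∫ ω, Y ω ^ 2 ∂ν) ^ agree 1 σ :=
    Finset.sum_pos (fun σ _ => by positivity) ⟨1, Finset.mem_univ _⟩
  positivity

lemma IsTilt.sum_integral_matchWeight_mul (h : IsTilt ν Y x) (n : ℕ) :
    (n.factorial : ℝ)⁻¹ * ((n.factorial : ℝ)⁻¹ * ∑ π : Equiv.Perm (Fin n),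
      ∑ τ : Equiv.Perm (Fin n), ∫ w, matchWeight Y w π * matchWeight Y w τ ∂(edgeLaw ν n)) =
      secondMoment ν Y n := by
  have key : ∀ π τ : Equiv.Perm (Fin n),
      ∫ w, matchWeight Y w π * matchWeight Y w τ ∂(edgeLaw ν n) =
        (∫ ω, Y ω ^ 2 ∂ν) ^ agree π τ := by
    intro π τ
    have := integral_prod_matching_mul (n := n) (ν := ν) Y Y (fun _ => 1) π τ
    simp only [Finset.prod_const_one, mul_one, h.mean_one, integral_const, probReal_univ,
      one_smul] at this
    rw [prod_edgeCase _ _ _ one_ne_zero one_ne_zero one_ne_zero] at this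
    simp only [one_pow, mul_one, div_one, one_mul] at this
    simpa only [matchWeight, sq] using this
  simp only [key]
  rw [sum_sum_agree (fun k => (∫ ω, Y ω ^ 2 ∂ν) ^ k)]
  rfl

lemma tendsto_secondMoment (ν : Measure E) (Y : E → ℝ) :
    Tendsto (secondMoment ν Y) atTop (𝓝 (Real.exp (∫ ω, Y ω ^ 2 ∂ν - 1))) :=
  tendsto_overlapMean_pow_real tendsto_const_nhds

/-- The density of the annealed law of two replicas `π, τ`. -/
noncomputable def replicaDensity {n : ℕ} (ν : Measure E) (Y : E → ℝ) (π τ : Equiv.Perm (Fin n))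
    (w : Fin n × Fin n → E) : ℝ :=
  (secondMoment ν Y n)⁻¹ * ((n.factorial : ℝ)⁻¹ * ((n.factorial : ℝ)⁻¹ *
    (matchWeight Y w π * matchWeight Y w τ)))

/-- The rescaled observables of two replicas. -/
noncomputable def replicaObs {n : ℕ} (x : E → ℝ) (π τ : Equiv.Perm (Fin n))
    (w : Fin n × Fin n → E) : WithLp 2 (ℝ × ℝ) :=
  WithLp.toLp 2 ((√(n : ℝ))⁻¹ * obsSum x w π, (√(n : ℝ))⁻¹ * obsSum x w τ)

/-- The annealed joint law of the rescaled observables of two replicas. -/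
noncomputable def replicaLaw (ν : Measure E) (Y x : E → ℝ) (n : ℕ) :
    Measure (WithLp 2 (ℝ × ℝ)) :=
  ∑ p : Equiv.Perm (Fin n) × Equiv.Perm (Fin n), ((edgeLaw ν n).withDensity fun w =>
    ENNReal.ofReal (replicaDensity ν Y p.1 p.2 w)).map (replicaObs x p.1 p.2)

lemma IsTilt.replicaDensity_nonneg (h : IsTilt ν Y x) {n : ℕ} (π τ : Equiv.Perm (Fin n))
    (w : Fin n × Fin n → E) : 0 ≤ replicaDensity ν Y π τ w := by
  have h1 := h.secondMoment_pos n
  have h2 := h.matchWeight_nonneg w π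
  have h3 := h.matchWeight_nonneg w τ
  unfold replicaDensity
  positivity

lemma IsTilt.measurable_replicaDensity (h : IsTilt ν Y x) {n : ℕ} (π τ : Equiv.Perm (Fin n)) :
    Measurable (replicaDensity (n := n) ν Y π τ) := by
  have h2 := h.measurable_matchWeight π
  have h3 := h.measurable_matchWeight τ
  unfold replicaDensity
  fun_prop

lemma IsTilt.integrable_replicaDensity (h : IsTilt ν Y x) {n : ℕ} (π τ : Equiv.Perm (Fin n)) :
    Integrable (replicaDensity (n := n) ν Y π τ) (edgeLaw ν n) :=
  (((h.integrable_matchWeight_mul π τ).const_mul _).const_mul _).const_mul _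

lemma IsTilt.measurable_replicaObs (h : IsTilt ν Y x) {n : ℕ} (π τ : Equiv.Perm (Fin n)) :
    Measurable (replicaObs (n := n) x π τ) := by
  have h2 := h.measurable_obsSum π
  have h3 := h.measurable_obsSum τ
  unfold replicaObs
  fun_prop

lemma IsTilt.integral_replicaLaw (h : IsTilt ν Y x) (n : ℕ) {G : Type*} [NormedAddCommGroup G]
    [NormedSpace ℝ G] {g : WithLp 2 (ℝ × ℝ) → G} (hg : StronglyMeasurable g) {K : ℝ}
    (hK : ∀ y, ‖g y‖ ≤ K) :
    ∫ y, g y ∂(replicaLaw ν Y x n) = ∑ p : Equiv.Perm (Fin n) × Equiv.Perm (Fin n),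
      ∫ w, replicaDensity ν Y p.1 p.2 w • g (replicaObs x p.1 p.2 w) ∂(edgeLaw ν n) := by
  have hfin : ∀ p : Equiv.Perm (Fin n) × Equiv.Perm (Fin n), IsFiniteMeasure
      ((edgeLaw ν n).withDensity fun w => ENNReal.ofReal (replicaDensity ν Y p.1 p.2 w)) :=
    fun p => isFiniteMeasure_withDensity_ofReal (h.integrable_replicaDensity p.1 p.2).2
  rw [replicaLaw, integral_finsetSum_measure]
  · refine Finset.sum_congr rfl fun p _ => ?_
    rw [integral_map (h.measurable_replicaObs _ _).aemeasurable hg.aestronglyMeasurable,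
      integral_withDensity_eq_integral_toReal_smul
        (h.measurable_replicaDensity _ _).ennreal_ofReal
        (Eventually.of_forall fun _ => ENNReal.ofReal_lt_top)]
    simp only [ENNReal.toReal_ofReal (h.replicaDensity_nonneg _ _ _)]
  · intro p _
    exact Integrable.of_bound hg.aestronglyMeasurable K (Eventually.of_forall hK)

lemma IsTilt.isProbabilityMeasure_replicaLaw (h : IsTilt ν Y x) (n : ℕ) :
    IsProbabilityMeasure (replicaLaw ν Y x n) := by
  constructor
  have h1 : ∀ p : Equiv.Perm (Fin n) × Equiv.Perm (Fin n),
      (((edgeLaw ν n).withDensity fun w =>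
        ENNReal.ofReal (replicaDensity ν Y p.1 p.2 w)).map (replicaObs x p.1 p.2)) Set.univ =
      ENNReal.ofReal (∫ w, replicaDensity ν Y p.1 p.2 w ∂(edgeLaw ν n)) := by
    intro p
    rw [Measure.map_apply (h.measurable_replicaObs _ _) MeasurableSet.univ, Set.preimage_univ,
      withDensity_apply _ MeasurableSet.univ, setLIntegral_univ,
      ← ofReal_integral_eq_lintegral_ofReal (h.integrable_replicaDensity _ _)
        (Eventually.of_forall (h.replicaDensity_nonneg _ _))]
  rw [replicaLaw, Measure.finsetSum_apply]
  simp only [h1]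
  rw [← ENNReal.ofReal_sum_of_nonneg fun p _ => integral_nonneg (h.replicaDensity_nonneg _ _),
    ← ENNReal.ofReal_one]
  congr 1
  simp only [replicaDensity, integral_const_mul, ← Finset.mul_sum, Fintype.sum_prod_type]
  rw [h.sum_integral_matchWeight_mul]
  exact inv_mul_cancel₀ (h.secondMoment_pos n).ne'

/-- The exponential of a sum over a matching is a product along it, so the double sum over replicas
factors into two permanents with complex entries. -/
lemma IsTilt.charFun_replicaLaw (h : IsTilt ν Y x) (n : ℕ) (t : WithLp 2 (ℝ × ℝ)) :
    charFun (replicaLaw ν Y x n) t = (secondMoment ν Y n : ℂ)⁻¹ *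
      ∫ w : Fin n × Fin n → E, permMean (phase Y x ((√(n : ℝ))⁻¹ * t.fst)) w *
        permMean (phase Y x ((√(n : ℝ))⁻¹ * t.snd)) w ∂(edgeLaw ν n) := by
  rw [charFun_apply, h.integral_replicaLaw n (K := 1) (by fun_prop)]
  swap
  · intro y
    rw [Complex.norm_exp_ofReal_mul_I]
  have h1 := fun w : Fin n × Fin n → E => permMean_mul (phase Y x ((√(n : ℝ))⁻¹ * t.fst))
    (phase Y x ((√(n : ℝ))⁻¹ * t.snd)) (fun _ => 1) w
  simp only [Finset.prod_const_one, mul_one] at h1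
  simp only [h1]
  rw [integral_const_mul, integral_const_mul, integral_finsetSum]
  swap
  · intro π _
    refine integrable_finsetSum _ fun τ _ => ?_
    have := integrable_prod_matching_mul (n := n) (ν := ν)
      (F := phase Y x ((√(n : ℝ))⁻¹ * t.fst)) (G := phase Y x ((√(n : ℝ))⁻¹ * t.snd))
      (H := fun _ => 1) π τ (by simpa using h.integrable_phase_mul _ _)
      (by simpa using h.integrable_phase _) (by simpa using h.integrable_phase _)
      (integrable_const _)
    simpa using this
  rw [Fintype.sum_prod_type, Finset.mul_sum, Finset.mul_sum, Finset.mul_sum]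
  refine Finset.sum_congr rfl fun π _ => ?_
  rw [integral_finsetSum]
  swap
  · intro τ _
    have := integrable_prod_matching_mul (n := n) (ν := ν)
      (F := phase Y x ((√(n : ℝ))⁻¹ * t.fst)) (G := phase Y x ((√(n : ℝ))⁻¹ * t.snd))
      (H := fun _ => 1) π τ (by simpa using h.integrable_phase_mul _ _)
      (by simpa using h.integrable_phase _) (by simpa using h.integrable_phase _)
      (integrable_const _)
    simpa using this
  rw [Finset.mul_sum, Finset.mul_sum, Finset.mul_sum]
  refine Finset.sum_congr rfl fun τ _ => ?_
  rw [← integral_const_mul, ← integral_const_mul, ← integral_const_mul]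
  refine integral_congr_ae (Eventually.of_forall fun w => ?_)
  simp only [prod_phase, replicaDensity, replicaObs, WithLp.prod_inner_apply, Complex.real_smul]
  have : Complex.exp (((inner ℝ ((√(n : ℝ))⁻¹ * obsSum x w π) t.ofLp.1 +
      inner ℝ ((√(n : ℝ))⁻¹ * obsSum x w τ) t.ofLp.2 : ℝ) : ℂ) * Complex.I) =
      Complex.exp (((√(n : ℝ))⁻¹ * t.fst : ℝ) * obsSum x w π * Complex.I) *
      Complex.exp (((√(n : ℝ))⁻¹ * t.snd : ℝ) * obsSum x w τ * Complex.I) := by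
    rw [← Complex.exp_add]
    congr 1
    simp only [RCLike.inner_apply, conj_trivial]
    push_cast
    simp only [WithLp.fst, WithLp.snd]
    ring
  rw [this]
  push_cast
  ring

lemma IsTilt.tendsto_charFun_replicaLaw (h : IsTilt ν Y x) (t : WithLp 2 (ℝ × ℝ)) :
    Tendsto (fun n => charFun (replicaLaw ν Y x n) t) atTop
      (𝓝 (Complex.exp (-((∫ ω, Y ω * x ω ^ 2 ∂ν : ℝ) * t.fst ^ 2 / 2)) *
        Complex.exp (-((∫ ω, Y ω * x ω ^ 2 ∂ν : ℝ) * t.snd ^ 2 / 2)))) := by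
  simp only [h.charFun_replicaLaw]
  have := h.isProbabilityMeasure_tiltLaw
  have hb : ∀ u : ℝ, Tendsto (fun n : ℕ => charFun (tiltLaw ν Y x) ((√(n : ℝ))⁻¹ * u)) atTop
      (𝓝 1) := by
    intro u
    have := (continuous_charFun (μ := tiltLaw ν Y x)).tendsto 0
    simpa [Function.comp_def] using this.comp (tendsto_inv_sqrt_nat_mul u)
  have hr := ((h.tendsto_integral_phase_mul t.fst t.snd).div ((hb t.fst).mul (hb t.snd))
    (by norm_num))
  rw [mul_one, div_one] at hr
  have ho := tendsto_overlapMean_pow hr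
  have hZ : Tendsto (fun n => (secondMoment ν Y n : ℂ)⁻¹) atTop
      (𝓝 ((Real.exp (∫ ω, Y ω ^ 2 ∂ν - 1) : ℝ) : ℂ)⁻¹) := by
    refine ((Complex.continuous_ofReal.tendsto _).comp (tendsto_secondMoment ν Y)).inv₀ ?_
    exact_mod_cast (Real.exp_pos _).ne'
  have hmain := hZ.mul (((h.tendsto_charFun_tiltLaw t.fst).mul
    (h.tendsto_charFun_tiltLaw t.snd)).mul ho)
  -- The overlap factor has the same limit e^(r-1) as the normalizing second moment; their
  -- cancellation leaves a product of two Gaussian characteristic functions.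
  have hlim : ∀ A : ℂ, ((Real.exp (∫ ω, Y ω ^ 2 ∂ν - 1) : ℝ) : ℂ)⁻¹ *
      (A * Complex.exp ((∫ ω, Y ω ^ 2 ∂ν : ℝ) - 1)) = A := by
    intro A
    have : Complex.exp ((∫ ω, Y ω ^ 2 ∂ν : ℝ) - 1) ≠ 0 := Complex.exp_ne_zero _
    push_cast
    field_simp
  rw [hlim] at hmain
  refine hmain.congr' ?_
  filter_upwards [(hb t.fst).eventually_ne one_ne_zero, (hb t.snd).eventually_ne one_ne_zero]
    with n h1 h2
  congr 1
  have := integral_permMean_mul (n := n) (ν := ν)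
      (F := phase Y x ((√(n : ℝ))⁻¹ * t.fst)) (G := phase Y x ((√(n : ℝ))⁻¹ * t.snd))
      (H := fun _ => 1) (by simpa using h.integrable_phase_mul _ _)
      (by simpa using h.integrable_phase _) (by simpa using h.integrable_phase _)
      (integrable_const _) (by simpa [h.integral_phase] using h1)
      (by simpa [h.integral_phase] using h2) (by simp)
  simp only [Finset.prod_const_one, mul_one, integral_const, probReal_univ, one_smul, one_pow,
    div_one, one_mul, h.integral_phase] at this
  rw [this]
  rfl

/-- The Gibbs numerator of a centred bounded test function of the rescaled observable vanishes
in mean square. -/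
lemma IsTilt.tendsto_integral_testSum_sq (h : IsTilt ν Y x) (f : ℝ →ᵇ ℝ)
    (hf : ∫ y, f y ∂(gaussianReal 0 (∫ ω, Y ω * x ω ^ 2 ∂ν).toNNReal) = 0) :
    Tendsto (fun n : ℕ => ∫ w : Fin n × Fin n → E, ((n.factorial : ℝ)⁻¹ *
      ∑ π, matchWeight Y w π * f ((√(n : ℝ))⁻¹ * obsSum x w π)) ^ 2 ∂(edgeLaw ν n)) atTop (𝓝 0) := by
  set s := ∫ ω, Y ω * x ω ^ 2 ∂ν with hs
  have hs0 : 0 ≤ s := integral_nonneg fun ω => mul_nonneg (h.nonneg ω) (sq_nonneg _)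
  set γ := gaussianReal 0 s.toNNReal
  let Λ : ℕ → ProbabilityMeasure (WithLp 2 (ℝ × ℝ)) := fun n =>
    ⟨replicaLaw ν Y x n, h.isProbabilityMeasure_replicaLaw n⟩
  let Λ₀ : ProbabilityMeasure (WithLp 2 (ℝ × ℝ)) :=
    ⟨(γ.prod γ).map (WithLp.toLp 2), Measure.isProbabilityMeasure_map (by fun_prop)⟩
  have hΛ : Tendsto Λ atTop (𝓝 Λ₀) := by
    rw [ProbabilityMeasure.tendsto_iff_tendsto_charFun]
    intro t
    have := h.tendsto_charFun_replicaLaw t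
    convert! this using 2
    change charFun ((γ.prod γ).map (WithLp.toLp 2)) t = _
    rw [charFun_prod]
    simp only [γ, charFun_gaussianReal, Real.coe_toNNReal s hs0]
    rw [← hs]
    simp
  -- The squared numerator is a double sum over matchings, that is, a multiple of the replica
  -- average of f ⊗ f. In the limit this average is (∫ f dγ)² = 0.
  let g : WithLp 2 (ℝ × ℝ) →ᵇ ℝ :=
    (f.compContinuous ⟨fun y => y.fst, by fun_prop⟩) * (f.compContinuous ⟨fun y => y.snd, by fun_prop⟩)
  have hg : ∀ y, g y = f y.fst * f y.snd := fun y => rfl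
  have h1 := (ProbabilityMeasure.tendsto_iff_forall_integral_tendsto.1 hΛ) g
  have h0 : ∫ y, g y ∂(Λ₀ : Measure (WithLp 2 (ℝ × ℝ))) = 0 := by
    change ∫ y, g y ∂((γ.prod γ).map (WithLp.toLp 2)) = 0
    rw [integral_map (by fun_prop) (by fun_prop)]
    exact (integral_prod_mul (μ := γ) (ν := γ) (fun y => f y) (fun y => f y)).trans
      (by rw [hf, zero_mul])
  rw [h0] at h1
  have h2 := (tendsto_secondMoment ν Y).mul h1
  rw [mul_zero] at h2
  refine h2.congr fun n => ?_
  change secondMoment ν Y n * ∫ y, g y ∂(replicaLaw ν Y x n) = _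
  rw [h.integral_replicaLaw n (K := ‖g‖) g.continuous.stronglyMeasurable (fun y => g.norm_coe_le_norm y),
    Finset.mul_sum]
  have hsq : ∀ w : Fin n × Fin n → E, ((n.factorial : ℝ)⁻¹ *
      ∑ π, matchWeight Y w π * f ((√(n : ℝ))⁻¹ * obsSum x w π)) ^ 2 =
      ∑ p : Equiv.Perm (Fin n) × Equiv.Perm (Fin n), secondMoment ν Y n *
        (replicaDensity ν Y p.1 p.2 w • g (replicaObs x p.1 p.2 w)) := by
    intro w
    rw [mul_pow, sq (∑ π, _), Finset.sum_mul_sum, Fintype.sum_prod_type, Finset.mul_sum]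
    refine Finset.sum_congr rfl fun π _ => ?_
    rw [Finset.mul_sum]
    refine Finset.sum_congr rfl fun τ _ => ?_
    simp only [replicaDensity, replicaObs, hg, smul_eq_mul, WithLp.fst, WithLp.snd]
    have := (h.secondMoment_pos n).ne'
    field_simp
  simp only [hsq]
  rw [integral_finsetSum]
  · simp only [integral_const_mul]
  · intro p _
    refine Integrable.const_mul ?_ _
    exact (h.integrable_replicaDensity p.1 p.2).mul_bdd (c := ‖g‖)
      (g.continuous.measurable.comp (h.measurable_replicaObs _ _)).aestronglyMeasurable
      (Eventually.of_forall fun w => g.norm_coe_le_norm _)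

lemma IsTilt.integrable_testSum_sq (h : IsTilt ν Y x) (f : ℝ →ᵇ ℝ) (n : ℕ) :
    Integrable (fun w : Fin n × Fin n → E => ((n.factorial : ℝ)⁻¹ *
      ∑ π, matchWeight Y w π * f ((√(n : ℝ))⁻¹ * obsSum x w π)) ^ 2) (edgeLaw ν n) := by
  simp only [mul_pow, sq (∑ π, _), Finset.sum_mul_sum]
  refine Integrable.const_mul (integrable_finsetSum _ fun π _ => integrable_finsetSum _ fun τ _ => ?_) _
  have hm := fun π => f.continuous.measurable.comp ((h.measurable_obsSum (n := n) π).const_mul (√(n : ℝ))⁻¹)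
  refine ((h.integrable_matchWeight_mul π τ).mul_bdd (c := ‖f‖ * ‖f‖)
    ((hm π).mul (hm τ)).aestronglyMeasurable (Eventually.of_forall fun w => ?_)).congr
    (Eventually.of_forall fun w => ?_)
  · simp only [Pi.mul_apply, Function.comp, norm_mul]
    exact mul_le_mul (f.norm_coe_le_norm _) (f.norm_coe_le_norm _) (norm_nonneg _) (norm_nonneg _)
  · simp only [Pi.mul_apply, Function.comp]
    ring

end Replicas

/-! ### Linear statistics under a product of tilts. -/

section ProductMeasure

variable {ι E : Type*} [Fintype ι] [DecidableEq ι] [MeasurableSpace E] {ν : Measure E}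
  [IsProbabilityMeasure ν]

lemma prod_mul_apply (F : ι → E → ℝ) (ℓ : ι → E → ℝ) (e : ι) (w : ι → E) :
    (∏ i, F i (w i)) * ℓ e (w e) =
      ∏ i, (if i = e then fun ω => F i ω * ℓ i ω else F i) (w i) := by
  rw [← Finset.mul_prod_erase Finset.univ (fun i => F i (w i)) (Finset.mem_univ e),
    ← Finset.mul_prod_erase Finset.univ
      (fun i => (if i = e then fun ω => F i ω * ℓ i ω else F i) (w i)) (Finset.mem_univ e),
    if_pos rfl]
  have : ∏ i ∈ Finset.univ.erase e, (if i = e then fun ω => F i ω * ℓ i ω else F i) (w i) =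
      ∏ i ∈ Finset.univ.erase e, F i (w i) :=
    Finset.prod_congr rfl fun i hi => by rw [if_neg (Finset.ne_of_mem_erase hi)]
  rw [this]
  ring

lemma integral_prod_mul_apply_eq_erase (F ℓ : ι → E → ℝ) (e : ι) :
    ∫ w : ι → E, (∏ i, F i (w i)) * ℓ e (w e) ∂(Measure.pi fun _ => ν) =
      (∏ i ∈ Finset.univ.erase e, ∫ ω, F i ω ∂ν) * ∫ ω, F e ω * ℓ e ω ∂ν := by
  simp only [prod_mul_apply]
  rw [integral_fintype_prod_eq_prod, ← Finset.prod_erase_mul _ _ (Finset.mem_univ e), if_pos rfl]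
  congr 1
  exact Finset.prod_congr rfl fun i hi => by rw [if_neg (Finset.ne_of_mem_erase hi)]

lemma integral_prod_mul_apply {F ℓ : ι → E → ℝ} {f μ : ι → ℝ} (hf : ∀ i, ∫ ω, F i ω ∂ν = f i)
    (hμ : ∀ i, ∫ ω, F i ω * ℓ i ω ∂ν = f i * μ i) (e : ι) :
    ∫ w : ι → E, (∏ i, F i (w i)) * ℓ e (w e) ∂(Measure.pi fun _ => ν) = (∏ i, f i) * μ e := by
  rw [integral_prod_mul_apply_eq_erase, hμ, ← Finset.prod_erase_mul _ f (Finset.mem_univ e)]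
  simp only [hf]
  ring

lemma integrable_prod_mul_apply {F ℓ : ι → E → ℝ} (hF : ∀ i, Integrable (F i) ν)
    (hℓ : ∀ i, Integrable (fun ω => F i ω * ℓ i ω) ν) (e : ι) :
    Integrable (fun w : ι → E => (∏ i, F i (w i)) * ℓ e (w e)) (Measure.pi fun _ => ν) := by
  simp only [prod_mul_apply]
  refine Integrable.fintype_prod fun i => ?_
  split_ifs
  exacts [hℓ i, hF i]

/-- Under the measure with density ∏ F the coordinates stay independent, so the covariance lives on
the diagonal e = e'. Here f is the mass of each factor, and μ, μ', η are means under the normalized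
tilts. -/
lemma integral_prod_mul_apply_mul {F ℓ ℓ' : ι → E → ℝ} {f μ μ' η : ι → ℝ}
    (hf : ∀ i, ∫ ω, F i ω ∂ν = f i) (hμ : ∀ i, ∫ ω, F i ω * ℓ i ω ∂ν = f i * μ i)
    (hμ' : ∀ i, ∫ ω, F i ω * ℓ' i ω ∂ν = f i * μ' i)
    (hη : ∀ i, ∫ ω, F i ω * (ℓ i ω * ℓ' i ω) ∂ν = f i * η i) (e e' : ι) :
    ∫ w : ι → E, (∏ i, F i (w i)) * (ℓ e (w e) * ℓ' e' (w e')) ∂(Measure.pi fun _ => ν) =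
      (∏ i, f i) * (μ e * μ' e' + if e = e' then η e - μ e * μ' e else 0) := by
  rcases eq_or_ne e e' with rfl | hne
  · have := integral_prod_mul_apply (ν := ν) (ℓ := fun i ω => ℓ i ω * ℓ' i ω) hf hη e
    rw [this, if_pos rfl]
    ring
  · rw [if_neg hne, add_zero]
    simp only [← mul_assoc, prod_mul_apply F ℓ]
    have he : e ∈ Finset.univ.erase e' := Finset.mem_erase.2 ⟨hne, Finset.mem_univ e⟩
    rw [integral_prod_mul_apply_eq_erase, if_neg hne.symm, hμ',
      ← Finset.prod_erase_mul _ f (Finset.mem_univ e'), ← Finset.prod_erase_mul _ _ he,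
      ← Finset.prod_erase_mul _ f he, if_pos rfl, hμ]
    have : ∏ i ∈ (Finset.univ.erase e').erase e,
        ∫ ω, (if i = e then fun ω => F i ω * ℓ i ω else F i) ω ∂ν =
        ∏ i ∈ (Finset.univ.erase e').erase e, f i :=
      Finset.prod_congr rfl fun i hi => by rw [if_neg (Finset.ne_of_mem_erase hi), hf]
    rw [this]
    ring

lemma integrable_prod_mul_apply_mul {F ℓ ℓ' : ι → E → ℝ} (hF : ∀ i, Integrable (F i) ν)
    (hℓ : ∀ i, Integrable (fun ω => F i ω * ℓ i ω) ν)
    (hℓ' : ∀ i, Integrable (fun ω => F i ω * ℓ' i ω) ν)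
    (hℓℓ' : ∀ i, Integrable (fun ω => F i ω * (ℓ i ω * ℓ' i ω)) ν) (e e' : ι) :
    Integrable (fun w : ι → E => (∏ i, F i (w i)) * (ℓ e (w e) * ℓ' e' (w e')))
      (Measure.pi fun _ => ν) := by
  rcases eq_or_ne e e' with rfl | hne
  · exact integrable_prod_mul_apply (ℓ := fun i ω => ℓ i ω * ℓ' i ω) hF hℓℓ' e
  · simp only [← mul_assoc, prod_mul_apply F ℓ]
    simp only [prod_mul_apply _ ℓ']
    refine Integrable.fintype_prod fun i => ?_
    split_ifs with h1 h2
    · exact absurd (h2.symm.trans h1) hne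
    exacts [hℓ' i, hℓ i, hF i]

/-- The mixed second moment of two linear statistics under a product of tilts. -/
lemma integral_prod_mul_sum_mul_sum {F ℓ ℓ' : ι → E → ℝ} {f μ μ' η : ι → ℝ}
    (hF : ∀ i, Integrable (F i) ν) (hℓ : ∀ i, Integrable (fun ω => F i ω * ℓ i ω) ν)
    (hℓ' : ∀ i, Integrable (fun ω => F i ω * ℓ' i ω) ν)
    (hℓℓ' : ∀ i, Integrable (fun ω => F i ω * (ℓ i ω * ℓ' i ω)) ν)
    (hf : ∀ i, ∫ ω, F i ω ∂ν = f i) (hμ : ∀ i, ∫ ω, F i ω * ℓ i ω ∂ν = f i * μ i)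
    (hμ' : ∀ i, ∫ ω, F i ω * ℓ' i ω ∂ν = f i * μ' i)
    (hη : ∀ i, ∫ ω, F i ω * (ℓ i ω * ℓ' i ω) ∂ν = f i * η i) (m : ℝ) :
    Integrable (fun w : ι → E => (∏ i, F i (w i)) *
      ((∑ e, ℓ e (w e) - m) * (∑ e, ℓ' e (w e) - m))) (Measure.pi fun _ => ν) ∧
    ∫ w : ι → E, (∏ i, F i (w i)) * ((∑ e, ℓ e (w e) - m) * (∑ e, ℓ' e (w e) - m))
      ∂(Measure.pi fun _ => ν) =
      (∏ i, f i) * (∑ e, (η e - μ e * μ' e) + (∑ e, μ e - m) * (∑ e, μ' e - m)) := by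
  have expand : ∀ w : ι → E, (∏ i, F i (w i)) *
      ((∑ e, ℓ e (w e) - m) * (∑ e, ℓ' e (w e) - m)) =
      ∑ e, ∑ e', (∏ i, F i (w i)) * (ℓ e (w e) * ℓ' e' (w e')) -
        m * ∑ e, (∏ i, F i (w i)) * ℓ e (w e) - m * ∑ e, (∏ i, F i (w i)) * ℓ' e (w e) +
        m ^ 2 * ∏ i, F i (w i) := by
    intro w
    simp only [← Finset.mul_sum, ← Finset.sum_mul]
    ring
  simp only [expand]
  have i0 : Integrable (fun w : ι → E => ∏ i, F i (w i)) (Measure.pi fun _ => ν) :=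
    Integrable.fintype_prod hF
  have i1 := fun e => integrable_prod_mul_apply hF hℓ e
  have i2 := fun e => integrable_prod_mul_apply hF hℓ' e
  have i3 := fun e e' => integrable_prod_mul_apply_mul hF hℓ hℓ' hℓℓ' e e'
  have s1 := (integrable_finsetSum Finset.univ fun e _ => i1 e).const_mul m
  have s2 := (integrable_finsetSum Finset.univ fun e _ => i2 e).const_mul m
  have s3 := integrable_finsetSum Finset.univ fun e _ =>
    integrable_finsetSum Finset.univ fun e' _ => i3 e e'
  have s31 := s3.sub s1
  have s312 := s31.sub s2
  refine ⟨s312.add (i0.const_mul _), ?_⟩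
  refine (integral_add s312 (i0.const_mul _)).trans ?_
  rw [integral_sub' s31 s2, integral_sub' s3 s1, integral_const_mul, integral_const_mul,
    integral_const_mul, integral_finsetSum _ fun e _ => i1 e, integral_finsetSum _ fun e _ => i2 e,
    integral_finsetSum _ fun e _ => integrable_finsetSum Finset.univ fun e' _ => i3 e e',
    integral_fintype_prod_eq_prod]
  simp only [integral_finsetSum _ fun e' _ => i3 _ e', integral_prod_mul_apply hf hμ,
    integral_prod_mul_apply hf hμ', integral_prod_mul_apply_mul hf hμ hμ' hη, hf]
  simp only [← Finset.mul_sum, Finset.sum_add_distrib, Finset.sum_ite_eq, Finset.mem_univ, if_true,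
    Finset.sum_sub_distrib, ← Finset.sum_mul]
  ring

end ProductMeasure

/-! ### The first order approximation of the Gibbs average. -/

section Numerator

variable {E : Type*} [MeasurableSpace E] {ν : Measure E} [IsProbabilityMeasure ν] {Y x : E → ℝ}

/-- The linear statistic `(1 / n) ∑_e Y_e x_e`. -/
noncomputable def edgeStat {n : ℕ} (Y x : E → ℝ) (w : Fin n × Fin n → E) : ℝ :=
  (n : ℝ)⁻¹ * ∑ e, Y (w e) * x (w e)

lemma IsTilt.integrable_moment (h : IsTilt ν Y x) {a : ℕ} (ha : a ≠ 0) (b : ℕ) :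
    Integrable (fun ω => Y ω ^ a * x ω ^ b) ν := by
  obtain ⟨a, rfl⟩ := Nat.exists_eq_succ_of_ne_zero ha
  exact h.integrable a b

lemma IsTilt.integrable_comb (h : IsTilt ν Y x) {a₁ a₂ a₃ : ℕ} (h₁ : a₁ ≠ 0) (h₂ : a₂ ≠ 0)
    (h₃ : a₃ ≠ 0) (b : ℕ) (c₁ c₂ c₃ : ℝ) :
    Integrable (fun ω => c₁ * (Y ω ^ a₁ * x ω ^ b) + c₂ * (Y ω ^ a₂ * x ω ^ b) +
      c₃ * (Y ω ^ a₃ * x ω ^ b)) ν :=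
  (((h.integrable_moment h₁ b).const_mul c₁).add ((h.integrable_moment h₂ b).const_mul c₂)).add
    ((h.integrable_moment h₃ b).const_mul c₃)

lemma IsTilt.integral_comb (h : IsTilt ν Y x) {a₁ a₂ a₃ : ℕ} (h₁ : a₁ ≠ 0) (h₂ : a₂ ≠ 0)
    (h₃ : a₃ ≠ 0) (b : ℕ) (c₁ c₂ c₃ : ℝ) :
    ∫ ω, (c₁ * (Y ω ^ a₁ * x ω ^ b) + c₂ * (Y ω ^ a₂ * x ω ^ b) + c₃ * (Y ω ^ a₃ * x ω ^ b)) ∂ν =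
      c₁ * ∫ ω, Y ω ^ a₁ * x ω ^ b ∂ν + c₂ * ∫ ω, Y ω ^ a₂ * x ω ^ b ∂ν +
        c₃ * ∫ ω, Y ω ^ a₃ * x ω ^ b ∂ν := by
  have i1 := (h.integrable_moment h₁ b).const_mul c₁
  have i2 := (h.integrable_moment h₂ b).const_mul c₂
  have i3 := (h.integrable_moment h₃ b).const_mul c₃
  refine (integral_add (i1.add i2) i3).trans ?_
  rw [integral_add' i1 i2, integral_const_mul, integral_const_mul, integral_const_mul]

/-- The numerator of the Gibbs average of the observable, centred by its first order
approximation. -/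
noncomputable def centredNumerator {n : ℕ} (Y x : E → ℝ) (m : ℝ) (w : Fin n × Fin n → E) : ℝ :=
  (n.factorial : ℝ)⁻¹ * ∑ π, matchWeight Y w π * (obsSum x w π - edgeStat Y x w - m)

lemma centredNumerator_sq {n : ℕ} (Y x : E → ℝ) (m : ℝ) (w : Fin n × Fin n → E) :
    centredNumerator Y x m w ^ 2 =
      (n.factorial : ℝ)⁻¹ * ((n.factorial : ℝ)⁻¹ * ∑ π : Equiv.Perm (Fin n),
        ∑ τ : Equiv.Perm (Fin n), matchWeight Y w π * matchWeight Y w τ *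
          ((obsSum x w π - edgeStat Y x w - m) * (obsSum x w τ - edgeStat Y x w - m))) := by
  rw [centredNumerator, mul_pow, sq (∑ π, _), Finset.sum_mul_sum, sq, mul_assoc]
  congr 2
  refine Finset.sum_congr rfl fun π _ => Finset.sum_congr rfl fun τ _ => by ring

/-- The difference is again a linear statistic over all edges, which is the form required by
`integral_prod_mul_sum_mul_sum`. -/
lemma obsSum_sub_edgeStat {n : ℕ} (Y x : E → ℝ) (w : Fin n × Fin n → E) (π : Equiv.Perm (Fin n)) :
    obsSum x w π - edgeStat Y x w =
      ∑ e : Fin n × Fin n, ((if π e.1 = e.2 then x (w e) else 0) -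
        (n : ℝ)⁻¹ * (Y (w e) * x (w e))) := by
  rw [Finset.sum_sub_distrib, ← Finset.mul_sum, Fintype.sum_prod_type]
  simp [obsSum, edgeStat]

/-- The weights of the two matchings tilt common edges by Y² (mass r), edges of exactly one matching
by Y, and leave the others alone. Under this tilt each centred statistic has mean m + αK: edges in
one matching contribute 2m in total before the overlap correction, and m is subtracted. Squaring
gives m² + 2mαK + α²K²; the remaining terms of A and B are the diagonal covariances. -/
lemma IsTilt.integral_pair (h : IsTilt ν Y x) {n : ℕ} (hn : n ≠ 0) (π τ : Equiv.Perm (Fin n)) :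
    let M : ℕ → ℕ → ℝ := fun a b => ∫ ω, Y ω ^ a * x ω ^ b ∂ν
    let r := M 2 0
    let m := -M 2 1
    let t := (n : ℝ)⁻¹
    let μ := (M 2 1 - t * M 3 1) / r
    let α := μ + 2 * t * M 2 1
    let A := -M 2 2 + 2 * t * (M 3 2 - M 2 1 ^ 2 - M 2 2) + m ^ 2
    let B := (M 2 2 - 2 * t * M 3 2 + t ^ 2 * M 4 2) / r - μ ^ 2 + 2 * t * M 2 2 -
      2 * t ^ 2 * M 3 2 + 2 * t ^ 2 * M 2 1 ^ 2 + t ^ 2 * M 2 2 + 2 * m * α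
    Integrable (fun w => matchWeight Y w π * matchWeight Y w τ *
          ((obsSum x w π - edgeStat Y x w - m) * (obsSum x w τ - edgeStat Y x w - m)))
      (edgeLaw ν n) ∧
    ∫ w, matchWeight Y w π * matchWeight Y w τ *
          ((obsSum x w π - edgeStat Y x w - m) * (obsSum x w τ - edgeStat Y x w - m))
      ∂(edgeLaw ν n) =
      r ^ agree π τ * (A + B * agree π τ + α ^ 2 * (agree π τ : ℝ) ^ 2) := by
  intro M r m t μ α A B
  have hr : r ≠ 0 := by
    have := h.one_le_second_moment
    have : (1 : ℝ) ≤ r := by simpa [r, M] using this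
    positivity
  have hnt : (n : ℝ) * t = 1 := mul_inv_cancel₀ (by exact_mod_cast hn)
  have M10 : M 1 0 = 1 := by simpa [M] using h.mean_one
  have M11 : M 1 1 = 0 := by simpa [M] using h.centered
  -- An edge contributes q to the statistic of a matching containing it and p otherwise.
  let q : E → ℝ := fun ω => x ω - t * (Y ω * x ω)
  let p : E → ℝ := fun ω => -(t * (Y ω * x ω))
  let F := edgeCase π τ (fun ω => Y ω ^ 2) Y Y (fun _ => (1 : ℝ))
  let ℓ := edgeCase π τ q q p p
  let ℓ' := edgeCase π τ q p q p
  have e1 : ∀ w : Fin n × Fin n → E, matchWeight Y w π * matchWeight Y w τ *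
      ((obsSum x w π - edgeStat Y x w - m) * (obsSum x w τ - edgeStat Y x w - m)) =
      (∏ e, F e (w e)) * ((∑ e, ℓ e (w e) - m) * (∑ e, ℓ' e (w e) - m)) := by
    intro w
    have := prod_matching_mul Y Y (fun _ => 1) w π τ
    simp only [Finset.prod_const_one, mul_one, ← sq] at this
    rw [obsSum_sub_edgeStat, obsSum_sub_edgeStat]
    simp only [matchWeight]
    rw [this]
    have s1 : ∀ e : Fin n × Fin n, ((if π e.1 = e.2 then x (w e) else 0) -
        (n : ℝ)⁻¹ * (Y (w e) * x (w e))) = ℓ e (w e) := by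
      intro e
      simp only [ℓ, edgeCase, q, p, t]
      split_ifs <;> simp
    have s2 : ∀ e : Fin n × Fin n, ((if τ e.1 = e.2 then x (w e) else 0) -
        (n : ℝ)⁻¹ * (Y (w e) * x (w e))) = ℓ' e (w e) := by
      intro e
      simp only [ℓ', edgeCase, q, p, t]
      split_ifs <;> simp
    simp only [s1, s2]
    rfl
  simp only [e1]
  have key : ∀ {a₁ a₂ a₃ : ℕ} (h₁ : a₁ ≠ 0) (h₂ : a₂ ≠ 0) (h₃ : a₃ ≠ 0) (b : ℕ) (c₁ c₂ c₃ : ℝ)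
      (g : E → ℝ), (∀ ω, g ω = c₁ * (Y ω ^ a₁ * x ω ^ b) + c₂ * (Y ω ^ a₂ * x ω ^ b) +
        c₃ * (Y ω ^ a₃ * x ω ^ b)) →
      Integrable g ν ∧ ∫ ω, g ω ∂ν = c₁ * M a₁ b + c₂ * M a₂ b + c₃ * M a₃ b := by
    intro a₁ a₂ a₃ h₁ h₂ h₃ b c₁ c₂ c₃ g hg
    rw [funext hg]
    exact ⟨h.integrable_comb h₁ h₂ h₃ b c₁ c₂ c₃, h.integral_comb h₁ h₂ h₃ b c₁ c₂ c₃⟩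
  have kq2 := key two_ne_zero three_ne_zero one_ne_zero 1 1 (-t) 0 (fun ω => Y ω ^ 2 * q ω)
    (fun ω => by simp only [q]; ring)
  have kq1 := key one_ne_zero two_ne_zero one_ne_zero 1 1 (-t) 0 (fun ω => Y ω * q ω)
    (fun ω => by simp only [q]; ring)
  have kp1 := key two_ne_zero one_ne_zero one_ne_zero 1 (-t) 0 0 (fun ω => Y ω * p ω)
    (fun ω => by simp only [p]; ring)
  have kp0 := key one_ne_zero one_ne_zero one_ne_zero 1 (-t) 0 0 (fun ω => 1 * p ω)
    (fun ω => by simp only [p]; ring)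
  have kqq2 := key two_ne_zero three_ne_zero four_ne_zero 2 1 (-2 * t) (t ^ 2)
    (fun ω => Y ω ^ 2 * (q ω * q ω)) (fun ω => by simp only [q]; ring)
  have kqp1 := key two_ne_zero three_ne_zero one_ne_zero 2 (-t) (t ^ 2) 0
    (fun ω => Y ω * (q ω * p ω)) (fun ω => by simp only [p, q]; ring)
  have kpq1 := key two_ne_zero three_ne_zero one_ne_zero 2 (-t) (t ^ 2) 0
    (fun ω => Y ω * (p ω * q ω)) (fun ω => by simp only [p, q]; ring)
  have kpp0 := key two_ne_zero one_ne_zero one_ne_zero 2 (t ^ 2) 0 0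
    (fun ω => 1 * (p ω * p ω)) (fun ω => by simp only [p]; ring)
  have k2 := key two_ne_zero one_ne_zero one_ne_zero 0 1 0 0 (fun ω => Y ω ^ 2)
    (fun ω => by ring)
  have k1 := key one_ne_zero one_ne_zero one_ne_zero 0 1 0 0 Y (fun ω => by ring)
  have main := integral_prod_mul_sum_mul_sum (ν := ν) (F := F) (ℓ := ℓ) (ℓ' := ℓ')
    (f := edgeCase π τ r 1 1 1) (μ := edgeCase π τ μ (-t * M 2 1) (-t * M 2 1) 0)
    (μ' := edgeCase π τ μ (-t * M 2 1) (-t * M 2 1) 0)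
    (η := edgeCase π τ ((M 2 2 - 2 * t * M 3 2 + t ^ 2 * M 4 2) / r)
      (-t * M 2 2 + t ^ 2 * M 3 2) (-t * M 2 2 + t ^ 2 * M 3 2) (t ^ 2 * M 2 2))
    (fun e => by
      simp only [F, edgeCase]; split_ifs
      exacts [k2.1, k1.1, k1.1, integrable_const _])
    (fun e => by
      simp only [F, ℓ, edgeCase]; split_ifs
      exacts [kq2.1, kq1.1, kp1.1, kp0.1])
    (fun e => by
      simp only [F, ℓ', edgeCase]; split_ifs
      exacts [kq2.1, kp1.1, kq1.1, kp0.1])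
    (fun e => by
      simp only [F, ℓ, ℓ', edgeCase]; split_ifs
      exacts [kqq2.1, kqp1.1, kpq1.1, kpp0.1])
    (fun e => by
      simp only [F, edgeCase]; split_ifs
      · rw [k2.2]; simp only [r]; ring
      · rw [k1.2, M10]; ring
      · rw [k1.2, M10]; ring
      · simp)
    (fun e => by
      simp only [F, ℓ, edgeCase]; split_ifs
      · rw [kq2.2]; simp only [μ]; field_simp; ring
      · rw [kq1.2, M11]; ring
      · rw [kp1.2]; ring
      · rw [kp0.2, M11]; ring)
    (fun e => by
      simp only [F, ℓ', edgeCase]; split_ifs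
      · rw [kq2.2]; simp only [μ]; field_simp; ring
      · rw [kp1.2]; ring
      · rw [kq1.2, M11]; ring
      · rw [kp0.2, M11]; ring)
    (fun e => by
      simp only [F, ℓ, ℓ', edgeCase]; split_ifs
      · rw [kqq2.2]; field_simp; ring
      · rw [kqp1.2]; ring
      · rw [kpq1.2]; ring
      · rw [kpp0.2]; ring) m
  refine ⟨main.1, main.2.trans ?_⟩
  rw [prod_edgeCase π τ r one_ne_zero one_ne_zero one_ne_zero, Finset.sum_sub_distrib,
    sum_edgeCase, sum_edgeCase]
  have hmm : ∀ e, edgeCase π τ μ (-t * M 2 1) (-t * M 2 1) 0 e *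
      edgeCase π τ μ (-t * M 2 1) (-t * M 2 1) 0 e =
      edgeCase π τ (μ ^ 2) ((t * M 2 1) ^ 2) ((t * M 2 1) ^ 2) 0 e := by
    intro e
    unfold edgeCase
    split_ifs <;> ring
  simp only [hmm, sum_edgeCase, one_pow, mul_one, div_one, one_mul]
  congr 1
  simp only [A, B, α, m]
  generalize hK : (agree π τ : ℝ) = K
  generalize (M 2 2 - 2 * t * M 3 2 + t ^ 2 * M 4 2) / r = H
  generalize M 2 2 = s
  generalize M 2 1 = u
  generalize M 3 2 = κ
  generalize μ = μ at *
  generalize (n : ℝ) = N at hnt ⊢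
  generalize t = t at hnt ⊢
  -- Both sides agree modulo the single relation n t = 1; the coefficient is the quotient by it.
  linear_combination (s * (N * t - 1) - 4 * K * u * μ + 4 * N * t * u ^ 2 - 2 * t * s + 2 * t * κ -
    8 * t * K * u ^ 2 - 2 * t * u ^ 2) * hnt

/-- The centred numerator vanishes in mean square. -/
lemma IsTilt.tendsto_integral_centredNumerator_sq (h : IsTilt ν Y x) :
    let m := -∫ ω, Y ω ^ 2 * x ω ∂ν
    Tendsto (fun n : ℕ => ∫ w : Fin n × Fin n → E, centredNumerator Y x m w ^ 2 ∂(edgeLaw ν n))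
      atTop (𝓝 0) ∧
    ∀ᶠ n : ℕ in atTop,
      Integrable (fun w : Fin n × Fin n → E => centredNumerator Y x m w ^ 2) (edgeLaw ν n) := by
  intro m
  let M : ℕ → ℕ → ℝ := fun a b => ∫ ω, Y ω ^ a * x ω ^ b ∂ν
  let r := M 2 0
  have hm : m = -M 2 1 := by simp [m, M]
  have hr : r ≠ 0 := by
    have := h.one_le_second_moment
    have : (1 : ℝ) ≤ r := by simpa [r, M] using this
    positivity
  let t : ℕ → ℝ := fun n => (n : ℝ)⁻¹
  have ht : Tendsto t atTop (𝓝 0) := tendsto_inv_nat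
  let μ : ℕ → ℝ := fun n => (M 2 1 - t n * M 3 1) / r
  let α : ℕ → ℝ := fun n => μ n + 2 * t n * M 2 1
  let A : ℕ → ℝ := fun n => -M 2 2 + 2 * t n * (M 3 2 - M 2 1 ^ 2 - M 2 2) + m ^ 2
  let B : ℕ → ℝ := fun n => (M 2 2 - 2 * t n * M 3 2 + t n ^ 2 * M 4 2) / r - μ n ^ 2 +
    2 * t n * M 2 2 - 2 * t n ^ 2 * M 3 2 + 2 * t n ^ 2 * M 2 1 ^ 2 + t n ^ 2 * M 2 2 +
    2 * m * α n
  have main : ∀ n : ℕ, n ≠ 0 →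
      Integrable (fun w : Fin n × Fin n → E => centredNumerator Y x m w ^ 2) (edgeLaw ν n) ∧
      ∫ w : Fin n × Fin n → E, centredNumerator Y x m w ^ 2 ∂(edgeLaw ν n) =
        overlapMean ℝ n (fun k => r ^ k * (A n + B n * k + α n ^ 2 * k ^ 2)) := by
    intro n hn
    have hp := fun π τ => h.integral_pair hn π τ
    simp only [← show m = -∫ ω, Y ω ^ 2 * x ω ^ 1 ∂ν from hm] at hp
    simp only [centredNumerator_sq]
    refine ⟨((integrable_finsetSum _ fun π _ => integrable_finsetSum _ fun τ _ =>
      (hp π τ).1).const_mul _).const_mul _, ?_⟩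
    rw [integral_const_mul, integral_const_mul, integral_finsetSum _ fun π _ =>
      integrable_finsetSum _ fun τ _ => (hp π τ).1]
    simp only [integral_finsetSum _ fun τ _ => (hp _ τ).1]
    simp only [(hp _ _).2]
    exact sum_sum_agree (fun k : ℕ => r ^ k * (A n + B n * k + α n ^ 2 * k ^ 2))
  refine ⟨?_, ?_⟩
  swap
  · filter_upwards [eventually_ne_atTop 0] with n hn
    exact (main n hn).1
  have lμ : Tendsto μ atTop (𝓝 ((M 2 1 - 0 * M 3 1) / r)) :=
    ((ht.mul_const _).const_sub _).div_const _
  have lα : Tendsto α atTop (𝓝 ((M 2 1 - 0 * M 3 1) / r + 2 * 0 * M 2 1)) :=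
    lμ.add ((ht.const_mul 2).mul_const _)
  have lA : Tendsto A atTop (𝓝 (-M 2 2 + 2 * 0 * (M 3 2 - M 2 1 ^ 2 - M 2 2) + m ^ 2)) :=
    (((ht.const_mul 2).mul_const _).const_add _).add_const _
  have lB : Tendsto B atTop (𝓝 ((M 2 2 - 2 * 0 * M 3 2 + 0 ^ 2 * M 4 2) / r -
      ((M 2 1 - 0 * M 3 1) / r) ^ 2 + 2 * 0 * M 2 2 - 2 * 0 ^ 2 * M 3 2 +
      2 * 0 ^ 2 * M 2 1 ^ 2 + 0 ^ 2 * M 2 2 +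
      2 * m * ((M 2 1 - 0 * M 3 1) / r + 2 * 0 * M 2 1))) :=
    ((((((((((ht.const_mul 2).mul_const _).const_sub _).add ((ht.pow 2).mul_const _)).div_const
      _).sub (lμ.pow 2)).add ((ht.const_mul 2).mul_const _)).sub
      (((ht.pow 2).const_mul 2).mul_const _)).add (((ht.pow 2).const_mul 2).mul_const _)).add
      ((ht.pow 2).mul_const _)).add (lα.const_mul _)
  have lim := tendsto_overlapMean_quadratic r lA lB (lα.pow 2)
  -- In the limit K is Poisson(r), with moments r and r² + r. The quadratic then collapses to 0 when
  -- u = m = -E Y²x and α = -u/r; this cancellation fixes the choice of m. The terms multiplied by 0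
  -- mirror the form in which the limits were produced.
  have hz : ∀ s κ u v₁ v₂ : ℝ, (-s + 2 * 0 * κ + u ^ 2) +
      ((s - 2 * 0 * v₁ + 0 ^ 2 * v₂) / r - ((-u) / r) ^ 2 + 2 * u * ((-u) / r)) * r +
      ((-u) / r) ^ 2 * (r ^ 2 + r) = 0 := by
    intro s κ u v₁ v₂
    field_simp
    ring
  have hz' : Real.exp (r - 1) * (-M 2 2 + 2 * 0 * (M 3 2 - M 2 1 ^ 2 - M 2 2) + m ^ 2 +
      ((M 2 2 - 2 * 0 * M 3 2 + 0 ^ 2 * M 4 2) / r -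
      ((M 2 1 - 0 * M 3 1) / r) ^ 2 + 2 * 0 * M 2 2 - 2 * 0 ^ 2 * M 3 2 +
      2 * 0 ^ 2 * M 2 1 ^ 2 + 0 ^ 2 * M 2 2 +
      2 * m * ((M 2 1 - 0 * M 3 1) / r + 2 * 0 * M 2 1)) * r +
      ((M 2 1 - 0 * M 3 1) / r + 2 * 0 * M 2 1) ^ 2 * (r ^ 2 + r)) = 0 := by
    refine mul_eq_zero_of_right _ ?_
    rw [hm]
    refine Eq.trans ?_ (hz (M 2 2) (M 3 2 - M 2 1 ^ 2 - M 2 2) (-M 2 1) (M 3 2) (M 4 2))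
    ring
  rw [hz'] at lim
  refine lim.congr' ?_
  filter_upwards [eventually_ne_atTop 0] with n hn
  exact (main n hn).2.symm

end Numerator

/-! ### From numerators to Gibbs averages. -/

section GibbsRatio

variable {E : Type*} [MeasurableSpace E] {ν : Measure E} [IsProbabilityMeasure ν] {Y x : E → ℝ}

/-- The statistic is a sum of n² independent copies of Yx, and its factor 1/n is the central limit
scaling 1/√(n²). -/
lemma IsTilt.integral_edgeStat_charFun (h : IsTilt ν Y x) {n : ℕ} (t : ℝ) :
    ∫ w : Fin n × Fin n → E, Complex.exp (t * edgeStat Y x w * Complex.I) ∂(edgeLaw ν n) =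
      charFun (ν.map fun ω => Y ω * x ω) ((√((n ^ 2 : ℕ) : ℝ))⁻¹ * t) ^ (n ^ 2) := by
  have hm : Measurable fun ω => Y ω * x ω := h.measurable_weight.mul h.measurable_obs
  have h1 : ∀ w : Fin n × Fin n → E, Complex.exp (t * edgeStat Y x w * Complex.I) =
      ∏ e, Complex.exp (((√((n ^ 2 : ℕ) : ℝ))⁻¹ * t : ℝ) * (Y (w e) * x (w e) : ℝ) * Complex.I) := by
    intro w
    rw [← Complex.exp_sum]
    congr 1
    rw [← Finset.sum_mul, ← Finset.mul_sum, Nat.cast_pow, Real.sqrt_sq (Nat.cast_nonneg n),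
      edgeStat]
    push_cast
    ring
  simp only [h1]
  rw [integral_fintype_prod_eq_prod (f := fun _ ω =>
    Complex.exp (((√((n ^ 2 : ℕ) : ℝ))⁻¹ * t : ℝ) * (Y ω * x ω : ℝ) * Complex.I)),
    Finset.prod_const, charFun_apply_real, integral_map hm.aemeasurable (by fun_prop)]
  simp [sq]

lemma IsTilt.tendsto_edgeStat_charFun (h : IsTilt ν Y x) (t : ℝ) :
    Tendsto (fun n : ℕ => ∫ w : Fin n × Fin n → E,
      Complex.exp (t * edgeStat Y x w * Complex.I) ∂(edgeLaw ν n)) atTop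
      (𝓝 (Complex.exp (-((∫ ω, Y ω ^ 2 * x ω ^ 2 ∂ν : ℝ) * t ^ 2 / 2)))) := by
  have hm : Measurable fun ω => Y ω * x ω := h.measurable_weight.mul h.measurable_obs
  have : IsProbabilityMeasure (ν.map fun ω => Y ω * x ω) :=
    Measure.isProbabilityMeasure_map hm.aemeasurable
  have h2 : MemLp id 2 (ν.map fun ω => Y ω * x ω) := by
    rw [memLp_two_iff_integrable_sq aestronglyMeasurable_id,
      integrable_map_measure (by fun_prop) hm.aemeasurable]
    simpa [Function.comp_def, mul_pow] using h.integrable 1 2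
  have h0 : ∫ y, y ∂(ν.map fun ω => Y ω * x ω) = 0 := by
    rw [integral_map hm.aemeasurable (by fun_prop)]
    exact h.centered
  have hs : ∫ y, y ^ 2 ∂(ν.map fun ω => Y ω * x ω) = ∫ ω, Y ω ^ 2 * x ω ^ 2 ∂ν := by
    rw [integral_map hm.aemeasurable (by fun_prop)]
    simp only [mul_pow]
  simp only [h.integral_edgeStat_charFun]
  rw [← hs]
  exact (tendsto_charFun_pow h2 h0 t).comp (tendsto_pow_atTop (α := ℕ) two_ne_zero)

lemma norm_exp_mul_I_sub_le (a b : ℝ) :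
    ‖Complex.exp (a * Complex.I) - Complex.exp (b * Complex.I)‖ ≤ |a - b| := by
  have h1 : Complex.exp (a * Complex.I) - Complex.exp (b * Complex.I) =
      Complex.exp (b * Complex.I) * (Complex.exp (Complex.I * ((a - b : ℝ) : ℂ)) - 1) := by
    rw [mul_sub, mul_one, ← Complex.exp_add]
    congr 2
    push_cast
    ring
  rw [h1, norm_mul, Complex.norm_exp_ofReal_mul_I, one_mul]
  exact Real.norm_exp_I_mul_ofReal_sub_one_le

/-- Variables that are close in probability have the same characteristic function limits. -/
lemma tendsto_integral_exp_of_close {Ω : ℕ → Type*} [∀ n, MeasurableSpace (Ω n)]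
    {P : ∀ n, Measure (Ω n)} [∀ n, IsProbabilityMeasure (P n)] {X Z : ∀ n, Ω n → ℝ}
    (hX : ∀ n, Measurable (X n)) (hZ : ∀ n, Measurable (Z n))
    (hXZ : ∀ ε > 0, Tendsto (fun n => (P n).real {a | ε ≤ |X n a - Z n a|}) atTop (𝓝 0))
    {t : ℝ} {c : ℂ}
    (hlim : Tendsto (fun n => ∫ a, Complex.exp (t * Z n a * Complex.I) ∂(P n)) atTop (𝓝 c)) :
    Tendsto (fun n => ∫ a, Complex.exp (t * X n a * Complex.I) ∂(P n)) atTop (𝓝 c) := by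
  have hmX : ∀ n, Measurable fun a => Complex.exp (t * X n a * Complex.I) := fun n => by
    have := hX n; fun_prop
  have hmZ : ∀ n, Measurable fun a => Complex.exp (t * Z n a * Complex.I) := fun n => by
    have := hZ n; fun_prop
  have iX : ∀ n, Integrable (fun a => Complex.exp (t * X n a * Complex.I)) (P n) := fun n =>
    Integrable.of_bound (hmX n).aestronglyMeasurable 1
      (Eventually.of_forall fun a => (norm_exp_phase t (X n a)).le)
  have iZ : ∀ n, Integrable (fun a => Complex.exp (t * Z n a * Complex.I)) (P n) := fun n =>
    Integrable.of_bound (hmZ n).aestronglyMeasurable 1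
      (Eventually.of_forall fun a => (norm_exp_phase t (Z n a)).le)
  suffices h0 : Tendsto (fun n => ∫ a, Complex.exp (t * X n a * Complex.I) ∂(P n) -
      ∫ a, Complex.exp (t * Z n a * Complex.I) ∂(P n)) atTop (𝓝 0) by
    simpa using h0.add hlim
  rw [Metric.tendsto_atTop]
  intro η hη
  obtain ⟨ε, hε, hεt⟩ : ∃ ε > 0, |t| * ε < η / 2 := by
    refine ⟨η / 2 / (|t| + 1), by positivity, ?_⟩
    rw [mul_div_assoc', div_lt_iff₀ (by positivity)]
    nlinarith [abs_nonneg t]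
  obtain ⟨N, hN⟩ := (Metric.tendsto_atTop.1 (hXZ ε hε)) (η / 4) (by positivity)
  refine ⟨N, fun n hn => ?_⟩
  have hS : MeasurableSet {a | ε ≤ |X n a - Z n a|} := by
    have := hX n; have := hZ n
    exact measurableSet_le measurable_const (by fun_prop)
  have hp : (P n).real {a | ε ≤ |X n a - Z n a|} < η / 4 := by
    have := hN n hn
    rw [Real.dist_eq, sub_zero] at this
    exact (le_abs_self _).trans_lt this
  rw [dist_zero_right, ← integral_sub (iX n) (iZ n)]
  have bound : ∀ a, ‖Complex.exp (t * X n a * Complex.I) - Complex.exp (t * Z n a * Complex.I)‖ ≤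
      |t| * ε + {a | ε ≤ |X n a - Z n a|}.indicator (fun _ => (2 : ℝ)) a := by
    intro a
    by_cases ha : ε ≤ |X n a - Z n a|
    · rw [Set.indicator_of_mem (by exact ha)]
      refine (norm_sub_le _ _).trans ?_
      rw [norm_exp_phase, norm_exp_phase]
      have : 0 ≤ |t| * ε := by positivity
      linarith
    · rw [Set.indicator_of_notMem (by exact ha), add_zero, ← Complex.ofReal_mul,
        ← Complex.ofReal_mul]
      refine (norm_exp_mul_I_sub_le _ _).trans ?_
      rw [← mul_sub, abs_mul]
      exact mul_le_mul_of_nonneg_left (not_le.1 ha).le (abs_nonneg t)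
  have iB : Integrable ({a | ε ≤ |X n a - Z n a|}.indicator (fun _ => (2 : ℝ))) (P n) :=
    (integrable_const _).indicator hS
  calc _ ≤ ∫ a, (|t| * ε + {a | ε ≤ |X n a - Z n a|}.indicator (fun _ => (2 : ℝ)) a) ∂(P n) :=
        norm_integral_le_of_norm_le ((integrable_const _).add iB) (Eventually.of_forall bound)
    _ = |t| * ε + 2 * (P n).real {a | ε ≤ |X n a - Z n a|} := by
        rw [integral_add (integrable_const _) iB, integral_indicator_const _ hS]
        simp [mul_comm]
    _ < η := by linarith

/-- The Gibbs average of the observable of a matching. -/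
noncomputable def ratioMean {n : ℕ} (Y : E → ℝ) (w : Fin n × Fin n → E)
    (f : Equiv.Perm (Fin n) → ℝ) : ℝ :=
  (∑ π, matchWeight Y w π * f π) / ∑ π, matchWeight Y w π

lemma permMean_eq {n : ℕ} (Y : E → ℝ) (w : Fin n × Fin n → E) :
    permMean Y w = (n.factorial : ℝ)⁻¹ * ∑ π, matchWeight Y w π := rfl

/-- Centring inside the numerator is legitimate because a Gibbs average of a constant is that
constant, provided the denominator is nonzero. -/
lemma ratioMean_sub {n : ℕ} (Y : E → ℝ) (w : Fin n × Fin n → E) (f : Equiv.Perm (Fin n) → ℝ)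
    (c : ℝ) (hZ : permMean Y w ≠ 0) :
    ratioMean Y w f - c =
      ((n.factorial : ℝ)⁻¹ * ∑ π, matchWeight Y w π * (f π - c)) / permMean Y w := by
  rw [permMean_eq] at hZ
  have h1 := left_ne_zero_of_mul hZ
  have h2 := right_ne_zero_of_mul hZ
  rw [permMean_eq, mul_div_mul_left _ _ h1, ratioMean, eq_div_iff h2, sub_mul, div_mul_cancel₀ _ h2]
  simp only [mul_sub, Finset.sum_sub_distrib, ← Finset.sum_mul]
  ring

/-- Dividing by the normalized permanent preserves convergence to zero in probability. -/
lemma IsTilt.tendsto_measure_of_div (h : IsTilt ν Y x)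
    {N R : ∀ n : ℕ, (Fin n × Fin n → E) → ℝ}
    (hR : ∀ n w, permMean Y w ≠ 0 → R n w = N n w / permMean Y w)
    (hN : ∀ ε > 0, Tendsto (fun n => (edgeLaw ν n).real {w | ε ≤ |N n w|}) atTop (𝓝 0))
    {ε : ℝ} (hε : 0 < ε) :
    Tendsto (fun n => (edgeLaw ν n).real {w | ε ≤ |R n w|}) atTop (𝓝 0) := by
  rw [Metric.tendsto_atTop]
  intro η hη
  obtain ⟨δ, hδ, hδ'⟩ := h.exists_permMean_lower_bound (half_pos hη)
  obtain ⟨K, hK⟩ := eventually_atTop.1 hδ'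
  obtain ⟨K', hK'⟩ := Metric.tendsto_atTop.1 (hN (ε * δ) (by positivity)) (η / 2) (half_pos hη)
  refine ⟨max K K', fun n hn => ?_⟩
  have h1 := hK n ((le_max_left _ _).trans hn)
  have h2 := hK' n ((le_max_right _ _).trans hn)
  rw [Real.dist_eq, sub_zero, abs_of_nonneg measureReal_nonneg] at h2 ⊢
  have hsub : {w : Fin n × Fin n → E | ε ≤ |R n w|} ⊆
      {w | permMean Y w < δ} ∪ {w | ε * δ ≤ |N n w|} := by
    intro w hw
    by_contra hcon
    simp only [Set.mem_union, Set.mem_ofPred_eq, not_or, not_lt, not_le] at hcon hw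
    obtain ⟨c1, c2⟩ := hcon
    have hpos : 0 < permMean Y w := hδ.trans_le c1
    rw [hR n w hpos.ne', abs_div, abs_of_pos hpos, le_div_iff₀ hpos] at hw
    have : ε * δ ≤ ε * permMean Y w := mul_le_mul_of_nonneg_left c1 hε.le
    linarith
  calc _ ≤ _ := measureReal_mono hsub
    _ ≤ _ := measureReal_union_le _ _
    _ < η := by linarith

lemma IsTilt.measurable_ratioMean (h : IsTilt ν Y x) {n : ℕ}
    {f : (Fin n × Fin n → E) → Equiv.Perm (Fin n) → ℝ} (hf : ∀ π, Measurable fun w => f w π) :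
    Measurable fun w : Fin n × Fin n → E => ratioMean Y w (f w) := by
  have := h.measurable_matchWeight (n := n)
  unfold ratioMean
  fun_prop

lemma IsTilt.measurable_edgeStat (h : IsTilt ν Y x) (n : ℕ) :
    Measurable fun w : Fin n × Fin n → E => edgeStat Y x w := by
  have := h.measurable_weight
  have := h.measurable_obs
  unfold edgeStat
  fun_prop

/-- Characteristic function limit of the Gibbs average of the observable. -/
lemma IsTilt.tendsto_ratioMean_charFun (h : IsTilt ν Y x) (t : ℝ) :
    Tendsto (fun n : ℕ => ∫ w : Fin n × Fin n → E,
      Complex.exp (t * ratioMean Y w (obsSum x w) * Complex.I) ∂(edgeLaw ν n)) atTop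
      (𝓝 (Complex.exp (t * (-∫ ω, Y ω ^ 2 * x ω ∂ν : ℝ) * Complex.I -
        (∫ ω, Y ω ^ 2 * x ω ^ 2 ∂ν : ℝ) * t ^ 2 / 2))) := by
  set m : ℝ := -∫ ω, Y ω ^ 2 * x ω ∂ν with hm
  obtain ⟨h1, h2⟩ := h.tendsto_integral_centredNumerator_sq
  rw [← hm] at h1 h2
  have hN := fun ε (hε : (0 : ℝ) < ε) => tendsto_measure_of_tendsto_integral_sq
    (fun n => edgeLaw ν n) (fun n w => centredNumerator Y x m w) h2 h1 hε
  -- The Gibbs average is compared with the linear statistic plus m: their difference is the centred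
  -- numerator over the permanent. The shift m becomes the limiting mean, the statistic supplies the
  -- variance.
  refine tendsto_integral_exp_of_close (P := fun n => edgeLaw ν n)
    (Z := fun n w => edgeStat Y x w + m)
    (fun n => h.measurable_ratioMean fun π => h.measurable_obsSum π)
    (fun n => (h.measurable_edgeStat n).add_const m) (fun ε hε => ?_) ?_
  · refine h.tendsto_measure_of_div (N := fun n w => centredNumerator Y x m w) ?_ hN hε
    intro n w hw
    rw [ratioMean_sub _ _ _ _ hw, centredNumerator]
    simp only [sub_sub]
  · have := (h.tendsto_edgeStat_charFun t).mul_const (Complex.exp (t * m * Complex.I))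
    rw [← Complex.exp_add] at this
    have e : -((∫ ω, Y ω ^ 2 * x ω ^ 2 ∂ν : ℝ) * (t : ℂ) ^ 2 / 2) + t * m * Complex.I =
      t * m * Complex.I - (∫ ω, Y ω ^ 2 * x ω ^ 2 ∂ν : ℝ) * t ^ 2 / 2 := by ring
    rw [e] at this
    refine this.congr fun n => ?_
    rw [← integral_mul_const]
    refine integral_congr_ae (Eventually.of_forall fun w => ?_)
    simp only
    rw [← Complex.exp_add]
    congr 1
    push_cast
    ring

/-- The quenched law of the rescaled observable is asymptotically Gaussian in probability. -/
lemma IsTilt.tendsto_measure_ratioMean_test (h : IsTilt ν Y x) (f : ℝ →ᵇ ℝ) {ε : ℝ} (hε : 0 < ε) :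
    Tendsto (fun n : ℕ => (edgeLaw ν n).real {w : Fin n × Fin n → E | ε ≤
      |ratioMean Y w (fun π => f ((√(n : ℝ))⁻¹ * obsSum x w π)) -
        ∫ y, f y ∂(gaussianReal 0 (∫ ω, Y ω * x ω ^ 2 ∂ν).toNNReal)|}) atTop (𝓝 0) := by
  set c := ∫ y, f y ∂(gaussianReal 0 (∫ ω, Y ω * x ω ^ 2 ∂ν).toNNReal) with hc
  let g : ℝ →ᵇ ℝ := f - BoundedContinuousFunction.const ℝ c
  have hg : ∀ y, g y = f y - c := fun y => rfl
  have hg0 : ∫ y, g y ∂(gaussianReal 0 (∫ ω, Y ω * x ω ^ 2 ∂ν).toNNReal) = 0 := by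
    simp only [hg]
    rw [integral_sub (f.integrable _) (integrable_const _)]
    simp [hc]
  refine h.tendsto_measure_of_div (N := fun n w => (n.factorial : ℝ)⁻¹ *
      ∑ π, matchWeight Y w π * g ((√(n : ℝ))⁻¹ * obsSum x w π)) ?_ (fun ε hε => ?_) hε
  · intro n w hw
    rw [ratioMean_sub _ _ _ _ hw]
    rfl
  · exact tendsto_measure_of_tendsto_integral_sq (fun n => edgeLaw ν n) _
      (Eventually.of_forall fun n => h.integrable_testSum_sq g n)
      (h.tendsto_integral_testSum_sq g hg0) hε

/-- The normalized permanent vanishes with vanishing probability. -/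
lemma IsTilt.tendsto_measure_permMean_eq_zero (h : IsTilt ν Y x) :
    Tendsto (fun n : ℕ => (edgeLaw ν n).real {w : Fin n × Fin n → E | permMean Y w = 0})
      atTop (𝓝 0) := by
  rw [Metric.tendsto_atTop]
  intro η hη
  obtain ⟨δ, hδ, hδ'⟩ := h.exists_permMean_lower_bound (half_pos hη)
  obtain ⟨K, hK⟩ := eventually_atTop.1 hδ'
  refine ⟨K, fun n hn => ?_⟩
  rw [Real.dist_eq, sub_zero, abs_of_nonneg measureReal_nonneg]
  refine lt_of_le_of_lt ((measureReal_mono fun w hw => ?_).trans (hK n hn)) (half_lt_self hη)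
  simp only [Set.mem_ofPred_eq] at hw ⊢
  rw [hw]
  exact hδ

end GibbsRatio

/-! ### Identification of ψ as a cumulant generating function, and the tilted moments. -/

section LogLaplace

variable {ν : Measure EReal} [IsProbabilityMeasure ν]

/-- The restriction of the weight law to finite weights. -/
noncomputable abbrev finPart (ν : Measure EReal) : Measure EReal := ν.restrict {⊤}ᶜ

/-- The negative of the weight, with junk value at infinite weights. -/
noncomputable def negReal (ω : EReal) : ℝ := -ω.toReal

lemma measurable_negReal : Measurable negReal := measurable_ereal_toReal.neg

/-- The function `exp (-t ω)` with real values. -/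
noncomputable def expWeight (t : ℝ) (ω : EReal) : ℝ := (EReal.exp (-((t : EReal) * ω))).toReal

lemma measurable_exp_neg_mul (t : ℝ) : Measurable fun ω : EReal => EReal.exp (-((t : EReal) * ω)) := by
  fun_prop

lemma measurable_expWeight (t : ℝ) : Measurable (expWeight t) :=
  (measurable_exp_neg_mul t).ennreal_toReal

lemma exp_neg_mul_coe (t r : ℝ) :
    EReal.exp (-((t : EReal) * (r : EReal))) = ENNReal.ofReal (Real.exp (t * -r)) := by
  rw [← EReal.coe_mul, ← EReal.coe_neg, EReal.exp_coe, mul_neg]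

lemma expWeight_coe (t r : ℝ) : expWeight t (r : EReal) = Real.exp (t * -r) := by
  rw [expWeight, exp_neg_mul_coe, ENNReal.toReal_ofReal (Real.exp_nonneg _)]

lemma exp_neg_mul_top {t : ℝ} (ht : 0 < t) : EReal.exp (-((t : EReal) * ⊤)) = 0 := by
  rw [EReal.coe_mul_top_of_pos ht, EReal.neg_top, EReal.exp_bot]

lemma expWeight_top {t : ℝ} (ht : 0 < t) : expWeight t ⊤ = 0 := by
  rw [expWeight, exp_neg_mul_top ht, ENNReal.toReal_zero]

lemma expWeight_nonneg (t : ℝ) (ω : EReal) : 0 ≤ expWeight t ω := ENNReal.toReal_nonneg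

lemma ae_ne_bot (hfin : ∀ t : ℝ, 0 < t → laplace ν t < ∞) : ∀ᵐ ω ∂ν, ω ≠ ⊥ := by
  filter_upwards [ae_lt_top (measurable_exp_neg_mul 1) (hfin 1 one_pos).ne] with ω hω hbot
  rw [hbot, EReal.coe_mul_bot_of_pos one_pos, EReal.neg_bot, EReal.exp_top] at hω
  exact lt_irrefl _ hω

/-- For t > 0 the atom at ⊤ contributes nothing and finiteness excludes one at ⊥. Hence ψ is the
cumulant generating function of -ω under the restriction of ν to finite weights, a nonzero measure
of mass at most 1; its analyticity gives the regularity of ψ. -/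
lemma laplace_eq (hfin : ∀ t : ℝ, 0 < t → laplace ν t < ∞) {t : ℝ} (ht : 0 < t) :
    laplace ν t = ∫⁻ ω, ENNReal.ofReal (Real.exp (t * negReal ω)) ∂(finPart ν) := by
  rw [laplace, ← lintegral_indicator (measurableSet_singleton _).compl]
  refine lintegral_congr_ae ?_
  filter_upwards [ae_ne_bot hfin] with ω hω
  induction ω with
  | bot => exact absurd rfl hω
  | top => simp [exp_neg_mul_top ht]
  | coe r =>
    rw [Set.indicator_of_mem (by simp), exp_neg_mul_coe, negReal, EReal.toReal_coe]

lemma integrable_exp_negReal (hfin : ∀ t : ℝ, 0 < t → laplace ν t < ∞) {t : ℝ} (ht : 0 < t) :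
    Integrable (fun ω => Real.exp (t * negReal ω)) (finPart ν) := by
  have hm := measurable_negReal
  have hmeas : AEStronglyMeasurable (fun ω => Real.exp (t * negReal ω)) (finPart ν) := by
    fun_prop
  rw [← lintegral_ofReal_ne_top_iff_integrable hmeas (Eventually.of_forall fun _ =>
    (Real.exp_nonneg _)), ← laplace_eq hfin ht]
  exact (hfin t ht).ne

lemma toReal_laplace (hfin : ∀ t : ℝ, 0 < t → laplace ν t < ∞) {t : ℝ} (ht : 0 < t) :
    (laplace ν t).toReal = mgf negReal (finPart ν) t := by
  rw [laplace_eq hfin ht, mgf, integral_eq_lintegral_of_nonneg_ae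
    (Eventually.of_forall fun _ => (Real.exp_nonneg _))
    (integrable_exp_negReal hfin ht).aestronglyMeasurable]

lemma psi_eq_cgf (hfin : ∀ t : ℝ, 0 < t → laplace ν t < ∞) {t : ℝ} (ht : 0 < t) :
    psi ν t = cgf negReal (finPart ν) t := by
  rw [psi, toReal_laplace hfin ht, cgf]

lemma mem_interior_integrableExpSet (hfin : ∀ t : ℝ, 0 < t → laplace ν t < ∞) {t : ℝ}
    (ht : 0 < t) : t ∈ interior (integrableExpSet negReal (finPart ν)) :=
  mem_interior.2 ⟨Set.Ioi 0, fun _ hs => integrable_exp_negReal hfin hs, isOpen_Ioi, ht⟩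

lemma psi_eventuallyEq (hfin : ∀ t : ℝ, 0 < t → laplace ν t < ∞) {t : ℝ} (ht : 0 < t) :
    psi ν =ᶠ[𝓝 t] cgf negReal (finPart ν) := by
  filter_upwards [Ioi_mem_nhds ht] with s hs
  exact psi_eq_cgf hfin hs

lemma finPart_ne_zero (htop : ν {⊤} ≠ 1) : finPart ν ≠ 0 := by
  intro h0
  rw [Measure.restrict_eq_zero, prob_compl_eq_zero_iff (measurableSet_singleton _)] at h0
  exact htop h0

lemma contDiffOn_psi (hfin : ∀ t : ℝ, 0 < t → laplace ν t < ∞) :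
    ContDiffOn ℝ 2 (psi ν) (Set.Ioi 0) := by
  intro t ht
  have := (analyticAt_cgf (mem_interior_integrableExpSet hfin ht)).contDiffAt (n := 2)
  exact (this.congr_of_eventuallyEq (psi_eventuallyEq hfin ht)).contDiffWithinAt

lemma exp_psi (hfin : ∀ t : ℝ, 0 < t → laplace ν t < ∞) (htop : ν {⊤} ≠ 1) {t : ℝ} (ht : 0 < t) :
    Real.exp (psi ν t) = mgf negReal (finPart ν) t := by
  rw [psi, toReal_laplace hfin ht, Real.exp_log
    (mgf_pos' (finPart_ne_zero htop) (integrable_exp_negReal hfin ht))]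

/-- Since t is interior to the set of finite exponential moments, polynomial factors cost nothing.
Applying this to the shifted variable directly avoids a binomial expansion. -/
lemma integrable_pow_mul_exp (hfin : ∀ t : ℝ, 0 < t → laplace ν t < ∞) {t : ℝ} (ht : 0 < t)
    (c : ℝ) (b : ℕ) :
    Integrable (fun ω => (c - negReal ω) ^ b * Real.exp (t * negReal ω)) (finPart ν) := by
  have hU : ∀ s : ℝ, 0 < s →
      Integrable (fun ω => Real.exp (s * (negReal ω - c))) (finPart ν) := by
    intro s hs
    refine ((integrable_exp_negReal hfin hs).mul_const (Real.exp (-(s * c)))).congr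
      (Eventually.of_forall fun ω => ?_)
    simp only
    rw [← Real.exp_add]
    ring_nf
  have hmem : t ∈ interior (integrableExpSet (fun ω => negReal ω - c) (finPart ν)) :=
    mem_interior.2 ⟨Set.Ioi 0, fun s hs => hU s hs, isOpen_Ioi, ht⟩
  have := (integrable_pow_mul_exp_of_mem_interior_integrableExpSet hmem b).const_mul
    ((-1) ^ b * Real.exp (t * c))
  refine this.congr (Eventually.of_forall fun ω => ?_)
  simp only
  rw [show c - negReal ω = -1 * (negReal ω - c) by ring, mul_pow,
    show t * negReal ω = t * c + t * (negReal ω - c) by ring, Real.exp_add]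
  ring

lemma deriv_psi (hfin : ∀ t : ℝ, 0 < t → laplace ν t < ∞) {t : ℝ} (ht : 0 < t) :
    deriv (psi ν) t = deriv (cgf negReal (finPart ν)) t :=
  (psi_eventuallyEq hfin ht).deriv_eq

lemma deriv_deriv_psi (hfin : ∀ t : ℝ, 0 < t → laplace ν t < ∞) {t : ℝ} (ht : 0 < t) :
    deriv (deriv (psi ν)) t = iteratedDeriv 2 (cgf negReal (finPart ν)) t := by
  rw [(psi_eventuallyEq hfin ht).deriv.deriv_eq, iteratedDeriv_succ, iteratedDeriv_one]

lemma integral_centred_mul_exp (hfin : ∀ t : ℝ, 0 < t → laplace ν t < ∞) (htop : ν {⊤} ≠ 1)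
    {t : ℝ} (ht : 0 < t) (c : ℝ) :
    ∫ ω, (c - negReal ω) * Real.exp (t * negReal ω) ∂(finPart ν) =
      Real.exp (psi ν t) * (c - deriv (psi ν) t) := by
  have i1 := integrable_exp_negReal hfin ht
  have hmem := mem_interior_integrableExpSet hfin ht
  have i2 : Integrable (fun ω => negReal ω * Real.exp (t * negReal ω)) (finPart ν) := by
    simpa using integrable_pow_mul_exp_of_mem_interior_integrableExpSet hmem 1
  have hpos := mgf_pos' (finPart_ne_zero htop) i1
  have hd := deriv_cgf hmem
  rw [← deriv_psi hfin ht, eq_div_iff hpos.ne', ← exp_psi hfin htop ht] at hd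
  simp only [sub_mul]
  rw [integral_sub (i1.const_mul c) i2, integral_const_mul, ← hd]
  change c * mgf negReal (finPart ν) t - _ = _
  rw [← exp_psi hfin htop ht]
  ring

lemma integral_centred_sq_mul_exp (hfin : ∀ t : ℝ, 0 < t → laplace ν t < ∞) (htop : ν {⊤} ≠ 1)
    {t : ℝ} (ht : 0 < t) (c : ℝ) :
    ∫ ω, (c - negReal ω) ^ 2 * Real.exp (t * negReal ω) ∂(finPart ν) =
      Real.exp (psi ν t) * (deriv (deriv (psi ν)) t + (c - deriv (psi ν) t) ^ 2) := by
  have i1 := integrable_exp_negReal hfin ht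
  have hpos := mgf_pos' (finPart_ne_zero htop) i1
  have hmem := mem_interior_integrableExpSet hfin ht
  set d := deriv (psi ν) t with hd
  have h2 := iteratedDeriv_two_cgf_eq_integral hmem
  rw [← deriv_deriv_psi hfin ht, ← deriv_psi hfin ht, eq_div_iff hpos.ne', ← exp_psi hfin htop ht]
    at h2
  have j0 := i1.const_mul ((c - d) ^ 2)
  have j1 : Integrable (fun ω => 2 * (c - d) * ((d - negReal ω) * Real.exp (t * negReal ω)))
      (finPart ν) := by
    simpa using (integrable_pow_mul_exp hfin ht d 1).const_mul (2 * (c - d))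
  have j2 := integrable_pow_mul_exp hfin ht d 2
  have expand : ∀ ω, (c - negReal ω) ^ 2 * Real.exp (t * negReal ω) =
      (d - negReal ω) ^ 2 * Real.exp (t * negReal ω) +
      2 * (c - d) * ((d - negReal ω) * Real.exp (t * negReal ω)) +
      (c - d) ^ 2 * Real.exp (t * negReal ω) := fun ω => by ring
  simp only [expand]
  rw [integral_add (f := fun ω => (d - negReal ω) ^ 2 * Real.exp (t * negReal ω) +
      2 * (c - d) * ((d - negReal ω) * Real.exp (t * negReal ω))) (j2.add j1) j0, integral_add j2 j1, integral_const_mul, integral_const_mul,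
    integral_centred_mul_exp hfin htop ht, ← hd]
  have h3 : ∫ ω, (d - negReal ω) ^ 2 * Real.exp (t * negReal ω) ∂(finPart ν) =
      deriv (deriv (psi ν)) t * Real.exp (psi ν t) := by
    rw [h2]
    refine integral_congr_ae (Eventually.of_forall fun ω => ?_)
    simp only [← hd]
    ring
  rw [h3]
  change _ + _ + (c - d) ^ 2 * mgf negReal (finPart ν) t = _
  rw [← exp_psi hfin htop ht]
  ring

lemma deriv_deriv_psi_nonneg (hfin : ∀ t : ℝ, 0 < t → laplace ν t < ∞) (htop : ν {⊤} ≠ 1)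
    {t : ℝ} (ht : 0 < t) : 0 ≤ deriv (deriv (psi ν)) t := by
  have h := integral_centred_sq_mul_exp hfin htop ht (deriv (psi ν) t)
  rw [sub_self, zero_pow two_ne_zero, add_zero] at h
  have h0 : 0 ≤ Real.exp (psi ν t) * deriv (deriv (psi ν)) t := by
    rw [← h]
    exact integral_nonneg fun ω => by positivity
  exact nonneg_of_mul_nonneg_right h0 (Real.exp_pos _)

lemma limitVar_nonneg (hfin : ∀ t : ℝ, 0 < t → laplace ν t < ∞) (htop : ν {⊤} ≠ 1)
    {β : ℝ} (hβ : 0 < β) : 0 ≤ limitVar ν β := by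
  have := deriv_deriv_psi_nonneg hfin htop (t := 2 * β) (by positivity)
  unfold limitVar
  positivity

/-- The normalized Boltzmann factor of an edge. -/
noncomputable def tiltWeight (ν : Measure EReal) (β : ℝ) (ω : EReal) : ℝ :=
  Real.exp (-psi ν β) * expWeight β ω

/-- The edge weight centred by its tilted mean. -/
noncomputable def tiltObs (ν : Measure EReal) (β : ℝ) (ω : EReal) : ℝ :=
  deriv (psi ν) β - negReal ω

/-- The exponent a + 1 is at least 1, so the weight kills the junk value of the observable at ⊤. The
power of the weight at β is, up to a constant, the exponential at (a + 1)β. -/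
lemma tilt_ae_eq_indicator (hfin : ∀ t : ℝ, 0 < t → laplace ν t < ∞) {β : ℝ} (hβ : 0 < β)
    (a b : ℕ) :
    (fun ω => tiltWeight ν β ω ^ (a + 1) * tiltObs ν β ω ^ b) =ᵐ[ν]
      Set.indicator {⊤}ᶜ (fun ω => Real.exp (-psi ν β) ^ (a + 1) *
        ((deriv (psi ν) β - negReal ω) ^ b * Real.exp ((a + 1 : ℕ) * β * negReal ω))) := by
  filter_upwards [ae_ne_bot hfin] with ω hω
  induction ω with
  | bot => exact absurd rfl hω
  | top => simp [tiltWeight, expWeight_top hβ]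
  | coe r =>
    rw [Set.indicator_of_mem (by simp), tiltWeight, expWeight_coe, tiltObs, mul_pow,
      ← Real.exp_nat_mul, ← Real.exp_nat_mul]
    simp only [negReal, EReal.toReal_coe, mul_assoc]
    ring

lemma integrable_tilt (hfin : ∀ t : ℝ, 0 < t → laplace ν t < ∞) {β : ℝ} (hβ : 0 < β) (a b : ℕ) :
    Integrable (fun ω => tiltWeight ν β ω ^ (a + 1) * tiltObs ν β ω ^ b) ν := by
  rw [integrable_congr (tilt_ae_eq_indicator hfin hβ a b),
    integrable_indicator_iff (measurableSet_singleton _).compl]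
  exact (integrable_pow_mul_exp hfin (by positivity) _ b).const_mul _

lemma integral_tilt (hfin : ∀ t : ℝ, 0 < t → laplace ν t < ∞) {β : ℝ} (hβ : 0 < β) (a b : ℕ) :
    ∫ ω, tiltWeight ν β ω ^ (a + 1) * tiltObs ν β ω ^ b ∂ν = Real.exp (-psi ν β) ^ (a + 1) *
      ∫ ω, (deriv (psi ν) β - negReal ω) ^ b * Real.exp ((a + 1 : ℕ) * β * negReal ω)
        ∂(finPart ν) := by
  rw [integral_congr_ae (tilt_ae_eq_indicator hfin hβ a b),
    integral_indicator (measurableSet_singleton _).compl, integral_const_mul]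

lemma isTilt (hfin : ∀ t : ℝ, 0 < t → laplace ν t < ∞) (htop : ν {⊤} ≠ 1) {β : ℝ} (hβ : 0 < β) :
    IsTilt ν (tiltWeight ν β) (tiltObs ν β) where
  measurable_weight := (measurable_expWeight β).const_mul _
  measurable_obs := measurable_negReal.const_sub _
  nonneg ω := mul_nonneg (Real.exp_nonneg _) (expWeight_nonneg _ _)
  integrable := integrable_tilt hfin hβ
  mean_one := by
    have h := integral_tilt hfin hβ 0 0
    simp only [zero_add, pow_one, pow_zero, mul_one, one_mul, Nat.cast_one] at h
    rw [h]
    change _ * mgf negReal (finPart ν) β = 1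
    rw [← exp_psi hfin htop hβ, ← Real.exp_add, neg_add_cancel, Real.exp_zero]
  centered := by
    have h := integral_tilt hfin hβ 0 1
    simp only [zero_add, pow_one, one_mul, Nat.cast_one] at h
    rw [h, integral_centred_mul_exp hfin htop hβ]
    ring

lemma integral_tilt_sq (hfin : ∀ t : ℝ, 0 < t → laplace ν t < ∞) (htop : ν {⊤} ≠ 1) {β : ℝ}
    (hβ : 0 < β) :
    ∫ ω, tiltWeight ν β ω * tiltObs ν β ω ^ 2 ∂ν = deriv (deriv (psi ν)) β := by
  have h := integral_tilt hfin hβ 0 2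
  simp only [zero_add, pow_one, one_mul, Nat.cast_one] at h
  rw [h, integral_centred_sq_mul_exp hfin htop hβ, ← mul_assoc, ← Real.exp_add, neg_add_cancel,
    Real.exp_zero]
  ring

/-- Squaring the weight moves the tilt from β to 2β at the cost exp(ψ(2β) - 2ψ(β)), while the
observable stays centred at ψ'(β). -/
lemma neg_integral_sq_tilt (hfin : ∀ t : ℝ, 0 < t → laplace ν t < ∞) (htop : ν {⊤} ≠ 1) {β : ℝ}
    (hβ : 0 < β) :
    -∫ ω, tiltWeight ν β ω ^ 2 * tiltObs ν β ω ∂ν = limitMean ν β := by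
  have h := integral_tilt hfin hβ 1 1
  simp only [one_add_one_eq_two, pow_one, Nat.cast_ofNat] at h
  rw [h, integral_centred_mul_exp hfin htop (by positivity), limitMean, ← mul_assoc,
    ← Real.exp_nat_mul, ← Real.exp_add]
  push_cast
  ring_nf

lemma integral_sq_tilt_sq (hfin : ∀ t : ℝ, 0 < t → laplace ν t < ∞) (htop : ν {⊤} ≠ 1) {β : ℝ}
    (hβ : 0 < β) :
    ∫ ω, tiltWeight ν β ω ^ 2 * tiltObs ν β ω ^ 2 ∂ν = limitVar ν β := by
  have h := integral_tilt hfin hβ 1 2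
  simp only [one_add_one_eq_two, Nat.cast_ofNat] at h
  rw [h, integral_centred_sq_mul_exp hfin htop (by positivity), limitVar, ← mul_assoc,
    ← Real.exp_nat_mul, ← Real.exp_add]
  push_cast
  ring_nf

end LogLaplace

/-! ### From extended real weights to the tilted model. -/

section Translation

variable {n : ℕ} {ν : Measure EReal} {β : ℝ}

/-- Excluding ⊥ rules out the convention ⊤ + ⊥ = ⊥, under which an infinite edge would be lost. -/
lemma exp_neg_mul_add (hβ : 0 < β) {a b : EReal} (ha : a ≠ ⊥) (hb : b ≠ ⊥) :
    EReal.exp (-((β : EReal) * (a + b))) =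
      EReal.exp (-((β : EReal) * a)) * EReal.exp (-((β : EReal) * b)) := by
  induction a with
  | bot => exact absurd rfl ha
  | top => rw [EReal.top_add_of_ne_bot hb, exp_neg_mul_top hβ, zero_mul]
  | coe r =>
    induction b with
    | bot => exact absurd rfl hb
    | top => rw [EReal.add_top_of_ne_bot ha, exp_neg_mul_top hβ, mul_zero]
    | coe s =>
      rw [← EReal.coe_add, exp_neg_mul_coe, exp_neg_mul_coe, exp_neg_mul_coe,
        ← ENNReal.ofReal_mul (Real.exp_nonneg _), ← Real.exp_add]
      ring_nf

lemma sum_ne_bot_and_exp (hβ : 0 < β) {ι : Type*} (s : Finset ι) {v : ι → EReal}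
    (hv : ∀ i ∈ s, v i ≠ ⊥) :
    ∑ i ∈ s, v i ≠ ⊥ ∧ EReal.exp (-((β : EReal) * ∑ i ∈ s, v i)) =
      ∏ i ∈ s, EReal.exp (-((β : EReal) * v i)) := by
  classical
  induction s using Finset.induction_on with
  | empty => simp
  | insert i s hi ih =>
    have h1 := hv i (Finset.mem_insert_self i s)
    obtain ⟨h2, h3⟩ := ih fun j hj => hv j (Finset.mem_insert_of_mem hj)
    rw [Finset.sum_insert hi, Finset.prod_insert hi]
    exact ⟨EReal.add_ne_bot_iff.2 ⟨h1, h2⟩, by rw [exp_neg_mul_add hβ h1 h2, h3]⟩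

lemma boltzmann_eq (hβ : 0 < β) {w : Fin n × Fin n → EReal} (hw : ∀ e, w e ≠ ⊥)
    (π : Equiv.Perm (Fin n)) :
    boltzmann β w π = Real.exp (psi ν β) ^ n * matchWeight (tiltWeight ν β) w π := by
  rw [boltzmann, weight, (sum_ne_bot_and_exp hβ _ fun i _ => hw (i, π i)).2, ENNReal.toReal_prod]
  simp only [matchWeight, tiltWeight, Finset.prod_mul_distrib, Finset.prod_const, Finset.card_univ,
    Fintype.card_fin]
  rw [← mul_assoc, ← mul_pow, ← Real.exp_add, add_neg_cancel, Real.exp_zero, one_pow, one_mul]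
  rfl

lemma partitionFn_eq (hβ : 0 < β) {w : Fin n × Fin n → EReal} (hw : ∀ e, w e ≠ ⊥) :
    partitionFn β w = Real.exp (psi ν β) ^ n * permMean (tiltWeight ν β) w := by
  simp only [partitionFn, boltzmann_eq (ν := ν) hβ hw, permMean_eq, ← Finset.mul_sum, one_div]
  ring

/-- The factors exp(nψ(β)) and n! cancel. If the partition function vanishes, both sides are 0 by
the convention for division. -/
lemma gibbs_eq (hβ : 0 < β) {w : Fin n × Fin n → EReal} (hw : ∀ e, w e ≠ ⊥)
    (π : Equiv.Perm (Fin n)) :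
    gibbs β w π = matchWeight (tiltWeight ν β) w π / ∑ τ, matchWeight (tiltWeight ν β) w τ := by
  rw [gibbs, partitionFn_eq (ν := ν) hβ hw, boltzmann_eq (ν := ν) hβ hw, permMean_eq]
  have h1 : Real.exp (psi ν β) ^ n ≠ 0 := by positivity
  have h2 : (n.factorial : ℝ) ≠ 0 := by positivity
  rcases eq_or_ne (∑ τ, matchWeight (tiltWeight ν β) w τ) 0 with h0 | h0
  · simp [h0]
  · field_simp

lemma gibbsAvg_eq (hβ : 0 < β) {w : Fin n × Fin n → EReal} (hw : ∀ e, w e ≠ ⊥)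
    (f : Equiv.Perm (Fin n) → ℝ) :
    gibbsAvg β w f = ratioMean (tiltWeight ν β) w f := by
  simp only [gibbsAvg, gibbs_eq (ν := ν) hβ hw, ratioMean, Finset.sum_div]
  exact Finset.sum_congr rfl fun π _ => by ring

/-- A nonzero product forces every edge of the matching to be finite, so `EReal.toReal` is additive
on it and each edge receives one copy of ψ'(β). -/
lemma toReal_weight (hβ : 0 < β) {w : Fin n × Fin n → EReal} (hw : ∀ e, w e ≠ ⊥)
    {π : Equiv.Perm (Fin n)} (hπ : matchWeight (tiltWeight ν β) w π ≠ 0) :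
    (weight w π).toReal + n * deriv (psi ν) β = obsSum (tiltObs ν β) w π := by
  have hfin : ∀ i, ∃ r : ℝ, w (i, π i) = r := by
    intro i
    have h1 : tiltWeight ν β (w (i, π i)) ≠ 0 := Finset.prod_ne_zero_iff.1 hπ i (Finset.mem_univ i)
    refine ⟨(w (i, π i)).toReal, (EReal.coe_toReal (fun htop => h1 ?_) (hw _)).symm⟩
    rw [htop, tiltWeight, expWeight_top hβ, mul_zero]
  choose r hr using hfin
  have hsum : ∑ i, (r i : EReal) = ((∑ i, r i : ℝ) : EReal) := by
    induction (Finset.univ : Finset (Fin n)) using Finset.induction_on with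
    | empty => simp
    | insert i s hi ih => rw [Finset.sum_insert hi, Finset.sum_insert hi, ih, EReal.coe_add]
  simp only [weight, obsSum, tiltObs, negReal, hr, hsum, EReal.toReal_coe, sub_neg_eq_add,
    Finset.sum_add_distrib, Finset.sum_const, Finset.card_univ, Fintype.card_fin, nsmul_eq_mul]
  ring

lemma ratioMean_congr {E : Type*} {Y : E → ℝ} {w : Fin n × Fin n → E}
    {f g : Equiv.Perm (Fin n) → ℝ} (hfg : ∀ π, matchWeight Y w π ≠ 0 → f π = g π) :
    ratioMean Y w f = ratioMean Y w g := by
  unfold ratioMean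
  congr 1
  refine Finset.sum_congr rfl fun π _ => ?_
  rcases eq_or_ne (matchWeight Y w π) 0 with h0 | h0
  · simp [h0]
  · rw [hfg π h0]

lemma gibbsAvg_test_eq (hβ : 0 < β) {w : Fin n × Fin n → EReal} (hw : ∀ e, w e ≠ ⊥) (f : ℝ → ℝ) :
    gibbsAvg β w (fun π => f (normalizedWeight ν β w π)) =
      ratioMean (tiltWeight ν β) w (fun π => f ((√(n : ℝ))⁻¹ * obsSum (tiltObs ν β) w π)) := by
  rw [gibbsAvg_eq (ν := ν) hβ hw]
  refine ratioMean_congr fun π hπ => ?_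
  rw [normalizedWeight, toReal_weight hβ hw hπ, div_eq_inv_mul]

lemma ratioMean_add_const {E : Type*} {Y : E → ℝ} {w : Fin n × Fin n → E}
    (f : Equiv.Perm (Fin n) → ℝ) (c : ℝ) (hZ : permMean Y w ≠ 0) :
    ratioMean Y w f + c = ratioMean Y w (fun π => f π + c) := by
  have h2 := right_ne_zero_of_mul (show (n.factorial : ℝ)⁻¹ * ∑ π, matchWeight Y w π ≠ 0 from hZ)
  simp only [ratioMean, mul_add, Finset.sum_add_distrib, ← Finset.sum_mul, add_div]
  rw [mul_div_cancel_left₀ _ h2]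

lemma gibbsAvg_weight_eq (hβ : 0 < β) {w : Fin n × Fin n → EReal} (hw : ∀ e, w e ≠ ⊥)
    (hZ : permMean (tiltWeight ν β) w ≠ 0) :
    gibbsAvg β w (fun π => (weight w π).toReal) + n * deriv (psi ν) β =
      ratioMean (tiltWeight ν β) w (obsSum (tiltObs ν β) w) := by
  rw [gibbsAvg_eq (ν := ν) hβ hw, ratioMean_add_const _ _ hZ]
  exact ratioMean_congr fun π hπ => toReal_weight hβ hw hπ

lemma measurable_weight (π : Equiv.Perm (Fin n)) :
    Measurable fun w : Fin n × Fin n → EReal => weight w π := by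
  unfold weight
  fun_prop

lemma measurable_boltzmann (β : ℝ) (π : Equiv.Perm (Fin n)) :
    Measurable fun w : Fin n × Fin n → EReal => boltzmann β w π := by
  have := measurable_weight π
  unfold boltzmann
  fun_prop

lemma measurable_gibbs (β : ℝ) (π : Equiv.Perm (Fin n)) :
    Measurable fun w : Fin n × Fin n → EReal => gibbs β w π := by
  have := measurable_boltzmann (n := n) β
  unfold gibbs partitionFn
  fun_prop

lemma measurable_gibbsAvg (β : ℝ) {f : (Fin n × Fin n → EReal) → Equiv.Perm (Fin n) → ℝ}
    (hf : ∀ π, Measurable fun w => f w π) :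
    Measurable fun w : Fin n × Fin n → EReal => gibbsAvg β w (f w) := by
  have := measurable_gibbs (n := n) β
  unfold gibbsAvg
  fun_prop

lemma measurable_normalizedWeight (ν : Measure EReal) (β : ℝ) (π : Equiv.Perm (Fin n)) :
    Measurable fun w : Fin n × Fin n → EReal => normalizedWeight ν β w π := by
  have := measurable_weight π
  unfold normalizedWeight
  fun_prop

end Translation

/-! ### Conditioning a Gibbs sample on the weights. -/

section Sampling

variable {n : ℕ} {β : ℝ} {Ω : Type*} [MeasurableSpace Ω] {P : Measure Ω}
  {w : Ω → Fin n × Fin n → EReal} {π : Ω → Equiv.Perm (Fin n)}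
  {A : Set (Fin n × Fin n → EReal)}

lemma gibbs_nonneg (v : Fin n × Fin n → EReal) (τ : Equiv.Perm (Fin n)) : 0 ≤ gibbs β v τ := by
  have h : ∀ τ, 0 ≤ boltzmann β v τ := fun τ => ENNReal.toReal_nonneg
  have h' : 0 ≤ ∑ τ, boltzmann β v τ := Finset.sum_nonneg fun τ _ => h τ
  have := h τ
  unfold gibbs partitionFn
  positivity

/-- The sampling identity is available only for sets of weights with nonzero partition function, so
the conditional density is identified after restricting to such a set A. -/
lemma IsGibbsSample.map_restrict (hπ : IsGibbsSample P β w π) (hw : AEMeasurable w P)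
    (hA : MeasurableSet A) (hA' : ∀ v ∈ A, partitionFn β v ≠ 0) (τ : Equiv.Perm (Fin n)) :
    ((P.restrict {a | π a = τ}).map w).restrict A =
      ((P.map w).withDensity fun v => ENNReal.ofReal (gibbs β v τ)).restrict A := by
  ext B hB
  have hBA := hB.inter hA
  have hm : Measurable fun v : Fin n × Fin n → EReal => ENNReal.ofReal (gibbs β v τ) :=
    (measurable_gibbs β τ).ennreal_ofReal
  rw [Measure.restrict_apply hB, Measure.restrict_apply hB,
    Measure.map_apply_of_aemeasurable hw.restrict hBA,
    Measure.restrict_apply' (hπ.1 τ), withDensity_apply _ hBA, Measure.restrict_map_of_aemeasurable hw hBA,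
    lintegral_map' hm.aemeasurable hw.restrict]
  exact hπ.2 τ (B ∩ A) hBA fun v hv => hA' v hv.2

lemma IsGibbsSample.setIntegral (hπ : IsGibbsSample P β w π) (hw : AEMeasurable w P)
    (hA : MeasurableSet A) (hA' : ∀ v ∈ A, partitionFn β v ≠ 0) (τ : Equiv.Perm (Fin n))
    {g : (Fin n × Fin n → EReal) → ℝ} (hg : Measurable g) :
    ∫ a in {a | π a = τ}, A.indicator g (w a) ∂P =
      ∫ a, A.indicator (fun v => gibbs β v τ * g v) (w a) ∂P := by
  have hm : Measurable fun v : Fin n × Fin n → EReal => ENNReal.ofReal (gibbs β v τ) :=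
    (measurable_gibbs β τ).ennreal_ofReal
  have hm' : Measurable fun v => gibbs β v τ * g v := (measurable_gibbs β τ).mul hg
  rw [← integral_map (φ := w) hw.restrict (hg.indicator hA).aestronglyMeasurable,
    ← integral_map (φ := w) (f := A.indicator fun v => gibbs β v τ * g v) hw
      (hm'.indicator hA).aestronglyMeasurable,
    integral_indicator hA, integral_indicator hA, hπ.map_restrict hw hA hA' τ,
    restrict_withDensity hA, integral_withDensity_eq_integral_toReal_smul hm
      (Eventually.of_forall fun _ => ENNReal.ofReal_lt_top)]
  simp only [ENNReal.toReal_ofReal (gibbs_nonneg _ _), smul_eq_mul]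

/-- Averaging over a Gibbs sample amounts to taking Gibbs averages. -/
lemma IsGibbsSample.integral_eq [IsProbabilityMeasure P] (hπ : IsGibbsSample P β w π) (hw : AEMeasurable w P)
    (hA : MeasurableSet A) (hA' : ∀ v ∈ A, partitionFn β v ≠ 0)
    {G : (Fin n × Fin n → EReal) → Equiv.Perm (Fin n) → ℝ} (hG : ∀ τ, Measurable fun v => G v τ)
    {K : ℝ} (hK : ∀ v τ, |G v τ| ≤ K) (hgibbs : ∀ v ∈ A, ∀ τ, gibbs β v τ ≤ 1) :
    ∫ a, A.indicator (fun v => G v (π a)) (w a) ∂P =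
      ∫ a, A.indicator (fun v => gibbsAvg β v (G v)) (w a) ∂P := by
  -- Splitting by the finitely many values of π replaces the random matching by a fixed one, for
  -- which the density is known.
  have h1 : ∀ a, A.indicator (fun v => G v (π a)) (w a) =
      ∑ τ, Set.indicator {a | π a = τ} (fun a => A.indicator (fun v => G v τ) (w a)) a := by
    intro a
    rw [Finset.sum_eq_single (π a)]
    · exact (Set.indicator_of_mem (s := {b | π b = π a}) rfl
        fun b => A.indicator (fun v => G v (π a)) (w b)).symm
    · intro τ _ hτ
      exact Set.indicator_of_notMem (by exact hτ.symm) _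
    · simp
  have h2 : ∀ a, A.indicator (fun v => gibbsAvg β v (G v)) (w a) =
      ∑ τ, A.indicator (fun v => gibbs β v τ * G v τ) (w a) := by
    intro a
    by_cases ha : w a ∈ A
    · simp only [Set.indicator_of_mem ha, gibbsAvg]
    · simp only [Set.indicator_of_notMem ha, Finset.sum_const_zero]
  have hK0 : 0 ≤ K := (abs_nonneg _).trans (hK (fun _ => 0) 1)
  have i1 : ∀ τ, Integrable (fun a => A.indicator (fun v => G v τ) (w a)) P := by
    intro τ
    refine Integrable.of_bound
      (((hG τ).indicator hA).comp_aemeasurable hw).aestronglyMeasurable K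
      (Eventually.of_forall fun a => ?_)
    by_cases ha : w a ∈ A
    · rw [Set.indicator_of_mem ha]; exact hK _ _
    · rw [Set.indicator_of_notMem ha, norm_zero]; exact hK0
  have i2 : ∀ τ, Integrable (fun a => A.indicator (fun v => gibbs β v τ * G v τ) (w a)) P := by
    intro τ
    refine Integrable.of_bound
      ((((measurable_gibbs β τ).mul (hG τ)).indicator hA).comp_aemeasurable hw).aestronglyMeasurable
      K (Eventually.of_forall fun a => ?_)
    by_cases ha : w a ∈ A
    · rw [Set.indicator_of_mem ha, norm_mul, Real.norm_of_nonneg (gibbs_nonneg _ _)]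
      exact (mul_le_of_le_one_left (norm_nonneg _) (hgibbs _ ha τ)).trans (hK _ _)
    · rw [Set.indicator_of_notMem ha, norm_zero]; exact hK0
  simp only [h1, h2]
  rw [integral_finsetSum _ fun τ _ => (i1 τ).indicator (hπ.1 τ), integral_finsetSum _ fun τ _ => i2 τ]
  refine Finset.sum_congr rfl fun τ _ => ?_
  rw [integral_indicator (hπ.1 τ), hπ.setIntegral hw hA hA' τ (hG τ)]

end Sampling

/-! ### The limits under the product law of the weights. -/

section Limits

/-- Bounded variables converging in probability to a constant converge in mean. -/
lemma tendsto_integral_of_tendsto_measure {Ω : ℕ → Type*} [∀ n, MeasurableSpace (Ω n)]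
    {P : ∀ n, Measure (Ω n)} [∀ n, IsProbabilityMeasure (P n)] {X : ∀ n, Ω n → ℝ}
    (hX : ∀ n, AEMeasurable (X n) (P n)) {K c : ℝ} (hK : ∀ n, ∀ᵐ a ∂(P n), |X n a| ≤ K)
    (hc : |c| ≤ K)
    (hlim : ∀ ε > 0, Tendsto (fun n => (P n).real {a | ε ≤ |X n a - c|}) atTop (𝓝 0)) :
    Tendsto (fun n => ∫ a, X n a ∂(P n)) atTop (𝓝 c) := by
  have hK0 : 0 ≤ K := (abs_nonneg c).trans hc
  rw [Metric.tendsto_atTop]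
  intro η hη
  -- On the exceptional event the deviation is at most 2K, so probability η/(4(K + 1)) costs less
  -- than η/2.
  obtain ⟨N, hN⟩ := Metric.tendsto_atTop.1 (hlim (η / 2) (half_pos hη)) (η / (4 * (K + 1)))
    (by positivity)
  refine ⟨N, fun n hn => ?_⟩
  have hp := hN n hn
  rw [Real.dist_eq, sub_zero, abs_of_nonneg measureReal_nonneg, lt_div_iff₀ (by positivity)] at hp
  have hS : NullMeasurableSet {a | η / 2 ≤ |X n a - c|} (P n) := by
    have : AEMeasurable (fun a => |X n a - c|) (P n) := by
      have := hX n
      fun_prop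
    exact nullMeasurableSet_le aemeasurable_const this
  have iX : Integrable (X n) (P n) := Integrable.of_bound (hX n).aestronglyMeasurable K (hK n)
  have hsub : ∫ a, X n a ∂(P n) - c = ∫ a, (X n a - c) ∂(P n) := by
    rw [integral_sub iX (integrable_const _)]
    simp
  have iB : Integrable ({a | η / 2 ≤ |X n a - c|}.indicator (fun _ => 2 * K)) (P n) :=
    (integrable_const _).indicator₀ hS
  rw [Real.dist_eq, hsub]
  have bound : ∀ᵐ a ∂(P n), ‖X n a - c‖ ≤
      η / 2 + {a | η / 2 ≤ |X n a - c|}.indicator (fun _ => 2 * K) a := by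
    filter_upwards [hK n] with a ha
    rw [Real.norm_eq_abs]
    by_cases h : η / 2 ≤ |X n a - c|
    · rw [Set.indicator_of_mem (by exact h)]
      have := abs_sub (X n a) c
      linarith
    · rw [Set.indicator_of_notMem (by exact h)]
      linarith
  calc |∫ a, (X n a - c) ∂(P n)| ≤
      ∫ a, (η / 2 + {a | η / 2 ≤ |X n a - c|}.indicator (fun _ => 2 * K) a) ∂(P n) :=
        norm_integral_le_of_norm_le ((integrable_const _).add iB) bound
    _ = η / 2 + (P n).real {a | η / 2 ≤ |X n a - c|} * (2 * K) := by
        rw [integral_add (integrable_const _) iB, integral_indicator₀ hS]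
        simp
    _ < η := by nlinarith [measureReal_nonneg (μ := P n) (s := {a | η / 2 ≤ |X n a - c|})]

lemma abs_ratioMean_le {E : Type*} {n : ℕ} {Y : E → ℝ} (hY : ∀ ω, 0 ≤ Y ω) (w : Fin n × Fin n → E)
    {f : Equiv.Perm (Fin n) → ℝ} {K : ℝ} (hK : ∀ π, |f π| ≤ K) : |ratioMean Y w f| ≤ K := by
  have h0 : ∀ π, 0 ≤ matchWeight Y w π := fun π => Finset.prod_nonneg fun _ _ => hY _
  have hK0 : 0 ≤ K := (abs_nonneg _).trans (hK 1)
  rw [ratioMean, abs_div, abs_of_nonneg (Finset.sum_nonneg fun π _ => h0 π)]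
  refine div_le_of_le_mul₀ (Finset.sum_nonneg fun π _ => h0 π) hK0 ?_
  rw [Finset.mul_sum]
  refine (Finset.abs_sum_le_sum_abs _ _).trans (Finset.sum_le_sum fun π _ => ?_)
  rw [abs_mul, abs_of_nonneg (h0 π), mul_comm]
  exact mul_le_mul_of_nonneg_right (hK π) (h0 π)

/-- The configurations for which the Gibbs measure is given by the tilted weights. -/
def regularSet (ν : Measure EReal) (β : ℝ) (n : ℕ) : Set (Fin n × Fin n → EReal) :=
  {v | (∀ e, v e ≠ ⊥) ∧ permMean (tiltWeight ν β) v ≠ 0}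

lemma gibbs_le_one {ν : Measure EReal} {β : ℝ} (hβ : 0 < β) {n : ℕ} {v : Fin n × Fin n → EReal}
    (hv : v ∈ regularSet ν β n) (τ : Equiv.Perm (Fin n)) : gibbs β v τ ≤ 1 := by
  have h0 : ∀ π, 0 ≤ matchWeight (tiltWeight ν β) v π := fun π =>
    Finset.prod_nonneg fun _ _ => mul_nonneg (Real.exp_nonneg _) (expWeight_nonneg _ _)
  rw [gibbs_eq (ν := ν) hβ hv.1]
  exact div_le_one_of_le₀ (Finset.single_le_sum (fun π _ => h0 π) (Finset.mem_univ τ))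
    (Finset.sum_nonneg fun π _ => h0 π)

variable {ν : Measure EReal} [IsProbabilityMeasure ν]

lemma ae_edgeLaw_ne_bot (hfin : ∀ t : ℝ, 0 < t → laplace ν t < ∞) (n : ℕ) :
    ∀ᵐ v ∂(edgeLaw ν n), ∀ e, v e ≠ ⊥ :=
  ae_all_iff.2 fun e => (Measure.tendsto_eval_ae_ae (μ := fun _ : Fin n × Fin n => ν) (i := e)).eventually
    (ae_ne_bot hfin)

lemma tendsto_measureReal_of_ae_le {Ω : ℕ → Type*} [∀ n, MeasurableSpace (Ω n)]
    {P : ∀ n, Measure (Ω n)} [∀ n, IsProbabilityMeasure (P n)] {S T : ∀ n, Set (Ω n)}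
    (hST : ∀ n, ∀ᵐ a ∂(P n), a ∈ S n → a ∈ T n)
    (hT : Tendsto (fun n => (P n).real (T n)) atTop (𝓝 0)) :
    Tendsto (fun n => (P n).real (S n)) atTop (𝓝 0) :=
  squeeze_zero (fun _ => measureReal_nonneg)
    (fun n => ENNReal.toReal_mono (measure_ne_top _ _) (measure_mono_ae (hST n))) hT

/-- The quenched central limit theorem under the canonical product law. -/
lemma tendsto_measure_gibbsAvg_test (hfin : ∀ t : ℝ, 0 < t → laplace ν t < ∞) (htop : ν {⊤} ≠ 1)
    {β : ℝ} (hβ : 0 < β) (f : ℝ →ᵇ ℝ) {ε : ℝ} (hε : 0 < ε) :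
    Tendsto (fun n => (edgeLaw ν n).real {v | ε ≤
      |gibbsAvg β v (fun π => f (normalizedWeight ν β v π)) -
        ∫ x, f x ∂(gaussianReal 0 (deriv (deriv (psi ν)) β).toNNReal)|}) atTop (𝓝 0) := by
  have h := (isTilt hfin htop hβ).tendsto_measure_ratioMean_test f hε
  rw [integral_tilt_sq hfin htop hβ] at h
  refine tendsto_measureReal_of_ae_le (P := fun n => edgeLaw ν n) (fun n => ?_) h
  filter_upwards [ae_edgeLaw_ne_bot hfin n] with v hv hmem
  change ε ≤ _ at hmem
  rwa [gibbsAvg_test_eq hβ hv] at hmem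

lemma tendsto_gibbsAvg_charFun (hfin : ∀ t : ℝ, 0 < t → laplace ν t < ∞) (htop : ν {⊤} ≠ 1)
    {β : ℝ} (hβ : 0 < β) (t : ℝ) :
    Tendsto (fun n => ∫ v : Fin n × Fin n → EReal, Complex.exp (t *
      (gibbsAvg β v (fun π => (weight v π).toReal) + n * deriv (psi ν) β : ℝ) * Complex.I)
        ∂(edgeLaw ν n)) atTop
      (𝓝 (charFun (gaussianReal (limitMean ν β) (limitVar ν β).toNNReal) t)) := by
  have hT := isTilt hfin htop hβ
  have h := hT.tendsto_ratioMean_charFun t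
  rw [neg_integral_sq_tilt hfin htop hβ, integral_sq_tilt_sq hfin htop hβ] at h
  rw [charFun_gaussianReal, Real.coe_toNNReal _ (limitVar_nonneg hfin htop hβ)]
  refine tendsto_integral_exp_of_close (P := fun n => edgeLaw ν n)
    (X := fun n v => gibbsAvg β v (fun π => (weight v π).toReal) + n * deriv (psi ν) β)
    (fun n => (measurable_gibbsAvg β fun π => (measurable_weight π).ereal_toReal).add_const _)
    (fun n => hT.measurable_ratioMean fun π => hT.measurable_obsSum π) (fun ε hε => ?_) h
  -- The two variables agree almost surely where the permanent is nonzero. Where it vanishes the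
  -- convention leaves the Gibbs average 0 uncentred, but that event has vanishing probability.
  refine tendsto_measureReal_of_ae_le (P := fun n => edgeLaw ν n) (fun n => ?_)
    hT.tendsto_measure_permMean_eq_zero
  filter_upwards [ae_edgeLaw_ne_bot hfin n] with v hv hmem
  change ε ≤ _ at hmem
  by_contra hZ
  rw [gibbsAvg_weight_eq hβ hv hZ, sub_self, abs_zero] at hmem
  exact absurd hmem (not_le.2 hε)

lemma measurableSet_regularSet (hfin : ∀ t : ℝ, 0 < t → laplace ν t < ∞) (htop : ν {⊤} ≠ 1)
    {β : ℝ} (hβ : 0 < β) (n : ℕ) : MeasurableSet (regularSet ν β n) := by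
  have hm := fun π => (isTilt hfin htop hβ).measurable_matchWeight (n := n) π
  have hp : Measurable fun v : Fin n × Fin n → EReal => permMean (tiltWeight ν β) v := by
    simp only [permMean_eq]
    fun_prop
  have h1 : MeasurableSet {v : Fin n × Fin n → EReal | ∀ e, v e ≠ ⊥} := by
    simp only [Set.ofPred_forall]
    exact MeasurableSet.iInter fun e =>
      (measurable_pi_apply e (measurableSet_singleton ⊥)).compl
  exact h1.inter (hp (measurableSet_singleton 0)).compl

lemma tendsto_measure_compl_regularSet (hfin : ∀ t : ℝ, 0 < t → laplace ν t < ∞)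
    (htop : ν {⊤} ≠ 1) {β : ℝ} (hβ : 0 < β) :
    Tendsto (fun n => (edgeLaw ν n).real (regularSet ν β n)ᶜ) atTop (𝓝 0) := by
  refine tendsto_measureReal_of_ae_le (P := fun n => edgeLaw ν n) (fun n => ?_)
    (isTilt hfin htop hβ).tendsto_measure_permMean_eq_zero
  filter_upwards [ae_edgeLaw_ne_bot hfin n] with v hv hmem
  by_contra hZ
  exact hmem ⟨hv, hZ⟩

end Limits

end GibbsMatching

/-! ### Transfer to arbitrary probability spaces and conclusion. -/

open GibbsMatching in
theorem theorem1p3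
    (ν : Measure EReal) [IsProbabilityMeasure ν]
    (hν_fin : ∀ t : ℝ, 0 < t → GibbsMatching.laplace ν t < ∞)
    (hν_top : ν {⊤} ≠ 1)
    (β : ℝ) (hβ : 0 < β)
    {Ω : ℕ → Type*} [∀ n, MeasurableSpace (Ω n)]
    (P : ∀ n, Measure (Ω n)) [∀ n, IsProbabilityMeasure (P n)]
    (w : ∀ n, Ω n → Fin n × Fin n → EReal)
    (hw_law : ∀ n e, HasLaw (fun a => w n a e) ν (P n))
    (hw_indep : ∀ n, iIndepFun (fun e a => w n a e) (P n)) :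
    -- the derivatives exist and the limiting variances are nonnegative
    (ContDiffOn ℝ 2 (GibbsMatching.psi ν) (Set.Ioi 0) ∧
      0 ≤ deriv (deriv (GibbsMatching.psi ν)) β ∧ 0 ≤ GibbsMatching.limitVar ν β) ∧
    -- typical matching, jointly over the weights and the Gibbs sample
    (∀ π : ∀ n, Ω n → Equiv.Perm (Fin n),
      (∀ n, GibbsMatching.IsGibbsSample (P n) β (w n) (π n)) →
      TendstoInDistribution
        (fun n a => GibbsMatching.normalizedWeight ν β (w n a) (π n a)) atTop (id : ℝ → ℝ) P
        (gaussianReal 0 (deriv (deriv (GibbsMatching.psi ν)) β).toNNReal)) ∧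
    -- typical matching, quenched: weak convergence of the Gibbs law, in probability over the weights
    (∀ (f : ℝ →ᵇ ℝ) (ε : ℝ), 0 < ε →
      Tendsto (fun n => P n {a | ε ≤
          |GibbsMatching.gibbsAvg β (w n a)
              (fun π => f (GibbsMatching.normalizedWeight ν β (w n a) π)) -
            ∫ x, f x ∂(gaussianReal 0 (deriv (deriv (GibbsMatching.psi ν)) β).toNNReal)|})
        atTop (𝓝 0)) ∧
    -- the Gibbs average
    TendstoInDistribution
      (fun n a => GibbsMatching.gibbsAvg β (w n a)
          (fun π => (GibbsMatching.weight (w n a) π).toReal) +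
        n * deriv (GibbsMatching.psi ν) β) atTop (id : ℝ → ℝ) P
      (gaussianReal (GibbsMatching.limitMean ν β) (GibbsMatching.limitVar ν β).toNNReal) := by
  have hw : ∀ n, AEMeasurable (w n) (P n) := fun n =>
    aemeasurable_pi_lambda _ fun e => (hw_law n e).aemeasurable
  have hmap : ∀ n, (P n).map (w n) = edgeLaw ν n := by
    intro n
    have := (hw_indep n).map_fun_eq_pi_map fun e => (hw_law n e).aemeasurable
    simp only [(hw_law n _).map_eq] at this
    exact this
  have hpush : ∀ n (S : Set (Fin n × Fin n → EReal)), MeasurableSet S →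
      P n {a | w n a ∈ S} = edgeLaw ν n S := by
    intro n S hS
    rw [← hmap n, Measure.map_apply_of_aemeasurable (hw n) hS]
    rfl
  set γ := gaussianReal 0 (deriv (deriv (psi ν)) β).toNNReal with hγ
  have hmG : ∀ (f : ℝ →ᵇ ℝ) n, Measurable fun v : Fin n × Fin n → EReal =>
      gibbsAvg β v (fun π => f (normalizedWeight ν β v π)) := fun f n =>
    measurable_gibbsAvg β fun π => f.continuous.measurable.comp (measurable_normalizedWeight ν β π)
  have hquenched : ∀ (f : ℝ →ᵇ ℝ) (ε : ℝ), 0 < ε →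
      Tendsto (fun n => P n {a | ε ≤ |gibbsAvg β (w n a)
        (fun π => f (normalizedWeight ν β (w n a) π)) - ∫ x, f x ∂γ|}) atTop (𝓝 0) := by
    intro f ε hε
    have h := tendsto_measure_gibbsAvg_test hν_fin hν_top hβ f hε
    have h' := ENNReal.tendsto_ofReal h
    rw [ENNReal.ofReal_zero] at h'
    refine h'.congr fun n => ?_
    rw [ofReal_measureReal]
    refine (hpush n _ ?_).symm
    have := hmG f n
    exact measurableSet_le measurable_const (by fun_prop)
  refine ⟨⟨contDiffOn_psi hν_fin, deriv_deriv_psi_nonneg hν_fin hν_top hβ,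
    limitVar_nonneg hν_fin hν_top hβ⟩, fun π hπ => ?_, hquenched, ?_⟩
  · have hX : ∀ n, AEMeasurable (fun a => normalizedWeight ν β (w n a) (π n a)) (P n) := by
      intro n
      -- Only the level sets of π are assumed measurable, so measurability is obtained by a finite
      -- decomposition over them.
      have h1 : (fun a => normalizedWeight ν β (w n a) (π n a)) = fun a => ∑ τ,
          Set.indicator {a | π n a = τ} (fun a => normalizedWeight ν β (w n a) τ) a := by
        funext a
        rw [Finset.sum_eq_single (π n a)]
        · rw [Set.indicator_of_mem (by rfl)]
        · intro τ _ hτ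
          exact Set.indicator_of_notMem (by exact hτ.symm) _
        · simp
      rw [h1]
      exact Finset.aemeasurable_fun_sum _ fun τ _ =>
        ((measurable_normalizedWeight ν β τ).comp_aemeasurable (hw n)).indicator ((hπ n).1 τ)
    refine ⟨hX, aemeasurable_id, ?_⟩
    refine ProbabilityMeasure.tendsto_iff_forall_integral_tendsto.2 fun f => ?_
    simp only [ProbabilityMeasure.coe_mk, Measure.map_id]
    have hf : ∀ n, ∫ y, f y ∂((P n).map fun a => normalizedWeight ν β (w n a) (π n a)) =
        ∫ a, f (normalizedWeight ν β (w n a) (π n a)) ∂(P n) := fun n =>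
      integral_map (hX n) f.continuous.aestronglyMeasurable
    simp only [hf]
    let A := fun n => regularSet ν β n
    have hA : ∀ n, MeasurableSet (A n) := measurableSet_regularSet hν_fin hν_top hβ
    have hAc : Tendsto (fun n => (P n).real {a | w n a ∉ A n}) atTop (𝓝 0) :=
      (tendsto_measure_compl_regularSet hν_fin hν_top hβ).congr fun n =>
        congrArg ENNReal.toReal (hpush n _ (hA n).compl).symm
    have hG : ∀ n τ, Measurable fun v : Fin n × Fin n → EReal => f (normalizedWeight ν β v τ) :=
      fun n τ => f.continuous.measurable.comp (measurable_normalizedWeight ν β τ)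
    -- On the regular set the sample may be averaged out given the weights, which reduces the joint
    -- limit to the quenched one.
    have hcond : ∀ n, ∫ a, (A n).indicator (fun v => f (normalizedWeight ν β v (π n a))) (w n a)
        ∂(P n) = ∫ a, (A n).indicator (fun v => gibbsAvg β v
          (fun τ => f (normalizedWeight ν β v τ))) (w n a) ∂(P n) := fun n =>
      (hπ n).integral_eq (hw n) (hA n)
        (fun v hv => by
          rw [partitionFn_eq (ν := ν) hβ hv.1]
          exact mul_ne_zero (by positivity) hv.2)
        (hG n) (fun v τ => f.norm_coe_le_norm _) fun v hv τ => gibbs_le_one hβ hv τ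
    have hc : |∫ x, f x ∂γ| ≤ ‖f‖ := by
      have := norm_integral_le_of_norm_le_const (μ := γ) (Eventually.of_forall f.norm_coe_le_norm)
      simpa using this
    have hlimA : Tendsto (fun n => ∫ a, (A n).indicator (fun v => gibbsAvg β v
          (fun τ => f (normalizedWeight ν β v τ))) (w n a) ∂(P n)) atTop (𝓝 (∫ x, f x ∂γ)) := by
      refine tendsto_integral_of_tendsto_measure (K := ‖f‖)
        (X := fun n a => (A n).indicator (fun v => gibbsAvg β v
          (fun τ => f (normalizedWeight ν β v τ))) (w n a))
        (fun n => ((hmG f n).indicator (hA n)).comp_aemeasurable (hw n))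
        (fun n => Eventually.of_forall fun a => ?_) hc fun ε hε => ?_
      · by_cases ha : w n a ∈ A n
        · rw [Set.indicator_of_mem ha, gibbsAvg_eq (ν := ν) hβ ha.1]
          exact abs_ratioMean_le (isTilt hν_fin hν_top hβ).nonneg _ fun τ => f.norm_coe_le_norm _
        · rw [Set.indicator_of_notMem ha, abs_zero]
          exact norm_nonneg f
      · have hq : Tendsto (fun n => (P n).real {a | ε ≤ |gibbsAvg β (w n a)
            (fun π => f (normalizedWeight ν β (w n a) π)) - ∫ x, f x ∂γ|}) atTop (𝓝 0) := by
          have := (ENNReal.tendsto_toReal ENNReal.zero_ne_top).comp (hquenched f ε hε)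
          exact this
        have hsum := hq.add hAc
        rw [add_zero] at hsum
        refine squeeze_zero (fun _ => measureReal_nonneg) (fun n => ?_) hsum
        refine (measureReal_mono ?_).trans (measureReal_union_le _ _)
        intro a ha
        by_cases hmem : w n a ∈ A n
        · left
          simpa only [Set.mem_ofPred_eq, Set.indicator_of_mem hmem] using ha
        · exact Or.inr hmem
    -- Off the regular set the sample is arbitrary, but f is bounded and the event has vanishing
    -- probability.
    have hdiff : Tendsto (fun n => ∫ a, f (normalizedWeight ν β (w n a) (π n a)) ∂(P n) -
        ∫ a, (A n).indicator (fun v => f (normalizedWeight ν β v (π n a))) (w n a) ∂(P n)) atTop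
        (𝓝 0) := by
      have hb : Tendsto (fun n => ‖f‖ * (P n).real {a | w n a ∉ A n}) atTop (𝓝 0) := by
        simpa using hAc.const_mul ‖f‖
      refine squeeze_zero_norm (fun n => ?_) hb
      have hAn : NullMeasurableSet {a | w n a ∈ A n} (P n) := (hw n).nullMeasurable (hA n)
      have iX : Integrable (fun a => f (normalizedWeight ν β (w n a) (π n a))) (P n) :=
        Integrable.of_bound (f.continuous.measurable.comp_aemeasurable (hX n)).aestronglyMeasurable
          ‖f‖ (Eventually.of_forall fun a => f.norm_coe_le_norm _)
      have e1 : ∀ a, (A n).indicator (fun v => f (normalizedWeight ν β v (π n a))) (w n a) =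
          Set.indicator {a | w n a ∈ A n} (fun a => f (normalizedWeight ν β (w n a) (π n a))) a :=
        fun a => rfl
      simp only [e1]
      rw [← integral_sub iX (iX.indicator₀ hAn)]
      have bound : ∀ a, ‖f (normalizedWeight ν β (w n a) (π n a)) -
          Set.indicator {a | w n a ∈ A n} (fun a => f (normalizedWeight ν β (w n a) (π n a))) a‖ ≤
          Set.indicator {a | w n a ∉ A n} (fun _ => ‖f‖) a := by
        intro a
        by_cases ha : w n a ∈ A n
        · rw [Set.indicator_of_mem (by exact ha), sub_self, norm_zero]
          exact Set.indicator_nonneg (fun _ _ => norm_nonneg f) a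
        · rw [Set.indicator_of_notMem (by exact ha), sub_zero, Set.indicator_of_mem (by exact ha)]
          exact f.norm_coe_le_norm _
      refine (norm_integral_le_of_norm_le ((integrable_const _).indicator₀ hAn.compl)
        (Eventually.of_forall bound)).trans (le_of_eq ?_)
      rw [integral_indicator₀ hAn.compl]
      rw [setIntegral_const, smul_eq_mul, mul_comm]
      rfl
    have := hdiff.add hlimA
    rw [zero_add] at this
    refine this.congr fun n => ?_
    rw [← hcond n, sub_add_cancel]
  · have hmF : ∀ n, Measurable fun v : Fin n × Fin n → EReal =>
        gibbsAvg β v (fun π => (weight v π).toReal) + n * deriv (psi ν) β := fun n =>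
      (measurable_gibbsAvg β fun π => (measurable_weight π).ereal_toReal).add_const _
    have hX : ∀ n, AEMeasurable (fun a =>
        gibbsAvg β (w n a) (fun π => (weight (w n a) π).toReal) + n * deriv (psi ν) β) (P n) :=
      fun n => (hmF n).comp_aemeasurable (hw n)
    refine ⟨hX, aemeasurable_id, ?_⟩
    refine ProbabilityMeasure.tendsto_iff_tendsto_charFun.2 fun t => ?_
    simp only [ProbabilityMeasure.coe_mk, Measure.map_id]
    refine (tendsto_gibbsAvg_charFun hν_fin hν_top hβ t).congr fun n => ?_
    rw [charFun_apply_real, ← hmap n]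
    have hme : Measurable fun v : Fin n × Fin n → EReal => Complex.exp (t *
        (gibbsAvg β v (fun π => (weight v π).toReal) + n * deriv (psi ν) β : ℝ) * Complex.I) := by
      have := hmF n
      fun_prop
    rw [integral_map (hw n) hme.aestronglyMeasurable,
      integral_map (hX n) (by fun_prop)]
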